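/- Let $$\mathcal R(s)=\int_{0\swarrow 1}\frac{x^{-s}e^{\pi i x^2}}{e^{\pi i x}-e^{-\pi i x}}\,dx\qquad(s\in\mathbb C)$$ be Riemann's auxiliary function, where the path $0\swarrow1$ is the straight line $x=\tfrac12-e^{\pi i/4}u$, with $u$ running from $-\infty$ to $+\infty$ (a line of slope $1$ that crosses the real axis between $0$ and $1$, traversed from upper right to lower left), and $x^{-s}=e^{-s\log x}$ with the principal branch of the logarithm. For $T>0$ let $N(T)$ be the number of zeros $\rho=\beta+i\gamma$ of $\mathcal R(s)$ with $0<\gamma\le T$, counted with multiplicity. Then $N(T)$ is finite for every $T$, and, as $T\to+\infty$, $$N(T)=\frac{T}{4\pi}\log\frac{T}{2\pi}-\frac{T}{4\pi}-\frac12\sqrt{\frac{T}{2\pi}}+O\bigl(T^{2/5}\log^2T\bigr).$$ -/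

import Mathlib

open Complex Filter Asymptotics

noncomputable section

/-- The straight path `0 ↙ 1`: the line through `1/2` with direction `-e^{πi/4}`. It crosses the real
axis only at `1/2`, and it is described from the upper right to the lower left as `u` increases. -/
def siegelPath (u : ℝ) : ℂ := 1 / 2 - Complex.exp (Real.pi * I / 4) * u

/-- The integrand `x^{-s} e^{πix²} / (e^{πix} - e^{-πix})`. The power is the principal one; the path
`0 ↙ 1` does not meet the cut `(-∞, 0]`. -/
def riemannAuxIntegrand (s x : ℂ) : ℂ :=
  x ^ (-s) * Complex.exp (Real.pi * I * x ^ 2) /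
    (Complex.exp (Real.pi * I * x) - Complex.exp (-(Real.pi * I * x)))

/-- Riemann's auxiliary function `R(s) = ∫_{0 ↙ 1} x^{-s} e^{πix²} / (e^{πix} - e^{-πix}) dx`. -/
def riemannAux (s : ℂ) : ℂ :=
  ∫ u : ℝ, riemannAuxIntegrand s (siegelPath u) * deriv siegelPath u

/-- The zeros `β + iγ` of `R(s)` with `0 < γ ≤ T`. -/
def riemannAuxZeros (T : ℝ) : Set ℂ :=
  {s : ℂ | riemannAux s = 0 ∧ 0 < s.im ∧ s.im ≤ T}

/-- The number `N(T)` of zeros of `R(s)` with `0 < γ ≤ T`, counted with multiplicity. -/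
def riemannAuxN (T : ℝ) : ℕ :=
  ∑ᶠ s ∈ riemannAuxZeros T, analyticOrderNatAt riemannAux s

end

open Complex Filter Asymptotics Topology Set MeasureTheory

/-! Zeros are counted by the variation of the argument around the rectangle with vertical sides `σ =
-X` and `σ = 3` between a fixed height `t₀` and `T`, where `X = T^{2/5} log T`.

Right and upper edges. Moving the line of integration across the poles `1, …, N` with `N` about
`√(t/2π)` gives `R(s) = ∑_{n ≤ N} n^{-s}` minus an integral close to the saddle point of `x^{-s}
e^{πix²}`, where the integrand is dominated by a Gaussian (`riemannAux_eq_sum_sub_auxLine`,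
`arg_mul_sub_le`). Hence `R` is within `1/2` of `1` for `σ ≥ 3` and large `t`, and it has polynomial
growth with exponent linear in `|σ|`. The argument varies by `O(1)` on the right edge and, by Jensen
and Borel–Carathéodory (`abs_log_variation_le_of_norm_le`), by `O(X log T)` on the upper edge.

Left edge. For `σ ≤ -1` the line can be moved to the origin and folded into one ray
(`riemannAux_eq_auxRay`). There `1/(e^{πix} - e^{-πix})` is expanded in powers of `e^{2πix}`. With
`η = √(s/2πi)`, the `k`-th term has its saddle near `η - (2k+1)/4`; the resulting phases are the
signs `+ - - +`, and summation over `k` gives `(1 - q)/(1 + q²)` with `q = e^{2πiη}`. So `R(s)` is a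
constant times `e^{auxPhase s} (1 - e^{πis}) (1 - q)/(1 + q²) (1 + δ)` with `‖δ‖ ≤ 1/2`, as long as
`min(Im η, 1)^5 ‖η‖` is large (`exists_auxRay_asymptotic`). The factors beside the exponential have
bounded argument, so the variation is that of `Im auxPhase` up to `O(1)`. At `-X + iT` this is
`-(T/2 log(T/2π) - T/2 - π√(T/2π)) + O(X)`; the square root comes from the summand `πiη` of the
phase.

The exponent. On `σ = -X` at height near `T` one has `‖η‖ ≍ √T` and `Im η ≍ X/√T`, so validity of
the left asymptotics means `X^5 ≫ T²`. The total error is then `O(X log T)`.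

The argument principle enters through two explicit logarithms of `∏ (s - ρ)^m`, one with all cuts
running left, the other with all cuts running right. The first is continuous along the lower, right
and upper edges, the second along the left edge, and at the two left corners they differ by `±π` for
every zero (`two_pi_mul_sum_eq`). -/

/-! ### Contour shifts by means of primitives on convex sets -/

theorem norm_primitive_sub_le {F f : ℂ → ℂ} {U : Set ℂ} (hF : ∀ z ∈ U, HasDerivWithinAt F (f z) U z)
    {a b : ℂ} (hab : segment ℝ a b ⊆ U) {C : ℝ} (hC : ∀ z ∈ segment ℝ a b, ‖f z‖ ≤ C) :
    ‖F b - F a‖ ≤ C * ‖b - a‖ :=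
  (convex_segment a b).norm_image_sub_le_of_norm_hasDerivWithin_le
    (fun z hz => (hF z (hab hz)).mono hab) hC (left_mem_segment ℝ a b) (right_mem_segment ℝ a b)

theorem intervalIntegral_primitive {F f : ℂ → ℂ} {U : Set ℂ} (hU : IsOpen U)
    (hF : ∀ z ∈ U, HasDerivWithinAt F (f z) U z) (hf : ContinuousOn f U) (c d : ℂ) {a b : ℝ}
    (hm : ∀ y ∈ uIcc a b, c + d * (y : ℂ) ∈ U) :
    ∫ y in a..b, f (c + d * y) * d = F (c + d * b) - F (c + d * a) := by
  refine intervalIntegral.integral_eq_sub_of_hasDerivAt (f := fun y : ℝ => F (c + d * y)) ?_ ?_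
  · intro y hy
    have h1 : HasDerivAt F (f (c + d * y)) (c + d * (y : ℂ)) :=
      (hF _ (hm y hy)).hasDerivAt (hU.mem_nhds (hm y hy))
    have h2 : HasDerivAt (fun z : ℂ => c + d * z) d (y : ℂ) := by
      simpa using ((hasDerivAt_id (y : ℂ)).const_mul d).const_add c
    exact (HasDerivAt.comp (y : ℂ) h1 h2).comp_ofReal
  · refine ContinuousOn.intervalIntegrable ?_
    refine ContinuousOn.mul ?_ continuousOn_const
    exact hf.comp (by fun_prop) (fun y hy => hm y hy)

theorem slantedStrip_convex (α β : ℝ) : Convex ℝ {z : ℂ | α < z.re - z.im ∧ z.re - z.im < β} := by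
  have h : IsLinearMap ℝ (fun z : ℂ => z.re - z.im) :=
    ⟨fun x y => by simp; ring, fun c x => by simp; ring⟩
  exact (convex_halfSpace_gt h α).inter (convex_halfSpace_lt h β)

theorem slantedStrip_isOpen (α β : ℝ) : IsOpen {z : ℂ | α < z.re - z.im ∧ z.re - z.im < β} :=
  (isOpen_lt (f := fun _ : ℂ => α) (g := fun z : ℂ => z.re - z.im) (by fun_prop) (by fun_prop)).inter
    (isOpen_lt (f := fun z : ℂ => z.re - z.im) (g := fun _ : ℂ => β) (by fun_prop) (by fun_prop))

theorem slantedStrip_mem {α β c : ℝ} (h1 : α < c) (h2 : c < β) (y : ℝ) :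
    (c : ℂ) + (1 + I) * y ∈ {z : ℂ | α < z.re - z.im ∧ z.re - z.im < β} := by
  simp [h1, h2]

/-- Shift of a line of slope one inside a strip where the integrand is holomorphic. -/
theorem integral_slantedLine_eq {f : ℂ → ℂ} {α β c₁ c₂ : ℝ}
    (hf : DifferentiableOn ℂ f {z : ℂ | α < z.re - z.im ∧ z.re - z.im < β})
    (h1 : α < c₁) (h12 : c₁ ≤ c₂) (h2 : c₂ < β)
    (hi₁ : Integrable fun y : ℝ => f (c₁ + (1 + I) * y))
    (hi₂ : Integrable fun y : ℝ => f (c₂ + (1 + I) * y))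
    {b : ℝ → ℝ} (hbt : Tendsto b atTop (𝓝 0)) (hbb : Tendsto b atBot (𝓝 0))
    (hb : ∀ y : ℝ, 1 ≤ |y| → ∀ c ∈ Icc c₁ c₂, ‖f (c + (1 + I) * y)‖ ≤ b y) :
    ∫ y : ℝ, f (c₁ + (1 + I) * y) * (1 + I) = ∫ y : ℝ, f (c₂ + (1 + I) * y) * (1 + I) := by
  -- The strip is convex, so `f` has a primitive `F`. The truncated integrals are increments of `F`,
  -- and their difference is the increment of `F` across the two horizontal ends, which `b` makes
  -- small.
  obtain ⟨F, hF⟩ := (slantedStrip_convex α β).exists_forall_hasDerivWithinAt hf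
  have hm : ∀ c ∈ Icc c₁ c₂, ∀ y : ℝ, (c : ℂ) + (1 + I) * y ∈
      {z : ℂ | α < z.re - z.im ∧ z.re - z.im < β} :=
    fun c hc y => slantedStrip_mem (h1.trans_le hc.1) (hc.2.trans_lt h2) y
  have m1 : c₁ ∈ Icc c₁ c₂ := ⟨le_rfl, h12⟩
  have m2 : c₂ ∈ Icc c₁ c₂ := ⟨h12, le_rfl⟩
  have key : ∀ y : ℝ, 1 ≤ |y| → ‖F (c₂ + (1 + I) * y) - F (c₁ + (1 + I) * y)‖ ≤ b y * (c₂ - c₁) := by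
    intro y hy
    have hseg : ∀ z ∈ segment ℝ ((c₁ : ℂ) + (1 + I) * y) (c₂ + (1 + I) * y),
        ∃ c ∈ Icc c₁ c₂, z = c + (1 + I) * y := by
      rintro z ⟨p, q, hp, hq, hpq, rfl⟩
      refine ⟨p * c₁ + q * c₂, ⟨?_, ?_⟩, ?_⟩
      · obtain rfl : p = 1 - q := by linarith
        nlinarith [mul_le_mul_of_nonneg_left h12 hq]
      · obtain rfl : p = 1 - q := by linarith
        nlinarith [mul_le_mul_of_nonneg_left h12 hp]
      · have : (p : ℂ) + q = 1 := by exact_mod_cast hpq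
        simp only [real_smul]
        push_cast
        linear_combination (1 + I) * y * this
    have := norm_primitive_sub_le hF (a := (c₁ : ℂ) + (1 + I) * y) (b := c₂ + (1 + I) * y) (C := b y)
      (by intro z hz; obtain ⟨c, hc, rfl⟩ := hseg z hz; exact hm c hc y)
      (by intro z hz; obtain ⟨c, hc, rfl⟩ := hseg z hz; exact hb y hy c hc)
    have e : ‖(c₂ : ℂ) + (1 + I) * y - (c₁ + (1 + I) * y)‖ = c₂ - c₁ := by
      rw [add_sub_add_right_eq_sub, ← ofReal_sub, norm_real, Real.norm_of_nonneg (by linarith)]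
    rwa [e] at this
  have lim : ∀ l : Filter ℝ, Tendsto b l (𝓝 0) → (∀ᶠ y in l, 1 ≤ |y|) →
      Tendsto (fun y : ℝ => F (c₂ + (1 + I) * y) - F (c₁ + (1 + I) * y)) l (𝓝 0) := by
    intro l hl h
    refine squeeze_zero_norm' (h.mono key) ?_
    simpa using hl.mul_const (c₂ - c₁)
  have lt := lim atTop hbt ((eventually_ge_atTop 1).mono fun y hy => hy.trans (le_abs_self y))
  have lb := (lim atBot hbb ((eventually_le_atBot (-1)).mono fun y hy => by
    rw [le_abs]; right; linarith)).comp tendsto_neg_atTop_atBot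
  have t1 := intervalIntegral_tendsto_integral (hi₁.mul_const (1 + I)) tendsto_neg_atTop_atBot tendsto_id
  have t2 := intervalIntegral_tendsto_integral (hi₂.mul_const (1 + I)) tendsto_neg_atTop_atBot tendsto_id
  have t3 := t2.sub t1
  have t4 : Tendsto (fun R : ℝ => (∫ y in (-R)..R, f (c₂ + (1 + I) * y) * (1 + I)) -
      ∫ y in (-R)..R, f (c₁ + (1 + I) * y) * (1 + I)) atTop (𝓝 0) := by
    have := lt.sub lb
    rw [sub_zero] at this
    refine this.congr fun R => ?_
    rw [intervalIntegral_primitive (slantedStrip_isOpen α β) hF hf.continuousOn _ _ (fun y _ => hm c₁ m1 y),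
      intervalIntegral_primitive (slantedStrip_isOpen α β) hF hf.continuousOn _ _ (fun y _ => hm c₂ m2 y)]
    simp only [Function.comp_apply]
    ring
  have := tendsto_nhds_unique t3 t4
  exact (sub_eq_zero.mp this).symm

/-- The ray integral through `D` equals the integral along the path `0 → P → Q → ∞` whose first and
last pieces are radial. -/
theorem integral_ray_eq_path {f : ℂ → ℂ} {U : Set ℂ} (hU : IsOpen U) (hc : Convex ℝ U)
    (hcone : ∀ z ∈ U, ∀ r : ℝ, 0 < r → z * r ∈ U) (hf : DifferentiableOn ℂ f U) {D P Q : ℂ}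
    (hD : D ∈ U) (hP : P ∈ U) (hQ : Q ∈ U)
    (hiD : IntegrableOn (fun r : ℝ => f (D * r) * D) (Ioi 0))
    (hiP : IntegrableOn (fun r : ℝ => f (P * r) * P) (Ioc 0 1))
    (hiQ : IntegrableOn (fun r : ℝ => f (Q * r) * Q) (Ioi 1))
    {b₀ b₁ : ℝ → ℝ} (hb₀ : Tendsto b₀ (𝓝[>] 0) (𝓝 0)) (hb₁ : Tendsto b₁ atTop (𝓝 0))
    (h₀ : ∀ᶠ r : ℝ in 𝓝[>] 0, ∀ z ∈ segment ℝ P D, ‖f (z * r)‖ * r ≤ b₀ r)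
    (h₁ : ∀ᶠ r : ℝ in atTop, ∀ z ∈ segment ℝ Q D, ‖f (z * r)‖ * r ≤ b₁ r) :
    ∫ r in Ioi (0 : ℝ), f (D * r) * D = (∫ r in Ioc (0 : ℝ) 1, f (P * r) * P) +
      (∫ r in (0 : ℝ)..1, f (P + (Q - P) * r) * (Q - P)) + ∫ r in Ioi (1 : ℝ), f (Q * r) * Q := by
  obtain ⟨F, hF⟩ := hc.exists_forall_hasDerivWithinAt hf
  have ray : ∀ z ∈ U, ∀ a b : ℝ, 0 < a → 0 < b →
      ∫ r in a..b, f (z * r) * z = F (z * b) - F (z * a) := by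
    intro z hz a b ha hb
    have := intervalIntegral_primitive hU hF hf.continuousOn 0 z (a := a) (b := b) (by
      intro y hy
      rw [zero_add]
      refine hcone z hz y ?_
      rcases mem_uIcc.mp hy with h | h <;> linarith [h.1])
    simpa using this
  -- The segment from `z * r` to `D * r` has length `r ‖D - z‖`, so smallness of `‖f‖ * r` at `0`
  -- and at infinity closes the contour at both ends.
  have key : ∀ z ∈ U, ∀ (l : Filter ℝ) (b : ℝ → ℝ), Tendsto b l (𝓝 0) → (∀ᶠ r in l, 0 < r) →
      (∀ᶠ r : ℝ in l, ∀ w ∈ segment ℝ z D, ‖f (w * r)‖ * r ≤ b r) →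
      Tendsto (fun r : ℝ => F (D * r) - F (z * r)) l (𝓝 0) := by
    intro z hz l b hb hl h
    refine squeeze_zero_norm' (a := fun r => b r * ‖D - z‖) ?_ (by simpa using hb.mul_const ‖D - z‖)
    filter_upwards [hl, h] with r hr h
    have hseg : ∀ v ∈ segment ℝ (z * r) (D * r), ∃ w ∈ segment ℝ z D, v = w * r := by
      rintro v ⟨p, q, hp, hq, hpq, rfl⟩
      refine ⟨p • z + q • D, ⟨p, q, hp, hq, hpq, rfl⟩, ?_⟩
      simp only [real_smul]
      ring
    have := norm_primitive_sub_le hF (a := z * r) (b := D * r) (C := b r / r)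
      (by intro v hv; obtain ⟨w, hw, rfl⟩ := hseg v hv; exact hcone w (hc.segment_subset hz hD hw) r hr)
      (by
        intro v hv; obtain ⟨w, hw, rfl⟩ := hseg v hv
        rw [le_div_iff₀ hr]; exact h w hw)
    refine this.trans_eq ?_
    rw [← sub_mul, norm_mul, norm_real, Real.norm_of_nonneg hr.le]
    field_simp
  have k0 := key P hP _ b₀ hb₀ (eventually_mem_nhdsWithin) h₀
  have k1 := key Q hQ _ b₁ hb₁ (eventually_gt_atTop 0) h₁
  have mid : ∫ r in (0 : ℝ)..1, f (P + (Q - P) * r) * (Q - P) = F Q - F P := by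
    have := intervalIntegral_primitive hU hF hf.continuousOn P (Q - P) (a := 0) (b := 1) (by
      intro y hy
      rw [uIcc_of_le zero_le_one] at hy
      have := hc.add_smul_sub_mem hP hQ hy
      rwa [real_smul, mul_comm] at this)
    simpa using this
  -- limits of the truncated integrals
  have tz : Tendsto (fun r : ℝ => r⁻¹) atTop (𝓝[>] 0) := tendsto_inv_atTop_nhdsGT_zero
  have tz' : Tendsto (fun r : ℝ => r⁻¹) atTop (𝓝 0) := tz.mono_right nhdsWithin_le_nhds
  have lQ : Tendsto (fun R : ℝ => F (Q * R) - F Q) atTop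
      (𝓝 (∫ r in Ioi (1 : ℝ), f (Q * r) * Q)) := by
    refine (intervalIntegral_tendsto_integral_Ioi 1 hiQ tendsto_id).congr' ?_
    filter_upwards [eventually_gt_atTop 0] with R hR
    simpa using ray Q hQ 1 R one_pos hR
  have lzero : ∀ z ∈ U, IntegrableOn (fun r : ℝ => f (z * r) * z) (Ioc 0 1) →
      Tendsto (fun R : ℝ => F z - F (z * (R⁻¹ : ℝ))) atTop
        (𝓝 (∫ r in Ioc (0 : ℝ) 1, f (z * r) * z)) := by
    intro z hz hi
    rw [← intervalIntegral.integral_of_le zero_le_one]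
    have hcont := intervalIntegral.continuousOn_primitive_interval_left
      (μ := volume) (f := fun r : ℝ => f (z * r) * z) (a := 0) (b := 1) (by
        rw [uIcc_of_le zero_le_one, integrableOn_Icc_iff_integrableOn_Ioc]; exact hi)
    have h0 := (hcont 0 left_mem_uIcc).tendsto
    have tz2 : Tendsto (fun r : ℝ => r⁻¹) atTop (𝓝[uIcc 0 1] 0) := by
      refine tendsto_nhdsWithin_iff.mpr ⟨tz', ?_⟩
      filter_upwards [eventually_ge_atTop 1] with r hr
      rw [uIcc_of_le zero_le_one]
      exact ⟨by positivity, inv_le_one_of_one_le₀ hr⟩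
    refine (h0.comp tz2).congr' ?_
    filter_upwards [eventually_gt_atTop 0] with R hR
    simpa using ray z hz R⁻¹ 1 (by positivity) one_pos
  have lP := lzero P hP hiP
  have lD : Tendsto (fun R : ℝ => F (D * R) - F (D * (R⁻¹ : ℝ))) atTop
      (𝓝 (∫ r in Ioi (0 : ℝ), f (D * r) * D)) := by
    have a1 := intervalIntegral_tendsto_integral_Ioi 1 (hiD.mono_set (Ioi_subset_Ioi zero_le_one))
      tendsto_id
    have hDI : IntegrableOn (fun r : ℝ => f (D * r) * D) (Ioc 0 1) := hiD.mono_set Ioc_subset_Ioi_self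
    have a2 := lzero D hD hDI
    have := a1.add a2
    rw [add_comm (∫ r in Ioi (1 : ℝ), f (D * r) * D), ← setIntegral_union Ioc_disjoint_Ioi_same
      measurableSet_Ioi hDI (hiD.mono_set (Ioi_subset_Ioi zero_le_one)),
      Ioc_union_Ioi_eq_Ioi zero_le_one] at this
    refine this.congr' ?_
    filter_upwards [eventually_gt_atTop 0] with R hR
    rw [ray D hD 1 _ one_pos (by simpa using hR)]
    simp
  rw [mid]
  have := ((lP.add_const (F Q - F P)).add lQ).add (k1.sub (k0.comp tz))
  rw [sub_zero, add_zero] at this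
  refine tendsto_nhds_unique lD (this.congr fun R => ?_)
  simp only [Function.comp_apply]
  ring

/-! ### Size of the integrand on lines of slope one -/

/-- The numerator `x^{-s} e^{πix²}` of the integrand. -/
noncomputable def auxKernel (s x : ℂ) : ℂ := x ^ (-s) * Complex.exp (Real.pi * I * x ^ 2)

/-- The denominator `e^{πix} - e^{-πix}` of the integrand. -/
noncomputable def auxDenom (x : ℂ) : ℂ :=
  Complex.exp (Real.pi * I * x) - Complex.exp (-(Real.pi * I * x))

theorem riemannAuxIntegrand_eq (s x : ℂ) : riemannAuxIntegrand s x = auxKernel s x / auxDenom x := rfl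

theorem auxDenom_eq_sin (x : ℂ) : auxDenom x = 2 * I * Complex.sin (Real.pi * x) := by
  rw [auxDenom, Complex.sin]
  linear_combination (Complex.exp (Real.pi * I * x) - Complex.exp (-(Real.pi * I * x))) * I_sq +
    (-I ^ 2) * congrArg Complex.exp (show -(Real.pi * x : ℂ) * I = -(Real.pi * I * x) by ring) +
    (I ^ 2) * congrArg Complex.exp (show (Real.pi * x : ℂ) * I = (Real.pi * I * x) by ring)

theorem differentiable_auxDenom : Differentiable ℂ auxDenom := by
  unfold auxDenom; fun_prop

/-- The two exponentials have moduli `e^{∓π Im x}`, which differ by `2 sinh(π |Im x|)`. -/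
theorem two_pi_abs_im_le_norm_auxDenom (x : ℂ) : 2 * Real.pi * |x.im| ≤ ‖auxDenom x‖ := by
  have h1 : ‖Complex.exp (Real.pi * I * x)‖ = Real.exp (-(Real.pi * x.im)) := by
    rw [Complex.norm_exp]; simp
  have h2 : ‖Complex.exp (-(Real.pi * I * x))‖ = Real.exp (Real.pi * x.im) := by
    rw [Complex.norm_exp]; simp
  have h3 := abs_norm_sub_norm_le (Complex.exp (Real.pi * I * x)) (Complex.exp (-(Real.pi * I * x)))
  rw [h1, h2] at h3
  refine le_trans ?_ h3
  have h4 : Real.exp (-(Real.pi * x.im)) - Real.exp (Real.pi * x.im) = -(2 * Real.sinh (Real.pi * x.im)) := by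
    rw [Real.sinh_eq]; ring
  rw [h4, abs_neg, abs_mul, abs_two, Real.abs_sinh, mul_assoc]
  have h5 : |Real.pi * x.im| ≤ Real.sinh |Real.pi * x.im| := Real.self_le_sinh_iff.mpr (abs_nonneg _)
  rw [abs_mul, abs_of_pos Real.pi_pos] at h5
  rw [abs_mul, abs_of_pos Real.pi_pos]
  linarith

theorem two_abs_sin_le_norm_auxDenom (x : ℂ) : 2 * |Real.sin (Real.pi * x.re)| ≤ ‖auxDenom x‖ := by
  rw [auxDenom_eq_sin, norm_mul, norm_mul, Complex.norm_I, Complex.norm_two, mul_one]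
  have h : (Complex.sin (Real.pi * x)).re = Real.sin (Real.pi * x.re) * Real.cosh (Real.pi * x.im) := by
    conv_lhs => rw [← Complex.re_add_im x]
    rw [Complex.sin_eq]
    simp [← ofReal_mul, ← ofReal_sin, ← ofReal_cosh, ← ofReal_cos, ← ofReal_sinh]
  have h2 := Complex.abs_re_le_norm (Complex.sin (Real.pi * x))
  rw [h, abs_mul, abs_of_pos (Real.cosh_pos _)] at h2
  nlinarith [Real.one_le_cosh (Real.pi * x.im), abs_nonneg (Real.sin (Real.pi * x.re))]

/-- Far from the real axis the `sinh` bound suffices; for `|y| < 1/4` the real part is close to a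
half integer, where `|sin(π Re x)|` is at least `1/2`. -/
theorem one_le_norm_auxDenom (N : ℤ) (y : ℝ) :
    1 ≤ ‖auxDenom (((N + 1 / 2 : ℝ) : ℂ) + (1 + I) * y)‖ := by
  rcases le_or_gt (1 / 4) |y| with h | h
  · refine le_trans ?_ (two_pi_abs_im_le_norm_auxDenom _)
    simp
    nlinarith [Real.pi_gt_three]
  · refine le_trans ?_ (two_abs_sin_le_norm_auxDenom _)
    have e : Real.pi * ((((N + 1 / 2 : ℝ) : ℂ) + (1 + I) * y).re) = (Real.pi * y + Real.pi / 2) + N * Real.pi := by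
      simp; ring
    rw [e, Real.sin_add_int_mul_pi, abs_mul, Real.sin_add_pi_div_two, abs_zpow, abs_neg, abs_one, one_zpow,
      one_mul]
    have h3 : 1 - (Real.pi * y) ^ 2 / 2 ≤ Real.cos (Real.pi * y) := Real.one_sub_sq_div_two_le_cos
    have h4 : (Real.pi * y) ^ 2 ≤ 1 := by
      rw [sq_le_one_iff_abs_le_one, abs_mul, abs_of_pos Real.pi_pos]
      linarith [mul_le_mul Real.pi_lt_four.le h.le (abs_nonneg y) (by norm_num)]
    linarith [le_abs_self (Real.cos (Real.pi * y))]

theorem norm_auxKernel {s x : ℂ} (hx : x ≠ 0) :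
    ‖auxKernel s x‖ = ‖x‖ ^ (-s.re) * Real.exp (x.arg * s.im) * Real.exp (-(2 * Real.pi * x.re * x.im)) := by
  rw [auxKernel, norm_mul, Complex.norm_cpow_of_ne_zero hx, Complex.norm_exp, div_eq_mul_inv, ← Real.exp_neg]
  congr 2
  · simp
  · simp [sq]; ring

theorem rpow_le_exp_abs {r p : ℝ} (hr : 0 < r) : r ^ p ≤ Real.exp (|p| * (r + r⁻¹)) := by
  rw [Real.rpow_def_of_pos hr, mul_comm]
  refine Real.exp_le_exp.mpr ((le_abs_self _).trans ?_)
  rw [abs_mul]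
  refine mul_le_mul_of_nonneg_left ?_ (abs_nonneg _)
  rw [abs_le]
  have h1 := Real.log_le_sub_one_of_pos hr
  have h2 := Real.log_le_sub_one_of_pos (inv_pos.mpr hr)
  rw [Real.log_inv] at h2
  have := inv_pos.mpr hr
  constructor <;> linarith

theorem norm_slantedLine_le (c y : ℝ) : ‖(c : ℂ) + (1 + I) * y‖ ≤ |c| + 2 * |y| := by
  refine (Complex.norm_le_abs_re_add_abs_im _).trans ?_
  simp
  linarith [abs_add_le c y]

theorem abs_le_two_mul_norm_slantedLine (c y : ℝ) : |c| ≤ 2 * ‖(c : ℂ) + (1 + I) * y‖ := by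
  have h1 := Complex.abs_re_le_norm ((c : ℂ) + (1 + I) * y)
  have h2 := Complex.abs_im_le_norm ((c : ℂ) + (1 + I) * y)
  simp at h1 h2
  have := abs_sub (c + y) y
  simp at this
  linarith

theorem slantedLine_ne_zero {c : ℝ} (hc : 0 < c) (y : ℝ) : (c : ℂ) + (1 + I) * y ≠ 0 := by
  intro h
  have := abs_le_two_mul_norm_slantedLine c y
  rw [h, norm_zero, abs_of_pos hc] at this
  linarith

theorem slantedLine_mem_slitPlane {c : ℝ} (hc : 0 < c) (y : ℝ) :
    (c : ℂ) + (1 + I) * y ∈ slitPlane := by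
  rw [Complex.mem_slitPlane_iff]
  by_cases h : y = 0
  · left; simp [h, hc]
  · right; simpa using h

theorem slantedStrip_subset_slitPlane {α β : ℝ} (hα : 0 ≤ α) :
    {z : ℂ | α < z.re - z.im ∧ z.re - z.im < β} ⊆ slitPlane := by
  intro z hz
  rw [Complex.mem_slitPlane_iff]
  by_cases h : z.im = 0
  · left; have := hz.1; rw [h] at this; linarith
  · right; exact h

theorem abs_arg_mul_le (x : ℂ) (t : ℝ) : x.arg * t ≤ Real.pi * |t| := by
  refine (le_abs_self _).trans ?_
  rw [abs_mul]
  exact mul_le_mul_of_nonneg_right (Complex.abs_arg_le_pi x) (abs_nonneg t)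

theorem linear_sub_sq_le (K B y : ℝ) : K + B * |y| - 2 * Real.pi * y ^ 2 ≤ K + B ^ 2 - y ^ 2 := by
  nlinarith [Real.pi_gt_three, sq_nonneg (2 * B - |y|), sq_abs y, sq_nonneg y, sq_nonneg B]

/-- Gaussian bound for the numerator on lines of slope one, uniform for `s` in a box. -/
theorem exists_norm_auxKernel_le (S T : ℝ) {c₁ c₂ : ℝ} (hc₁ : 0 < c₁) :
    ∃ C, 0 < C ∧ ∀ s : ℂ, |s.re| ≤ S → |s.im| ≤ T → ∀ c ∈ Icc c₁ c₂, ∀ y : ℝ,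
      ‖auxKernel s (c + (1 + I) * y)‖ ≤ C * Real.exp (-y ^ 2) := by
  refine ⟨Real.exp (S * (c₂ + 2 / c₁) + Real.pi * T + (2 * S + 2 * Real.pi * c₂) ^ 2),
    Real.exp_pos _, ?_⟩
  intro s hS hT c hc y
  have hc0 : 0 < c := hc₁.trans_le hc.1
  have hx := slantedLine_ne_zero hc0 y
  set x : ℂ := c + (1 + I) * y with hxd
  have hn : 0 < ‖x‖ := norm_pos_iff.mpr hx
  have hS0 : 0 ≤ S := (abs_nonneg _).trans hS
  rw [norm_auxKernel hx]
  have hre : x.re = c + y := by simp [hxd]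
  have him : x.im = y := by simp [hxd]
  have e1 : ‖x‖ ^ (-s.re) ≤ Real.exp (S * (c₂ + 2 * |y| + 2 / c₁)) := by
    refine (rpow_le_exp_abs hn).trans (Real.exp_le_exp.mpr ?_)
    rw [abs_neg]
    have h1 : ‖x‖ ≤ c₂ + 2 * |y| :=
      (norm_slantedLine_le c y).trans (by rw [abs_of_pos hc0]; linarith [hc.2])
    have h2 : ‖x‖⁻¹ ≤ 2 / c₁ := by
      have := abs_le_two_mul_norm_slantedLine c y
      rw [abs_of_pos hc0, ← hxd] at this
      rw [inv_le_comm₀ hn (by positivity), inv_div]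
      linarith [hc.1]
    exact mul_le_mul hS (by linarith) (by positivity) hS0
  have e2 : Real.exp (x.arg * s.im) ≤ Real.exp (Real.pi * T) :=
    Real.exp_le_exp.mpr ((abs_arg_mul_le x _).trans (mul_le_mul_of_nonneg_left hT Real.pi_pos.le))
  have e3 : Real.exp (-(2 * Real.pi * x.re * x.im)) ≤
      Real.exp (2 * Real.pi * c₂ * |y| - 2 * Real.pi * y ^ 2) := by
    refine Real.exp_le_exp.mpr ?_
    rw [hre, him]
    have : -(c * y) ≤ c₂ * |y| := by
      have := neg_abs_le y
      nlinarith [hc.2, abs_nonneg y]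
    nlinarith [Real.pi_pos]
  calc _ ≤ Real.exp (S * (c₂ + 2 * |y| + 2 / c₁)) * Real.exp (Real.pi * T) *
        Real.exp (2 * Real.pi * c₂ * |y| - 2 * Real.pi * y ^ 2) := by gcongr
    _ ≤ _ := by
      rw [← Real.exp_add, ← Real.exp_add, ← Real.exp_add]
      refine Real.exp_le_exp.mpr ?_
      have := linear_sub_sq_le (S * (c₂ + 2 / c₁) + Real.pi * T) (2 * S + 2 * Real.pi * c₂) y
      linarith

theorem integrable_exp_neg_sq : Integrable fun y : ℝ => Real.exp (-y ^ 2) := by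
  simpa using integrable_exp_neg_mul_sq (b := 1) one_pos

theorem tendsto_exp_neg_sq_atTop : Tendsto (fun y : ℝ => Real.exp (-y ^ 2)) atTop (𝓝 0) :=
  Real.tendsto_exp_neg_atTop_nhds_zero.comp (tendsto_pow_atTop two_ne_zero)

theorem tendsto_exp_neg_sq_atBot : Tendsto (fun y : ℝ => Real.exp (-y ^ 2)) atBot (𝓝 0) := by
  have := tendsto_exp_neg_sq_atTop.comp tendsto_neg_atBot_atTop
  refine this.congr fun y => ?_
  simp

theorem differentiableAt_auxKernel {s x : ℂ} (hx : x ∈ slitPlane) :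
    DifferentiableAt ℂ (auxKernel s) x := by
  unfold auxKernel
  exact (DifferentiableAt.cpow differentiableAt_id (differentiableAt_const _) hx).mul (by fun_prop)

theorem continuous_auxKernel_slantedLine (s : ℂ) {c : ℝ} (hc : 0 < c) :
    Continuous fun y : ℝ => auxKernel s (c + (1 + I) * y) := by
  rw [continuous_iff_continuousAt]
  intro y
  exact ContinuousAt.comp (f := fun y : ℝ => (c : ℂ) + (1 + I) * y)
    (differentiableAt_auxKernel (slantedLine_mem_slitPlane hc y)).continuousAt
    (by fun_prop)

/-- The integral of the integrand of `R(s)` along the line of slope one through `c`, upwards. -/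
noncomputable def auxLine (s : ℂ) (c : ℝ) : ℂ :=
  ∫ y : ℝ, riemannAuxIntegrand s (c + (1 + I) * y) * (1 + I)

theorem integrable_riemannAuxIntegrand_slantedLine (s : ℂ) {c : ℝ} (hc : 0 < c) {m : ℝ} (hm : 0 < m)
    (hD : ∀ y : ℝ, m ≤ ‖auxDenom (c + (1 + I) * y)‖) :
    Integrable fun y : ℝ => riemannAuxIntegrand s (c + (1 + I) * y) := by
  obtain ⟨C, hC0, hC⟩ := exists_norm_auxKernel_le |s.re| |s.im| (c₂ := c) hc
  refine Integrable.mono' (integrable_exp_neg_sq.const_mul (C / m)) ?_ ?_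
  · refine Continuous.aestronglyMeasurable ?_
    refine (continuous_auxKernel_slantedLine s hc).div ?_ ?_
    · exact differentiable_auxDenom.continuous.comp (by fun_prop)
    · intro y h
      have := hD y
      change auxDenom _ = 0 at h
      rw [h, norm_zero] at this
      linarith
  · refine ae_of_all _ fun y => ?_
    rw [riemannAuxIntegrand_eq, norm_div, div_mul_eq_mul_div]
    have := hC s le_rfl le_rfl c ⟨le_rfl, le_rfl⟩ y
    have hD0 := hD y
    gcongr

theorem exp_pi_I_div_four : Complex.exp (Real.pi * I / 4) = (1 + I) * ((Real.sqrt 2)⁻¹ : ℝ) := by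
  have : (Real.pi * I / 4 : ℂ) = ((Real.pi / 4 : ℝ) : ℂ) * I := by push_cast; ring
  rw [this, Complex.exp_mul_I, ← ofReal_cos, ← ofReal_sin, Real.cos_pi_div_four, Real.sin_pi_div_four]
  have h : Real.sqrt 2 / 2 = (Real.sqrt 2)⁻¹ := by
    have := Real.mul_self_sqrt (show (0:ℝ) ≤ 2 by norm_num)
    field_simp; nlinarith
  rw [h]; ring

theorem deriv_siegelPath (u : ℝ) : deriv siegelPath u = -Complex.exp (Real.pi * I / 4) := by
  have h : HasDerivAt siegelPath (-Complex.exp (Real.pi * I / 4)) u := by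
    refine (((hasDerivAt_id (u : ℂ)).const_mul (Complex.exp (Real.pi * I / 4))).const_sub
      (1 / 2)).comp_ofReal.congr_deriv ?_
    simp
  exact h.deriv

/-- The substitution `y = -u/√2` turns `e^{πi/4}` into `1 + i`; the sign appears because `0 ↙ 1`
runs downwards and `auxLine` upwards. -/
theorem riemannAux_eq_neg_auxLine (s : ℂ) : riemannAux s = -auxLine s (1 / 2) := by
  have h := Measure.integral_comp_mul_left (fun y : ℝ => riemannAuxIntegrand s
    (((1 / 2 : ℝ) : ℂ) + (1 + I) * y) * (1 + I)) (-(Real.sqrt 2)⁻¹)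
  rw [auxLine, riemannAux]
  have h2 : 0 < Real.sqrt 2 := by positivity
  rw [inv_neg, inv_inv, abs_neg, abs_of_pos h2] at h
  have : (∫ y : ℝ, riemannAuxIntegrand s (((1 / 2 : ℝ) : ℂ) + (1 + I) * y) * (1 + I)) =
      ((Real.sqrt 2)⁻¹ : ℝ) • (Real.sqrt 2 • ∫ y : ℝ, riemannAuxIntegrand s
        (((1 / 2 : ℝ) : ℂ) + (1 + I) * y) * (1 + I)) := by
    rw [smul_smul, inv_mul_cancel₀ h2.ne', one_smul]
  rw [this, ← h, ← integral_smul, ← integral_neg]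
  congr 1
  ext u
  rw [deriv_siegelPath, siegelPath, exp_pi_I_div_four, real_smul]
  have e : (1 / 2 - (1 + I) * ((Real.sqrt 2)⁻¹ : ℝ) * u : ℂ) =
      ((1 / 2 : ℝ) : ℂ) + (1 + I) * ((-(Real.sqrt 2)⁻¹ * u : ℝ) : ℂ) := by push_cast; ring
  rw [e]
  ring

theorem norm_log_slantedLine_le {c : ℝ} (hc : 0 < c) (y : ℝ) :
    ‖Complex.log (c + (1 + I) * y)‖ ≤ c + 2 * |y| + 2 / c + Real.pi := by
  have hx := slantedLine_ne_zero hc y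
  set x : ℂ := c + (1 + I) * y with hxd
  have hn : 0 < ‖x‖ := norm_pos_iff.mpr hx
  refine (Complex.norm_le_abs_re_add_abs_im _).trans ?_
  rw [Complex.log_re, Complex.log_im]
  have h3 := Complex.abs_arg_le_pi x
  have h1 : ‖x‖ ≤ c + 2 * |y| := (norm_slantedLine_le c y).trans (by rw [abs_of_pos hc])
  have h2 : ‖x‖⁻¹ ≤ 2 / c := by
    have := abs_le_two_mul_norm_slantedLine c y
    rw [abs_of_pos hc, ← hxd] at this
    rw [inv_le_comm₀ hn (by positivity), inv_div]
    linarith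
  have h4 := Real.log_le_sub_one_of_pos hn
  have h5 := Real.log_le_sub_one_of_pos (inv_pos.mpr hn)
  rw [Real.log_inv] at h5
  have := inv_pos.mpr hn
  have : |Real.log ‖x‖| ≤ ‖x‖ + ‖x‖⁻¹ := by rw [abs_le]; constructor <;> linarith
  linarith

theorem hasDerivAt_auxKernel_param {x : ℂ} (hx : x ≠ 0) (s : ℂ) :
    HasDerivAt (fun s => auxKernel s x) (-Complex.log x * auxKernel s x) s := by
  unfold auxKernel
  have h := ((hasDerivAt_id s).neg.const_cpow (c := x) (Or.inl hx)).mul_const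
    (Complex.exp (Real.pi * I * x ^ 2))
  refine h.congr_deriv ?_
  simp only [id, Pi.neg_apply]
  ring

/-- `R(s)` is an entire function. -/
theorem differentiable_riemannAux : Differentiable ℂ riemannAux := by
  have hR : riemannAux = fun s => -auxLine s (1 / 2) := funext riemannAux_eq_neg_auxLine
  rw [hR]
  refine Differentiable.neg ?_
  intro s₀
  have hc : (0 : ℝ) < 1 / 2 := by norm_num
  have hD : ∀ y : ℝ, 1 ≤ ‖auxDenom (((1 / 2 : ℝ) : ℂ) + (1 + I) * y)‖ := fun y => by
    simpa using one_le_norm_auxDenom 0 y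
  have hD0 : ∀ y : ℝ, auxDenom (((1 / 2 : ℝ) : ℂ) + (1 + I) * y) ≠ 0 := fun y h => by
    have := hD y
    rw [h, norm_zero] at this
    linarith
  obtain ⟨C, hC0, hC⟩ := exists_norm_auxKernel_le (|s₀.re| + 1) (|s₀.im| + 1) (c₂ := 1 / 2) hc
  have hcd : Continuous fun y : ℝ => auxDenom (((1 / 2 : ℝ) : ℂ) + (1 + I) * y) :=
    differentiable_auxDenom.continuous.comp (by fun_prop)
  have hcl : Continuous fun y : ℝ => Complex.log (((1 / 2 : ℝ) : ℂ) + (1 + I) * y) := by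
    refine Continuous.clog (by fun_prop) (fun y => slantedLine_mem_slitPlane hc y)
  have hmeas : ∀ s : ℂ, Continuous fun y : ℝ =>
      riemannAuxIntegrand s (((1 / 2 : ℝ) : ℂ) + (1 + I) * y) := fun s =>
    (continuous_auxKernel_slantedLine s hc).div hcd hD0
  have key := hasDerivAt_integral_of_dominated_loc_of_deriv_le (μ := volume) (𝕜 := ℂ) (x₀ := s₀)
    (F := fun s (y : ℝ) => riemannAuxIntegrand s (((1 / 2 : ℝ) : ℂ) + (1 + I) * y) * (1 + I))
    (F' := fun s (y : ℝ) => -Complex.log (((1 / 2 : ℝ) : ℂ) + (1 + I) * y) *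
      riemannAuxIntegrand s (((1 / 2 : ℝ) : ℂ) + (1 + I) * y) * (1 + I))
    (bound := fun y : ℝ => (10 + 2 * |y|) * (C * Real.exp (-y ^ 2)) * ‖(1 + I : ℂ)‖)
    (s := Metric.ball s₀ 1) (Metric.ball_mem_nhds s₀ one_pos)
    (Eventually.of_forall fun s => ((hmeas s).mul continuous_const).aestronglyMeasurable)
    ((integrable_riemannAuxIntegrand_slantedLine s₀ hc one_pos hD).mul_const _)
    (((hcl.neg.mul (hmeas s₀)).mul continuous_const).aestronglyMeasurable)
    ?_ ?_ ?_
  · exact key.2.differentiableAt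
  · refine ae_of_all _ fun y s hs => ?_
    rw [norm_mul, norm_mul, norm_neg]
    have hs' : ‖s - s₀‖ < 1 := by simpa [dist_eq_norm] using hs
    have hre : |s.re| ≤ |s₀.re| + 1 := by
      have := (Complex.abs_re_le_norm (s - s₀)).trans hs'.le
      rw [Complex.sub_re] at this
      have := abs_sub_abs_le_abs_sub s.re s₀.re
      linarith
    have him : |s.im| ≤ |s₀.im| + 1 := by
      have := (Complex.abs_im_le_norm (s - s₀)).trans hs'.le
      rw [Complex.sub_im] at this
      have := abs_sub_abs_le_abs_sub s.im s₀.im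
      linarith
    have h1 := hC s hre him (1 / 2) ⟨le_rfl, le_rfl⟩ y
    have h2 := norm_log_slantedLine_le hc y
    have h3 : ‖riemannAuxIntegrand s (((1 / 2 : ℝ) : ℂ) + (1 + I) * y)‖ ≤ C * Real.exp (-y ^ 2) := by
      rw [riemannAuxIntegrand_eq, norm_div]
      exact (div_le_self (norm_nonneg _) (hD y)).trans h1
    gcongr
    linarith [Real.pi_lt_four]
  · have i1 : Integrable fun y : ℝ => Real.exp (-y ^ 2) := integrable_exp_neg_sq
    have i2 : Integrable fun y : ℝ => |y| * Real.exp (-y ^ 2) := by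
      have := (integrable_mul_exp_neg_mul_sq (b := 1) one_pos).norm
      simpa [abs_mul] using this
    have := ((i1.const_mul (10 * C)).add (i2.const_mul (2 * C))).mul_const ‖(1 + I : ℂ)‖
    refine this.congr (ae_of_all _ fun y => ?_)
    simp only [Pi.add_apply]
    ring
  · refine ae_of_all _ fun y s _ => ?_
    have := ((hasDerivAt_auxKernel_param (slantedLine_ne_zero hc y) s).div_const
      (auxDenom (((1 / 2 : ℝ) : ℂ) + (1 + I) * y))).mul_const (1 + I)
    refine this.congr_deriv ?_
    rw [riemannAuxIntegrand_eq]
    ring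

/-! ### Crossing the poles at the positive integers -/

theorem auxKernel_zero_left (x : ℂ) : auxKernel 0 x = Complex.exp (Real.pi * I * x ^ 2) := by
  simp [auxKernel]

theorem auxDenom_eq_zero_iff (x : ℂ) : auxDenom x = 0 ↔ ∃ k : ℤ, x = k := by
  have hpi : (Real.pi : ℂ) ≠ 0 := by exact_mod_cast Real.pi_ne_zero
  rw [auxDenom_eq_sin]
  simp only [mul_eq_zero, I_ne_zero, OfNat.ofNat_ne_zero, false_or, Complex.sin_eq_zero_iff]
  refine exists_congr fun k => ?_
  rw [mul_comm (k : ℂ), mul_right_inj' hpi]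

theorem deriv_auxDenom_ne_zero (k : ℤ) : deriv auxDenom k ≠ 0 := by
  have h : HasDerivAt auxDenom (2 * I * (Complex.cos (Real.pi * k) * Real.pi)) (k : ℂ) := by
    have h1 : HasDerivAt (fun x : ℂ => (Real.pi : ℂ) * x) Real.pi (k : ℂ) := by
      simpa using (hasDerivAt_id (k : ℂ)).const_mul (Real.pi : ℂ)
    have h2 := h1.csin.const_mul (2 * I)
    rwa [show (fun x : ℂ => 2 * I * Complex.sin (Real.pi * x)) = auxDenom from
      funext fun x => (auxDenom_eq_sin x).symm] at h2
  rw [h.deriv]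
  have hc : Complex.cos (Real.pi * k) ≠ 0 := by
    intro hc
    have := Complex.sin_sq_add_cos_sq (Real.pi * k)
    rw [hc, mul_comm, Complex.sin_int_mul_pi] at this
    simp at this
  have hpi : (Real.pi : ℂ) ≠ 0 := by exact_mod_cast Real.pi_ne_zero
  simp [hc, hpi]

theorem auxDenom_add_one (x : ℂ) : auxDenom (x + 1) = -auxDenom x := by
  rw [auxDenom_eq_sin, auxDenom_eq_sin, mul_add, mul_one, Complex.sin_add_pi]; ring

theorem integrable_auxLine_half (s : ℂ) (n : ℕ) :
    Integrable fun y : ℝ => riemannAuxIntegrand s (((n + 1 / 2 : ℝ) : ℂ) + (1 + I) * y) :=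
  integrable_riemannAuxIntegrand_slantedLine s (by positivity) one_pos
    fun y => by simpa using one_le_norm_auxDenom n y

/-- For `s = 0` the integrand satisfies `f(x + 1) - f(x) = e^{πix²} e^{πix}`: the denominator
changes sign under `x ↦ x + 1` and divides `e^{2πix} - 1`. What remains is a complete Gaussian
integral. This explicit value is the residue from which the crossing of every pole is deduced. -/
theorem auxLine_zero_add_one (n : ℕ) : auxLine 0 (n + 1 + 1 / 2) = auxLine 0 (n + 1 / 2) + 1 := by
  rw [← sub_eq_iff_eq_add']
  have i1 := (integrable_auxLine_half 0 (n + 1)).mul_const (1 + I)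
  have i2 := (integrable_auxLine_half 0 n).mul_const (1 + I)
  push_cast at i1
  rw [auxLine, auxLine]
  push_cast
  push_cast at i2
  rw [← integral_sub i1 i2]
  have hD : ∀ y : ℝ, auxDenom ((n : ℂ) + 1 / 2 + (1 + I) * y) ≠ 0 := fun y h => by
    have := one_le_norm_auxDenom n y
    push_cast at this
    rw [h, norm_zero] at this
    linarith
  have e : ∀ y : ℝ, riemannAuxIntegrand 0 ((n : ℂ) + 1 + 1 / 2 + (1 + I) * y) * (1 + I) -
      riemannAuxIntegrand 0 ((n : ℂ) + 1 / 2 + (1 + I) * y) * (1 + I) =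
      (1 + I) * Complex.exp ((-2 * Real.pi : ℂ) * (y : ℂ) ^ 2 +
        (2 * Real.pi * I * (n + 1) * (1 + I)) * y + Real.pi * I * ((n + 1) ^ 2 - 1 / 4)) := by
    intro y
    have hx : (n : ℂ) + 1 + 1 / 2 + (1 + I) * y = ((n : ℂ) + 1 / 2 + (1 + I) * y) + 1 := by ring
    rw [hx]
    set x : ℂ := (n : ℂ) + 1 / 2 + (1 + I) * y with hxd
    have hDx := hD y
    rw [← hxd] at hDx
    rw [riemannAuxIntegrand_eq, riemannAuxIntegrand_eq, auxKernel_zero_left, auxKernel_zero_left,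
      auxDenom_add_one]
    have e1 : Complex.exp (Real.pi * I * (x + 1) ^ 2) =
        -Complex.exp (Real.pi * I * x ^ 2) * Complex.exp (2 * (Real.pi * I * x)) := by
      rw [show (Real.pi * I * (x + 1) ^ 2 : ℂ) = Real.pi * I * x ^ 2 + 2 * (Real.pi * I * x) + Real.pi * I by ring,
        Complex.exp_add, Complex.exp_add, Complex.exp_pi_mul_I]
      ring
    have e2 : Complex.exp ((-2 * Real.pi : ℂ) * (y : ℂ) ^ 2 +
        (2 * Real.pi * I * (n + 1) * (1 + I)) * y + Real.pi * I * ((n + 1) ^ 2 - 1 / 4)) =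
        Complex.exp (Real.pi * I * x ^ 2) * Complex.exp (Real.pi * I * x) := by
      rw [← Complex.exp_add]
      congr 1
      rw [hxd]
      linear_combination (-(Real.pi : ℂ) * (y : ℂ) ^ 2 * (2 + I)) * I_sq
    have e3 : Complex.exp (2 * (Real.pi * I * x)) = Complex.exp (Real.pi * I * x) * auxDenom x + 1 := by
      rw [auxDenom, two_mul, Complex.exp_add, mul_sub, ← Complex.exp_add _ (-(Real.pi * I * x)), add_neg_cancel,
        Complex.exp_zero]
      ring
    rw [e1, e2, e3]
    field_simp
    ring
  simp_rw [e]
  rw [integral_const_mul, integral_cexp_quadratic (by simp [Real.pi_pos])]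
  have hpi : (Real.pi : ℂ) ≠ 0 := by exact_mod_cast Real.pi_ne_zero
  have e4 : (Real.pi * I * ((n + 1) ^ 2 - 1 / 4) - (2 * Real.pi * I * (n + 1) * (1 + I)) ^ 2 /
      (4 * (-2 * Real.pi)) : ℂ) = -(Real.pi * I / 4) := by
    field_simp
    linear_combination (2 * (n + 1 : ℂ) ^ 2 * (I + 2)) * I_sq
  rw [e4, Complex.exp_neg, exp_pi_I_div_four]
  have e5 : ((Real.pi : ℂ) / -(-2 * Real.pi)) ^ (1 / 2 : ℂ) = ((Real.sqrt 2)⁻¹ : ℝ) := by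
    rw [show ((Real.pi : ℂ) / -(-2 * Real.pi)) = ((2⁻¹ : ℝ) : ℂ) by push_cast; field_simp]
    rw [show (1 / 2 : ℂ) = ((1 / 2 : ℝ) : ℂ) by push_cast; rfl, ← ofReal_cpow (by norm_num),
      ← Real.sqrt_eq_rpow, Real.sqrt_inv]
  rw [e5]
  have h1 : (1 + I : ℂ) ≠ 0 := by
    intro h; have := congrArg Complex.re h; simp at this
  have h2 : (((Real.sqrt 2)⁻¹ : ℝ) : ℂ) ≠ 0 := by
    rw [ofReal_ne_zero]; positivity
  field_simp

theorem one_le_norm_auxDenom_of_one_le {x : ℂ} (h : 1 ≤ |x.im|) : 1 ≤ ‖auxDenom x‖ := by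
  have := two_pi_abs_im_le_norm_auxDenom x
  nlinarith [Real.pi_gt_three]

/-- Moving the line of integration past the pole `n + 1` gives the term `(n+1)^{-s}`. -/
theorem auxLine_add_one (s : ℂ) (n : ℕ) :
    auxLine s (n + 1 + 1 / 2) = auxLine s (n + 1 / 2) + ((n + 1 : ℕ) : ℂ) ^ (-s) := by
  set a : ℂ := ((n + 1 : ℕ) : ℂ) with ha
  have ha0 : a ≠ 0 := by rw [ha]; exact_mod_cast Nat.succ_ne_zero n
  set U : Set ℂ := {z : ℂ | (n : ℝ) < z.re - z.im ∧ z.re - z.im < n + 2} with hU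
  have hUo : IsOpen U := slantedStrip_isOpen _ _
  have hUs : U ⊆ slitPlane := slantedStrip_subset_slitPlane (Nat.cast_nonneg n)
  have haU : a ∈ U := by rw [ha, hU]; constructor <;> simp
  set p : ℂ → ℂ := fun x => x ^ (-s) with hp
  have hpd : DifferentiableOn ℂ p U := fun x hx =>
    (DifferentiableAt.cpow differentiableAt_id (differentiableAt_const _) (hUs hx)).differentiableWithinAt
  set d1 := dslope p a
  set d2 := dslope auxDenom a
  have hd1 : DifferentiableOn ℂ d1 U := (differentiableOn_dslope (hUo.mem_nhds haU)).mpr hpd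
  have hd2 : DifferentiableOn ℂ d2 U :=
    (differentiableOn_dslope (hUo.mem_nhds haU)).mpr differentiable_auxDenom.differentiableOn
  have hDa : auxDenom a = 0 := (auxDenom_eq_zero_iff a).mpr ⟨(n + 1 : ℕ), by rw [ha]; simp⟩
  have hD0 : ∀ x ∈ U, x ≠ a → auxDenom x ≠ 0 := by
    intro x hx hxa h
    obtain ⟨k, rfl⟩ := (auxDenom_eq_zero_iff x).mp h
    apply hxa
    rw [hU] at hx
    simp only [mem_ofPred_eq, intCast_re, intCast_im, sub_zero] at hx
    have h1 : (n : ℤ) < k := by exact_mod_cast hx.1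
    have h2 : k < (n : ℤ) + 2 := by exact_mod_cast hx.2
    have : k = (n : ℤ) + 1 := by omega
    rw [this, ha]; push_cast; ring
  have hd20 : ∀ x ∈ U, d2 x ≠ 0 := by
    intro x hx
    by_cases hxa : x = a
    · subst hxa
      change dslope auxDenom _ _ ≠ 0
      rw [dslope_same]
      have := deriv_auxDenom_ne_zero (n + 1 : ℕ)
      rw [ha]; simpa using this
    · change dslope auxDenom _ _ ≠ 0
      rw [dslope_of_ne _ hxa, slope_def_field, hDa, sub_zero]
      exact div_ne_zero (hD0 x hx hxa) (sub_ne_zero.mpr hxa)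
  -- Subtracting `a^{-s}` times the integrand for `s = 0` cancels the simple pole at `a`. Written as
  -- a quotient of divided differences, `g` is holomorphic at `a` too, so its line can be shifted
  -- freely and only `auxLine_zero_add_one` contributes.
  set g : ℂ → ℂ := fun x => d1 x * auxKernel 0 x / d2 x with hg
  have hgd : DifferentiableOn ℂ g U :=
    (hd1.mul (fun x hx => (differentiableAt_auxKernel (hUs hx)).differentiableWithinAt)).div hd2 hd20
  have hgx : ∀ x ∈ U, x ≠ a → g x = riemannAuxIntegrand s x - a ^ (-s) * riemannAuxIntegrand 0 x := by
    intro x hx hxa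
    have h1 : d1 x = (x ^ (-s) - a ^ (-s)) / (x - a) := by
      change dslope p a x = _
      rw [dslope_of_ne _ hxa, slope_def_field]
    have h2 : d2 x = auxDenom x / (x - a) := by
      change dslope auxDenom a x = _
      rw [dslope_of_ne _ hxa, slope_def_field, hDa, sub_zero]
    have h3 := sub_ne_zero.mpr hxa
    have h4 := hD0 x hx hxa
    rw [hg, riemannAuxIntegrand_eq, riemannAuxIntegrand_eq, auxKernel_zero_left]
    simp only [h1, h2, auxKernel_zero_left]
    rw [auxKernel]
    field_simp
  have hline : ∀ (c : ℝ), (n : ℝ) < c → c < n + 2 → ∀ y : ℝ, (c ≠ n + 1 ∨ 1 ≤ |y|) →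
      (c : ℂ) + (1 + I) * y ∈ U ∧ (c : ℂ) + (1 + I) * y ≠ a := by
    intro c h1 h2 y h3
    refine ⟨slantedStrip_mem h1 h2 y, ?_⟩
    intro h
    have him := congrArg Complex.im h
    have hre := congrArg Complex.re h
    simp [ha] at him hre
    rcases h3 with h3 | h3
    · apply h3; rw [him] at hre; linarith
    · rw [him] at h3; norm_num at h3
  have int_eq : ∀ (m : ℕ), (n : ℝ) < m + 1 / 2 → (m : ℝ) + 1 / 2 < n + 2 → (m + 1 / 2 : ℝ) ≠ n + 1 →
      Integrable (fun y : ℝ => g (((m + 1 / 2 : ℝ) : ℂ) + (1 + I) * y)) ∧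
      ∫ y : ℝ, g (((m + 1 / 2 : ℝ) : ℂ) + (1 + I) * y) * (1 + I) =
        auxLine s (m + 1 / 2) - a ^ (-s) * auxLine 0 (m + 1 / 2) := by
    intro m h1 h2 h3
    have e : ∀ y : ℝ, g (((m + 1 / 2 : ℝ) : ℂ) + (1 + I) * y) =
        riemannAuxIntegrand s (((m + 1 / 2 : ℝ) : ℂ) + (1 + I) * y) -
        a ^ (-s) * riemannAuxIntegrand 0 (((m + 1 / 2 : ℝ) : ℂ) + (1 + I) * y) := fun y => by
      obtain ⟨h4, h5⟩ := hline _ h1 h2 y (Or.inl h3)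
      exact hgx _ h4 h5
    have i1 := integrable_auxLine_half s m
    have i2 := (integrable_auxLine_half 0 m).const_mul (a ^ (-s))
    constructor
    · exact (i1.sub i2).congr (ae_of_all _ fun y => (e y).symm)
    · simp_rw [e, sub_mul, mul_assoc]
      rw [integral_sub (i1.mul_const _) (((integrable_auxLine_half 0 m).mul_const (1 + I)).const_mul (a ^ (-s))),
        integral_const_mul]
      rfl
  obtain ⟨i1, e1⟩ := int_eq n (by linarith) (by linarith) (fun h => by linarith)
  obtain ⟨i2, e2⟩ := int_eq (n + 1) (by push_cast; linarith) (by push_cast; linarith)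
    (fun h => by push_cast at h; linarith)
  push_cast at i2 e2
  obtain ⟨C1, hC10, hC1⟩ := exists_norm_auxKernel_le |s.re| |s.im| (c₁ := n + 1 / 2) (c₂ := n + 1 + 1 / 2)
    (by positivity)
  obtain ⟨C2, hC20, hC2⟩ := exists_norm_auxKernel_le 0 0 (c₁ := n + 1 / 2) (c₂ := n + 1 + 1 / 2)
    (by positivity)
  have key := integral_slantedLine_eq (f := g) (α := n) (β := n + 2) (c₁ := n + 1 / 2)
    (c₂ := n + 1 + 1 / 2) hgd (by linarith) (by linarith) (by linarith) i1
    (by push_cast; exact i2)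
    (b := fun y => (C1 + ‖a ^ (-s)‖ * C2) * Real.exp (-y ^ 2))
    (by simpa using tendsto_exp_neg_sq_atTop.const_mul (C1 + ‖a ^ (-s)‖ * C2))
    (by simpa using tendsto_exp_neg_sq_atBot.const_mul (C1 + ‖a ^ (-s)‖ * C2))
    (by
      intro y hy c hc
      obtain ⟨h4, h5⟩ := hline c (by linarith [hc.1]) (by linarith [hc.2]) y (Or.inr hy)
      rw [hgx _ h4 h5]
      have hD : 1 ≤ ‖auxDenom (c + (1 + I) * y)‖ := one_le_norm_auxDenom_of_one_le (by simpa using hy)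
      refine (norm_sub_le _ _).trans ?_
      rw [norm_mul, riemannAuxIntegrand_eq, riemannAuxIntegrand_eq, norm_div, norm_div]
      have b1 := (div_le_self (norm_nonneg _) hD).trans (hC1 s le_rfl le_rfl c hc y)
      have b2 := (div_le_self (norm_nonneg _) hD).trans (hC2 0 (by simp) (by simp) c hc y)
      have b3 := mul_le_mul_of_nonneg_left b2 (norm_nonneg (a ^ (-s)))
      linarith)
  push_cast at key e1
  rw [e1, e2, auxLine_zero_add_one] at key
  linear_combination -key

theorem riemannAux_eq_sum_sub_auxLine (s : ℂ) (N : ℕ) :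
    riemannAux s = (∑ n ∈ Finset.range N, ((n + 1 : ℕ) : ℂ) ^ (-s)) - auxLine s (N + 1 / 2) := by
  induction N with
  | zero => simp [riemannAux_eq_neg_auxLine]
  | succ N ih =>
    have := auxLine_add_one s N
    push_cast at this ih ⊢
    rw [Finset.sum_range_succ, ih, this]
    ring

/-! ### Bounds for `R(s)` from the line next to the saddle point -/

/-- The tangent of the argument is `y / (c + y)`. The slope `1/c` is the derivative of the argument
at `y = 0`; this precision is what lets the linear terms cancel at the saddle in `arg_mul_sub_le`.
-/
theorem arg_slantedLine_le {c y : ℝ} (hc : 0 < c) (hy : -c < y) :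
    ((c : ℂ) + (1 + I) * y).arg ≤ y / c := by
  set x : ℂ := c + (1 + I) * y with hx
  have hre : x.re = c + y := by simp [hx]
  have him : x.im = y := by simp [hx]
  have hpos : 0 < x.re := by rw [hre]; linarith
  have habs : |x.arg| < Real.pi / 2 := Complex.abs_arg_lt_pi_div_two_iff.mpr (Or.inl hpos)
  have htan : Real.tan x.arg = y / (c + y) := by rw [Complex.tan_arg, hre, him]
  rw [abs_lt] at habs
  rcases le_or_gt 0 y with h | h
  · have h0 : 0 ≤ x.arg := Complex.arg_nonneg_iff.mpr (by rw [him]; exact h)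
    calc x.arg ≤ Real.tan x.arg := Real.le_tan h0 habs.2
      _ = y / (c + y) := htan
      _ ≤ y / c := div_le_div_of_nonneg_left h hc (by linarith)
  · by_contra! hlt
    set u := -y / c with hu
    have hu0 : 0 < u := div_pos (by linarith) hc
    have hu1 : u < 1 := by rw [hu, div_lt_one hc]; linarith
    have hyu : y / c = -u := by rw [hu]; ring
    rw [hyu] at hlt
    have hpi := Real.pi_gt_three
    have h1 : Real.tan (-u) < Real.tan x.arg :=
      Real.tan_lt_tan_of_lt_of_lt_pi_div_two (by linarith) habs.2 hlt
    have h2 : Real.tan u ≤ u / (1 - u) := by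
      have hcos : 0 < Real.cos u := Real.cos_pos_of_mem_Ioo ⟨by linarith, by linarith⟩
      rw [Real.tan_eq_sin_div_cos, div_le_div_iff₀ hcos (by linarith)]
      have h3 := Real.one_sub_sq_div_two_le_cos (x := u)
      have h4 := Real.sin_le hu0.le
      nlinarith
    rw [Real.tan_neg, htan] at h1
    have h5 : y / (c + y) = -(u / (1 - u)) := by
      rw [hu]
      have h6 : c + y ≠ 0 := by linarith
      have h7 : 1 - -y / c = (c + y) / c := by field_simp; ring
      rw [h7]
      field_simp
    linarith

theorem arg_slantedLine_le_neg_pi_div_two {c y : ℝ} (hc : 0 < c) (hy : y ≤ -c) :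
    ((c : ℂ) + (1 + I) * y).arg ≤ -(Real.pi / 2) := by
  rcases hy.lt_or_eq with h | h
  · by_contra! hlt
    have := Complex.neg_pi_div_two_le_arg_iff.mp hlt.le
    simp at this
    rcases this with h | h <;> linarith
  · subst h
    have : (c : ℂ) + (1 + I) * ((-c : ℝ) : ℂ) = (c : ℝ) * -I := by push_cast; ring
    rw [this, Complex.arg_real_mul _ hc, Complex.arg_neg_I]

/-- On the line of slope one near the saddle point `√(t/2π)` the oscillating part of the numerator is
bounded by a fixed Gaussian. -/
theorem arg_mul_sub_le {t c : ℝ} (ht : 0 ≤ t) (h1 : Real.sqrt (t / (2 * Real.pi)) + 1 / 2 ≤ c)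
    (h2 : c ≤ Real.sqrt (t / (2 * Real.pi)) + 3 / 2) (y : ℝ) :
    ((c : ℂ) + (1 + I) * y).arg * t - 2 * Real.pi * (c + y) * y ≤ 20 - y ^ 2 := by
  set h := Real.sqrt (t / (2 * Real.pi)) with hh
  have hpi := Real.pi_gt_three
  have hpi4 : Real.pi < 3.15 := Real.pi_lt_d2
  have h0 : 0 ≤ h := Real.sqrt_nonneg _
  have hc : 0 < c := by linarith
  have ht' : t = 2 * Real.pi * h ^ 2 := by
    rw [hh, Real.sq_sqrt (by positivity)]; field_simp
  rcases lt_or_ge (-c) y with hy | hy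
  · have ha : ((c : ℂ) + (1 + I) * y).arg * t ≤ y / c * t :=
      mul_le_mul_of_nonneg_right (arg_slantedLine_le hc hy) ht
    -- Since `t = 2πh²`, the linear terms cancel except for the factor `(c² - h²)/c`, which lies
    -- between `0` and `3` because `c - h` is at most `3/2`.
    have hb : y / c * t - 2 * Real.pi * (c + y) * y = -2 * Real.pi * (y * ((c ^ 2 - h ^ 2) / c)) - 2 * Real.pi * y ^ 2 := by
      rw [ht']; field_simp; ring
    have hq0 : 0 ≤ (c ^ 2 - h ^ 2) / c := div_nonneg (by nlinarith) hc.le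
    have hq : (c ^ 2 - h ^ 2) / c ≤ 3 := by
      rw [div_le_iff₀ hc]; nlinarith
    have hm : -(y * ((c ^ 2 - h ^ 2) / c)) ≤ 3 * |y| := by
      have : -(y * ((c ^ 2 - h ^ 2) / c)) ≤ |y| * ((c ^ 2 - h ^ 2) / c) := by
        nlinarith [neg_abs_le y]
      nlinarith [abs_nonneg y]
    have hm2 : 2 * Real.pi * (-(y * ((c ^ 2 - h ^ 2) / c))) ≤ 18.9 * |y| := by
      nlinarith [abs_nonneg y]
    nlinarith [sq_abs y, sq_nonneg (|y| - 1.89), sq_nonneg y]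
  · have ha : ((c : ℂ) + (1 + I) * y).arg * t ≤ -(Real.pi / 2) * t :=
      mul_le_mul_of_nonneg_right (arg_slantedLine_le_neg_pi_div_two hc hy) ht
    rw [ht'] at ha
    have hA : ((c : ℂ) + (1 + I) * y).arg * t ≤ -9 * h ^ 2 := by
      rw [ht']; nlinarith [sq_nonneg h]
    set z := -y with hz
    have hzc : c ≤ z := by linarith
    have hyz : y = -z := by rw [hz]; ring
    have hB : -(2 * Real.pi * (c + y) * y) ≤ -6 * (z * (z - c)) := by
      rw [hyz]
      nlinarith [mul_nonneg (hc.le.trans hzc) (sub_nonneg.mpr hzc)]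
    have hC : -9 * h ^ 2 - 6 * (z * (z - c)) ≤ 20 - z ^ 2 := by
      have : -9 * h ^ 2 ≤ -9 * (c - 3 / 2) ^ 2 ∨ c ≤ 3 / 2 := by
        rcases le_or_gt c (3 / 2) with h3 | h3
        · exact Or.inr h3
        · left; nlinarith
      rcases this with h3 | h3
      · nlinarith [sq_nonneg (z - 3 / 5 * c), sq_nonneg (c - 2)]
      · nlinarith [sq_nonneg (z - 3 / 5 * c), sq_nonneg h]
    have : y ^ 2 = z ^ 2 := by rw [hyz]; ring
    linarith

theorem exists_natCast_add_half (t : ℝ) : ∃ N : ℕ,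
    Real.sqrt (t / (2 * Real.pi)) + 1 / 2 ≤ N + 1 / 2 ∧
    (N : ℝ) + 1 / 2 ≤ Real.sqrt (t / (2 * Real.pi)) + 3 / 2 := by
  refine ⟨⌈Real.sqrt (t / (2 * Real.pi))⌉₊, by linarith [Nat.le_ceil (Real.sqrt (t / (2 * Real.pi)))], ?_⟩
  linarith [Nat.ceil_lt_add_one (Real.sqrt_nonneg (t / (2 * Real.pi)))]

theorem norm_auxLine_le {s : ℂ} {c M K a : ℝ} (hc : 0 < c)
    (hD : ∀ y : ℝ, 1 ≤ ‖auxDenom (c + (1 + I) * y)‖) (ha : 0 < a)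
    (hM : ∀ y : ℝ, ‖(c : ℂ) + (1 + I) * y‖ ^ (-s.re) *
      Real.exp (((c : ℂ) + (1 + I) * y).arg * s.im - 2 * Real.pi * (c + y) * y) ≤ M * Real.exp (-a * y ^ 2))
    (hK : K = 2 * ∫ y : ℝ, Real.exp (-a * y ^ 2)) :
    ‖auxLine s c‖ ≤ M * K := by
  have hM0 : 0 ≤ M := by
    have := (by positivity : (0:ℝ) ≤ _).trans (hM 0)
    simpa using this
  have h2 : ‖(1 + I : ℂ)‖ ≤ 2 := (norm_add_le _ _).trans (by simp; norm_num)
  refine (norm_integral_le_of_norm_le (g := fun y => M * Real.exp (-a * y ^ 2) * 2)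
    (((integrable_exp_neg_mul_sq ha).const_mul M).mul_const 2) (ae_of_all _ fun y => ?_)).trans_eq ?_
  · rw [norm_mul, riemannAuxIntegrand_eq, norm_div]
    have h1 : ‖auxKernel s (c + (1 + I) * y)‖ ≤ M * Real.exp (-a * y ^ 2) := by
      rw [norm_auxKernel (slantedLine_ne_zero hc y), mul_assoc, ← Real.exp_add]
      refine le_trans (le_of_eq ?_) (hM y)
      congr 2
      simp
      ring
    exact mul_le_mul ((div_le_self (norm_nonneg _) (hD y)).trans h1) h2 (norm_nonneg _) (by positivity)
  · rw [integral_mul_const, integral_const_mul, hK]; ring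

theorem norm_sq_slantedLine_ge (c y : ℝ) : c ^ 2 / 2 ≤ ‖(c : ℂ) + (1 + I) * y‖ ^ 2 := by
  rw [← Complex.normSq_eq_norm_sq, Complex.normSq_apply]
  simp
  nlinarith [sq_nonneg (c + 2 * y)]

/-- Points of the line have modulus at least `c/2`, so `‖x‖^{-σ} ≤ (c/2)^{-σ}`, and the remaining
factor is the Gaussian of `arg_mul_sub_le`. -/
theorem exists_norm_auxLine_le_of_re_nonneg : ∃ C, 0 < C ∧ ∀ (s : ℂ) (N : ℕ), 0 ≤ s.im → 0 ≤ s.re →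
    Real.sqrt (s.im / (2 * Real.pi)) + 1 / 2 ≤ N + 1 / 2 →
    (N : ℝ) + 1 / 2 ≤ Real.sqrt (s.im / (2 * Real.pi)) + 3 / 2 →
    ‖auxLine s (N + 1 / 2)‖ ≤ C * (((N : ℝ) + 1 / 2) / 2) ^ (-s.re) := by
  refine ⟨Real.exp 20 * (1 + 2 * ∫ y : ℝ, Real.exp (-1 * y ^ 2)), by positivity, ?_⟩
  intro s N ht hσ h1 h2
  set c : ℝ := N + 1 / 2 with hc
  have hc0 : 0 < c := by positivity
  have hD : ∀ y : ℝ, 1 ≤ ‖auxDenom (c + (1 + I) * y)‖ := fun y => by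
    simpa [hc] using one_le_norm_auxDenom N y
  refine (norm_auxLine_le (M := Real.exp 20 * (c / 2) ^ (-s.re)) (a := 1) hc0 hD one_pos
    (fun y => ?_) rfl).trans ?_
  · have e1 : ‖(c : ℂ) + (1 + I) * y‖ ^ (-s.re) ≤ (c / 2) ^ (-s.re) := by
      refine Real.rpow_le_rpow_of_nonpos (by positivity) ?_ (by linarith)
      have := abs_le_two_mul_norm_slantedLine c y
      rw [abs_of_pos hc0] at this
      linarith
    have e2 := Real.exp_le_exp.mpr (arg_mul_sub_le ht h1 h2 y)
    calc _ ≤ (c / 2) ^ (-s.re) * Real.exp (20 - y ^ 2) := by gcongr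
      _ = _ := by rw [sub_eq_add_neg, Real.exp_add]; ring_nf
  · have : 0 ≤ Real.exp 20 * (c / 2) ^ (-s.re) := by positivity
    nlinarith

/-- For `|σ| ≤ c` one has `(c + 2|y|)^{|σ|} ≤ c^{|σ|} e^{2|y|}`, and the Gaussian absorbs `e^{2|y|}`
with a constant independent of `s`. -/
theorem exists_norm_auxLine_le_of_abs_re_le : ∃ C, 0 < C ∧ ∀ (s : ℂ) (N : ℕ), 0 ≤ s.im → s.re ≤ 0 →
    |s.re| ≤ (N : ℝ) + 1 / 2 →
    Real.sqrt (s.im / (2 * Real.pi)) + 1 / 2 ≤ N + 1 / 2 →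
    (N : ℝ) + 1 / 2 ≤ Real.sqrt (s.im / (2 * Real.pi)) + 3 / 2 →
    ‖auxLine s (N + 1 / 2)‖ ≤ C * ((N : ℝ) + 1 / 2) ^ |s.re| := by
  refine ⟨Real.exp 22 * (1 + 2 * ∫ y : ℝ, Real.exp (-(1 / 2) * y ^ 2)), by positivity, ?_⟩
  intro s N ht hσ hσc h1 h2
  set c : ℝ := N + 1 / 2 with hc
  have hc0 : 0 < c := by positivity
  have hD : ∀ y : ℝ, 1 ≤ ‖auxDenom (c + (1 + I) * y)‖ := fun y => by
    simpa [hc] using one_le_norm_auxDenom N y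
  refine (norm_auxLine_le (M := Real.exp 22 * c ^ |s.re|) (a := 1 / 2) hc0 hD (by norm_num)
    (fun y => ?_) rfl).trans ?_
  · have e1 : ‖(c : ℂ) + (1 + I) * y‖ ^ (-s.re) ≤ c ^ |s.re| * Real.exp (2 * |y|) := by
      rw [← abs_of_nonpos hσ]
      have ha := norm_slantedLine_le c y
      rw [abs_of_pos hc0] at ha
      have hb : c + 2 * |y| ≤ c * Real.exp (2 * |y| / c) := by
        have := Real.add_one_le_exp (2 * |y| / c)
        calc c + 2 * |y| = c * (2 * |y| / c + 1) := by field_simp; ring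
          _ ≤ _ := by gcongr
      calc ‖(c : ℂ) + (1 + I) * y‖ ^ |s.re| ≤ (c * Real.exp (2 * |y| / c)) ^ |s.re| := by
            gcongr; exact ha.trans hb
        _ = c ^ |s.re| * Real.exp (2 * |y| / c * |s.re|) := by
            rw [Real.mul_rpow hc0.le (Real.exp_pos _).le, ← Real.exp_mul]
        _ ≤ _ := by
            refine mul_le_mul_of_nonneg_left (Real.exp_le_exp.mpr ?_) (by positivity)
            rw [div_mul_eq_mul_div, div_le_iff₀ hc0]
            exact mul_le_mul_of_nonneg_left hσc (by positivity)
    have e2 := Real.exp_le_exp.mpr (arg_mul_sub_le ht h1 h2 y)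
    calc _ ≤ c ^ |s.re| * Real.exp (2 * |y|) * Real.exp (20 - y ^ 2) := by gcongr
      _ = c ^ |s.re| * Real.exp (2 * |y| + (20 - y ^ 2)) := by rw [Real.exp_add]; ring
      _ ≤ c ^ |s.re| * Real.exp (22 + -(1 / 2) * y ^ 2) := by
          gcongr ?_ * Real.exp ?_
          nlinarith [sq_nonneg (|y| - 2), sq_abs y]
      _ = _ := by rw [Real.exp_add]; ring
  · have : 0 ≤ Real.exp 22 * c ^ |s.re| := by positivity
    nlinarith

/-- Comparison with the telescoping series of `1/((n+1)(n+2)(n+3))`. The value `1/4` leaves another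
`1/4` for the line integral when `R(s)` is compared with `1`. -/
theorem sum_cube_le (N : ℕ) : ∑ n ∈ Finset.range N, ((n + 2 : ℕ) : ℝ) ^ (-3 : ℝ) ≤ 1 / 4 := by
  have h : ∀ N : ℕ, ∑ n ∈ Finset.range N, ((n + 2 : ℕ) : ℝ) ^ (-3 : ℝ) ≤
      1 / 4 - 1 / (2 * ((N + 1 : ℝ) * (N + 2))) := by
    intro N
    induction N with
    | zero => norm_num
    | succ N ih =>
      rw [Finset.sum_range_succ]
      have e : ((N + 2 : ℕ) : ℝ) ^ (-3 : ℝ) ≤ 1 / (2 * ((N + 1 : ℝ) * (N + 2))) - 1 / (2 * ((N + 2 : ℝ) * (N + 3))) := by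
        rw [Real.rpow_neg (by positivity)]
        push_cast
        rw [show ((N : ℝ) + 2) ^ (3 : ℝ) = ((N : ℝ) + 2) ^ (3 : ℕ) by
          rw [← Real.rpow_natCast]; norm_num]
        have e2 : 1 / (2 * ((N + 1 : ℝ) * (N + 2))) - 1 / (2 * ((N + 2 : ℝ) * (N + 3))) =
            1 / ((N + 1 : ℝ) * (N + 2) * (N + 3)) := by field_simp; ring
        rw [e2, inv_eq_one_div]
        refine one_div_le_one_div_of_le (by positivity) ?_
        have : (0 : ℝ) ≤ N := Nat.cast_nonneg N
        nlinarith
      push_cast at *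
      have e3 : (N : ℝ) + 1 + 1 = N + 2 := by ring
      have e4 : (N : ℝ) + 1 + 2 = N + 3 := by ring
      rw [e3, e4]
      linarith
  exact (h N).trans (by have : 0 < 1 / (2 * ((N + 1 : ℝ) * (N + 2))) := by positivity
                        linarith)

/-- `R(s)` is close to `1` for `σ ≥ 3` and large `t`. -/
theorem exists_norm_riemannAux_sub_one_le : ∃ t₁ : ℝ, 1 ≤ t₁ ∧ ∀ s : ℂ, 3 ≤ s.re → t₁ ≤ s.im →
    ‖riemannAux s - 1‖ ≤ 1 / 2 := by
  obtain ⟨C, hC0, hC⟩ := exists_norm_auxLine_le_of_re_nonneg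
  -- Ensures `c/2 ≥ 1 + 4C`, hence `C (c/2)^{-σ} ≤ C/(1 + 4C) ≤ 1/4`.
  set B : ℝ := 2 * (1 + 4 * C) with hB
  refine ⟨2 * Real.pi * B ^ 2, by nlinarith [Real.pi_gt_three], ?_⟩
  intro s hσ ht
  obtain ⟨N, h1, h2⟩ := exists_natCast_add_half s.im
  have ht0 : 0 ≤ s.im := le_trans (by positivity) ht
  have hL := hC s N ht0 (by linarith) h1 h2
  have hBc : B ≤ Real.sqrt (s.im / (2 * Real.pi)) := by
    refine Real.le_sqrt_of_sq_le ?_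
    rw [le_div_iff₀ (by positivity)]
    linarith
  set c : ℝ := N + 1 / 2 with hc
  have hBc2 : 1 + 4 * C ≤ c / 2 := by linarith
  have hN : 1 ≤ N := by
    by_contra! h
    have : N = 0 := by omega
    rw [this] at hc
    norm_num at hc
    rw [hc] at hBc2
    linarith
  have hL2 : ‖auxLine s c‖ ≤ 1 / 4 := by
    refine hL.trans ?_
    have e1 : (c / 2) ^ (-s.re) ≤ (c / 2) ^ (-1 : ℝ) :=
      Real.rpow_le_rpow_of_exponent_le (by linarith) (by linarith)
    rw [Real.rpow_neg_one] at e1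
    have e2 : (c / 2)⁻¹ ≤ (1 + 4 * C)⁻¹ := inv_anti₀ (by positivity) hBc2
    calc C * (c / 2) ^ (-s.re) ≤ C * (1 + 4 * C)⁻¹ := by gcongr; exact e1.trans e2
      _ ≤ 1 / 4 := by rw [← div_eq_mul_inv, div_le_iff₀ (by positivity)]; linarith
  obtain ⟨M, rfl⟩ : ∃ M, N = M + 1 := ⟨N - 1, by omega⟩
  rw [riemannAux_eq_sum_sub_auxLine s (M + 1), Finset.sum_range_succ']
  have e3 : ((0 + 1 : ℕ) : ℂ) ^ (-s) = 1 := by simp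
  rw [e3]
  have e4 : ‖∑ n ∈ Finset.range M, ((n + 1 + 1 : ℕ) : ℂ) ^ (-s)‖ ≤ 1 / 4 := by
    refine (norm_sum_le _ _).trans (le_trans (Finset.sum_le_sum fun n _ => ?_) (sum_cube_le M))
    rw [Complex.norm_natCast_cpow_of_pos (by omega), Complex.neg_re]
    refine Real.rpow_le_rpow_of_exponent_le ?_ (by linarith)
    push_cast
    linarith [(Nat.cast_nonneg n : (0 : ℝ) ≤ n)]
  have e5 : ∀ a b : ℂ, ‖a‖ ≤ 1 / 4 → ‖b‖ ≤ 1 / 4 → ‖a + 1 - b - 1‖ ≤ 1 / 2 := by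
    intro a b ha hb
    rw [show a + 1 - b - 1 = a - b by ring]
    exact (norm_sub_le _ _).trans (by linarith)
  exact e5 _ _ e4 (by rw [hc] at hL2; exact hL2)

/-- Polynomial growth of `R(s)` in the range `|σ| ≤ √t / 3`. -/
theorem exists_norm_riemannAux_le : ∃ C, 1 ≤ C ∧ ∀ s : ℂ, 36 ≤ s.im → |s.re| ≤ Real.sqrt s.im / 3 →
    ‖riemannAux s‖ ≤ C * Real.sqrt s.im ^ (|s.re| + 1) := by
  obtain ⟨C₁, hC₁0, hC₁⟩ := exists_norm_auxLine_le_of_re_nonneg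
  obtain ⟨C₂, hC₂0, hC₂⟩ := exists_norm_auxLine_le_of_abs_re_le
  refine ⟨1 + C₁ + C₂, by linarith, ?_⟩
  intro s ht hσ
  have ht0 : 0 ≤ s.im := by linarith
  obtain ⟨N, h1, h2⟩ := exists_natCast_add_half s.im
  have h6 : 6 ≤ Real.sqrt s.im := Real.le_sqrt_of_sq_le (by norm_num; exact ht)
  -- As `2π < 9`, the range `|σ| ≤ √t/3` lies within `|σ| ≤ c`, which the bound for negative `σ`
  -- requires.
  have hlow : Real.sqrt s.im / 3 ≤ Real.sqrt (s.im / (2 * Real.pi)) := by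
    refine Real.le_sqrt_of_sq_le ?_
    rw [div_pow, Real.sq_sqrt ht0]
    exact div_le_div_of_nonneg_left ht0 (by positivity) (by nlinarith [Real.pi_lt_four])
  have hup : Real.sqrt (s.im / (2 * Real.pi)) ≤ Real.sqrt s.im / 2 := by
    refine Real.sqrt_le_iff.mpr ⟨by positivity, ?_⟩
    rw [div_pow, Real.sq_sqrt ht0]
    exact div_le_div_of_nonneg_left ht0 (by positivity) (by nlinarith [Real.pi_gt_three])
  set c : ℝ := N + 1 / 2 with hc
  set w := Real.sqrt s.im with hw
  have hc2 : 2 ≤ c := by linarith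
  have hcw : c ≤ w := by linarith
  have hNw : (N : ℝ) ≤ w := by linarith
  have hw1 : 1 ≤ w := by linarith
  have hp1 : 1 ≤ w ^ |s.re| := Real.one_le_rpow hw1 (abs_nonneg _)
  have hL : ‖auxLine s c‖ ≤ (C₁ + C₂) * w ^ |s.re| := by
    rcases le_or_gt 0 s.re with h | h
    · refine (hC₁ s N ht0 h h1 h2).trans ?_
      have : (c / 2) ^ (-s.re) ≤ 1 := Real.rpow_le_one_of_one_le_of_nonpos (by linarith) (by linarith)
      nlinarith
    · refine (hC₂ s N ht0 h.le (by linarith) h1 h2).trans ?_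
      have : c ^ |s.re| ≤ w ^ |s.re| := Real.rpow_le_rpow (by linarith) hcw (abs_nonneg _)
      nlinarith
  have hS : ‖∑ n ∈ Finset.range N, ((n + 1 : ℕ) : ℂ) ^ (-s)‖ ≤ w * w ^ |s.re| := by
    refine (norm_sum_le_of_le (f := fun n : ℕ => ((n + 1 : ℕ) : ℂ) ^ (-s)) (Finset.range N) (n := fun _ => w ^ |s.re|) fun n hn => ?_).trans ?_
    · rw [Complex.norm_natCast_cpow_of_pos (by omega), Complex.neg_re]
      have hn1 : (1 : ℝ) ≤ ((n + 1 : ℕ) : ℝ) := by push_cast; linarith [(Nat.cast_nonneg n : (0 : ℝ) ≤ n)]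
      have hn2 : ((n + 1 : ℕ) : ℝ) ≤ w := by
        have : n + 1 ≤ N := Finset.mem_range.mp hn
        exact le_trans (by exact_mod_cast this) hNw
      calc ((n + 1 : ℕ) : ℝ) ^ (-s.re) ≤ ((n + 1 : ℕ) : ℝ) ^ |s.re| :=
            Real.rpow_le_rpow_of_exponent_le hn1 (neg_le_abs _)
        _ ≤ _ := Real.rpow_le_rpow (by linarith) hn2 (abs_nonneg _)
    · rw [Finset.sum_const, Finset.card_range, nsmul_eq_mul]
      gcongr
  rw [riemannAux_eq_sum_sub_auxLine s N, Real.rpow_add (by linarith), Real.rpow_one]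
  refine (norm_sub_le _ _).trans ?_
  rw [← hc]
  have : (C₁ + C₂) * w ^ |s.re| ≤ (C₁ + C₂) * (w ^ |s.re| * w) := by
    gcongr
    exact le_mul_of_one_le_right (by positivity) hw1
  nlinarith

/-- For bounded `t` there are no zeros far to the right. -/
theorem exists_riemannAux_ne_zero_right (T : ℝ) : ∃ σ₁ : ℝ, ∀ s : ℂ, σ₁ ≤ s.re → |s.im| ≤ T →
    riemannAux s ≠ 0 := by
  set J := 2 * ∫ y : ℝ, Real.exp (-1 * y ^ 2) with hJ
  have hJ0 : 0 ≤ J := by positivity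
  set B : ℝ := Real.exp (Real.pi * T + (3 * Real.pi) ^ 2) * J with hB
  -- The line through `3/2` has distance `3/(2√2) > 53/50` from the origin. With one pole crossed,
  -- `R(s) = 1 - auxLine s (3/2)`, and the integral decays geometrically as `σ → ∞` for bounded `t`.
  have hlim : Tendsto (fun x : ℝ => (53 / 50 : ℝ) ^ (-x) * B) atTop (𝓝 0) := by
    have h1 : Tendsto (fun x : ℝ => ((53 / 50 : ℝ)⁻¹) ^ x) atTop (𝓝 0) :=
      tendsto_rpow_atTop_of_base_lt_one _ (by norm_num) (by norm_num)
    have := h1.mul_const B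
    rw [zero_mul] at this
    refine this.congr fun x => ?_
    rw [Real.inv_rpow (by norm_num), Real.rpow_neg (by norm_num)]
  obtain ⟨σ₁, hσ₁⟩ := eventually_atTop.mp (hlim.eventually (gt_mem_nhds one_pos))
  refine ⟨max σ₁ 0, fun s hs ht h0 => ?_⟩
  have hσ0 : 0 ≤ s.re := (le_max_right _ _).trans hs
  have h1 := riemannAux_eq_sum_sub_auxLine s 1
  rw [h0] at h1
  simp at h1
  have h2 : auxLine s (3 / 2) = 1 := by
    have : (1 + 2⁻¹ : ℝ) = 3 / 2 := by norm_num
    rw [this] at h1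
    exact (sub_eq_zero.mp h1.symm).symm
  have hD : ∀ y : ℝ, 1 ≤ ‖auxDenom (((3 / 2 : ℝ) : ℂ) + (1 + I) * y)‖ := fun y => by
    have := one_le_norm_auxDenom 1 y
    norm_num at this ⊢
    exact this
  have h3 := norm_auxLine_le (s := s) (c := 3 / 2) (K := J) (a := 1)
    (M := (53 / 50 : ℝ) ^ (-s.re) * Real.exp (Real.pi * T + (3 * Real.pi) ^ 2)) (by norm_num) hD one_pos ?_ hJ
  · rw [h2, norm_one, mul_assoc, ← hB] at h3
    exact absurd (hσ₁ s.re ((le_max_left _ _).trans hs)) (not_lt.mpr h3)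
  · intro y
    rw [mul_assoc ((53 / 50 : ℝ) ^ (-s.re)), ← Real.exp_add]
    refine mul_le_mul ?_ (Real.exp_le_exp.mpr ?_) (Real.exp_pos _).le (by positivity)
    · refine Real.rpow_le_rpow_of_nonpos (by norm_num) ?_ (by linarith)
      have := norm_sq_slantedLine_ge (3 / 2) y
      exact le_of_sq_le_sq (by norm_num at this ⊢; linarith) (norm_nonneg _)
    · have e1 := (abs_arg_mul_le (((3 / 2 : ℝ) : ℂ) + (1 + I) * y) s.im).trans
        (mul_le_mul_of_nonneg_left ht Real.pi_pos.le)
      have e2 := linear_sub_sq_le (Real.pi * T) (3 * Real.pi) y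
      nlinarith [neg_abs_le y, Real.pi_pos]

/-! ### Reduction to a ray integral for `σ ≤ -1` -/

/-- On the lines with `0 ≤ c ≤ 1/2` the only zero of the denominator is the simple one at the
origin. It costs one power of `‖x‖`, which `‖x‖^{-σ}` supplies when `σ ≤ -1`; hence the line can be
moved up to the origin. -/
theorem min_le_norm_auxDenom {c : ℝ} (hc : c ∈ Icc (0 : ℝ) (1 / 2)) (y : ℝ) :
    min ‖(c : ℂ) + (1 + I) * y‖ 1 ≤ ‖auxDenom (c + (1 + I) * y)‖ := by
  have h1 := two_pi_abs_im_le_norm_auxDenom (c + (1 + I) * y)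
  have h2 := two_abs_sin_le_norm_auxDenom (c + (1 + I) * y)
  have hre : ((c : ℂ) + (1 + I) * y).re = c + y := by simp
  have him : ((c : ℂ) + (1 + I) * y).im = y := by simp
  rw [him] at h1
  rw [hre] at h2
  have hpi := Real.pi_gt_three
  rcases le_or_gt (1 / 4) |y| with h | h
  · exact (min_le_right _ _).trans (by nlinarith)
  · refine (min_le_left _ _).trans ?_
    have h3 : 2 / 3 * |c + y| ≤ |Real.sin (Real.pi * (c + y))| := by
      have hy := abs_lt.mp h
      rcases le_or_gt |c + y| (1 / 2) with h4 | h4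
      · have h5 : |Real.sin (Real.pi * (c + y))| = Real.sin (Real.pi * |c + y|) := by
          rcases le_or_gt 0 (c + y) with h6 | h6
          · rw [abs_of_nonneg h6, abs_of_nonneg]
            rw [abs_of_nonneg h6] at h4
            exact Real.sin_nonneg_of_nonneg_of_le_pi (by positivity) (by nlinarith)
          · rw [abs_of_neg h6, mul_neg, Real.sin_neg, abs_of_nonpos]
            rw [abs_of_neg h6] at h4
            exact Real.sin_nonpos_of_nonpos_of_neg_pi_le (by nlinarith) (by nlinarith)
        rw [h5]
        have := Real.mul_le_sin (x := Real.pi * |c + y|) (by positivity) (by nlinarith)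
        have e : 2 / Real.pi * (Real.pi * |c + y|) = 2 * |c + y| := by field_simp
        rw [e] at this
        linarith [abs_nonneg (c + y)]
      · have h0 : 0 < c + y := by
          by_contra! h0
          rw [abs_of_nonpos h0] at h4
          linarith [hc.1]
        rw [abs_of_pos h0] at h4 ⊢
        have h5 : Real.sin (Real.pi * (c + y)) = Real.sin (Real.pi * (1 - (c + y))) := by
          rw [mul_sub, mul_one, Real.sin_pi_sub]
        rw [h5]
        have := Real.mul_le_sin (x := Real.pi * (1 - (c + y))) (by nlinarith [hc.2]) (by nlinarith)
        have e : 2 / Real.pi * (Real.pi * (1 - (c + y))) = 2 * (1 - (c + y)) := by field_simp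
        rw [e] at this
        exact le_trans (by linarith [hc.2]) (this.trans (le_abs_self _))
    have h4 := Complex.norm_le_abs_re_add_abs_im ((c : ℂ) + (1 + I) * y)
    rw [hre, him] at h4
    nlinarith [abs_nonneg y, abs_nonneg (c + y)]

theorem rpow_le_exp_mul {r q p : ℝ} (hr : 0 ≤ r) (hq : 0 ≤ q) (hqp : q ≤ p) :
    r ^ q ≤ Real.exp (p * r) := by
  have h1 : r ≤ Real.exp r := by linarith [Real.add_one_le_exp r]
  calc r ^ q ≤ Real.exp r ^ q := Real.rpow_le_rpow hr h1 hq
    _ = Real.exp (r * q) := by rw [← Real.exp_mul]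
    _ ≤ _ := Real.exp_le_exp.mpr (by nlinarith)

theorem exists_norm_riemannAuxIntegrand_le {s : ℂ} (hs : s.re ≤ -1) : ∃ C, 0 < C ∧
    ∀ c ∈ Icc (0 : ℝ) (1 / 2), ∀ y : ℝ, (c : ℂ) + (1 + I) * y ≠ 0 →
      ‖riemannAuxIntegrand s (c + (1 + I) * y)‖ ≤ C * Real.exp (-y ^ 2) := by
  set p := -s.re with hp
  have hp1 : 1 ≤ p := by linarith
  refine ⟨2 * Real.exp (p / 2 + Real.pi * |s.im| + (2 * p + Real.pi) ^ 2), by positivity, ?_⟩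
  intro c hc y hx
  have hD := min_le_norm_auxDenom hc y
  have hre : ((c : ℂ) + (1 + I) * y).re = c + y := by simp
  have him : ((c : ℂ) + (1 + I) * y).im = y := by simp
  rw [riemannAuxIntegrand_eq, norm_div, norm_auxKernel hx, ← hp, hre, him]
  have hle := norm_slantedLine_le c y
  rw [abs_of_nonneg hc.1] at hle
  set x : ℂ := c + (1 + I) * y
  have hn : 0 < ‖x‖ := norm_pos_iff.mpr hx
  have hxm : 0 < min ‖x‖ 1 := lt_min hn one_pos
  have e1 : ‖x‖ ^ p / ‖auxDenom x‖ ≤ 2 * Real.exp (p * (1 / 2 + 2 * |y|)) := by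
    have e2 : ‖x‖ ^ p / ‖auxDenom x‖ ≤ 2 * Real.exp (p * ‖x‖) := by
      refine (div_le_div_of_nonneg_left (by positivity) hxm hD).trans ?_
      rcases le_total ‖x‖ 1 with h | h
      · rw [min_eq_left h]
        have : ‖x‖ ^ p / ‖x‖ = ‖x‖ ^ (p - 1) := by rw [Real.rpow_sub hn, Real.rpow_one]
        rw [this]
        have := rpow_le_exp_mul (r := ‖x‖) (q := p - 1) (p := p) hn.le (by linarith) (by linarith)
        linarith [Real.exp_pos (p * ‖x‖)]
      · rw [min_eq_right h, div_one]
        have := rpow_le_exp_mul (r := ‖x‖) (q := p) (p := p) hn.le (by linarith) le_rfl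
        linarith [Real.exp_pos (p * ‖x‖)]
    refine e2.trans ?_
    gcongr
    linarith [hc.2]
  have e3 := Real.exp_le_exp.mpr (abs_arg_mul_le x s.im)
  have e4 : Real.exp (-(2 * Real.pi * (c + y) * y)) ≤ Real.exp (Real.pi * |y| - 2 * Real.pi * y ^ 2) := by
    refine Real.exp_le_exp.mpr ?_
    have : -(c * y) ≤ 1 / 2 * |y| := by
      have := neg_abs_le y
      nlinarith [hc.2, hc.1, abs_nonneg y]
    nlinarith [Real.pi_pos]
  calc _ = ‖x‖ ^ p / ‖auxDenom x‖ * Real.exp (x.arg * s.im) * Real.exp (-(2 * Real.pi * (c + y) * y)) := by ring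
    _ ≤ 2 * Real.exp (p * (1 / 2 + 2 * |y|)) * Real.exp (Real.pi * |s.im|) *
        Real.exp (Real.pi * |y| - 2 * Real.pi * y ^ 2) := by gcongr
    _ = 2 * Real.exp (p * (1 / 2 + 2 * |y|) + Real.pi * |s.im| + (Real.pi * |y| - 2 * Real.pi * y ^ 2)) := by
        rw [Real.exp_add, Real.exp_add]; ring
    _ ≤ 2 * Real.exp (p / 2 + Real.pi * |s.im| + (2 * p + Real.pi) ^ 2 + -y ^ 2) := by
        refine mul_le_mul_of_nonneg_left (Real.exp_le_exp.mpr ?_) zero_le_two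
        have := linear_sub_sq_le (p / 2 + Real.pi * |s.im|) (2 * p + Real.pi) y
        linarith
    _ = _ := by rw [Real.exp_add]; ring

theorem differentiableAt_riemannAuxIntegrand {s x : ℂ} (hx : x ∈ slitPlane) (hD : auxDenom x ≠ 0) :
    DifferentiableAt ℂ (riemannAuxIntegrand s) x :=
  (differentiableAt_auxKernel hx).div differentiable_auxDenom.differentiableAt hD

theorem auxDenom_ne_zero_of_mem_strip {x : ℂ} (h0 : 0 < x.re - x.im) (h1 : x.re - x.im < 1) :
    auxDenom x ≠ 0 := by
  intro h
  obtain ⟨k, rfl⟩ := (auxDenom_eq_zero_iff x).mp h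
  simp only [intCast_re, intCast_im, sub_zero] at h0 h1
  have h2 : 0 < k := by exact_mod_cast h0
  have h3 : k < 1 := by exact_mod_cast h1
  omega

theorem auxDenom_ne_zero_of_im {x : ℂ} (h0 : x.im ≠ 0) : auxDenom x ≠ 0 := by
  intro h
  obtain ⟨k, rfl⟩ := (auxDenom_eq_zero_iff x).mp h
  simp at h0

theorem integrable_riemannAuxIntegrand_of_mem {s : ℂ} (hs : s.re ≤ -1) {c : ℝ}
    (hc : c ∈ Icc (0 : ℝ) (1 / 2)) :
    Integrable fun y : ℝ => riemannAuxIntegrand s (c + (1 + I) * y) := by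
  obtain ⟨C, hC0, hC⟩ := exists_norm_riemannAuxIntegrand_le hs
  have hmem : ∀ y ∈ ({0}ᶜ : Set ℝ), (c : ℂ) + (1 + I) * y ∈ slitPlane ∧
      auxDenom (c + (1 + I) * y) ≠ 0 := by
    intro y hy
    have hy0 : ((c : ℂ) + (1 + I) * y).im ≠ 0 := by simpa using hy
    exact ⟨Complex.mem_slitPlane_iff.mpr (Or.inr hy0), auxDenom_ne_zero_of_im hy0⟩
  have hae : ({0}ᶜ : Set ℝ) ∈ ae (volume : Measure ℝ) := by
    rw [compl_mem_ae_iff]; exact measure_singleton 0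
  refine Integrable.mono' (integrable_exp_neg_sq.const_mul C) ?_ ?_
  · have h1 : ContinuousOn (fun y : ℝ => riemannAuxIntegrand s (c + (1 + I) * y)) {0}ᶜ := by
      intro y hy
      refine ContinuousAt.continuousWithinAt ?_
      exact ContinuousAt.comp (f := fun y : ℝ => (c : ℂ) + (1 + I) * y)
        (differentiableAt_riemannAuxIntegrand (hmem y hy).1 (hmem y hy).2).continuousAt (by fun_prop)
    have h2 := h1.aestronglyMeasurable (μ := volume) (measurableSet_singleton (0 : ℝ)).compl
    have h3 : ∀ᵐ y : ℝ, y ∈ ({0}ᶜ : Set ℝ) := hae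
    rwa [Measure.restrict_eq_self_of_ae_mem h3] at h2
  · filter_upwards [hae] with y hy
    exact hC c hc y (Complex.slitPlane_ne_zero (hmem y hy).1)

theorem auxLine_eq_auxLine_half {s : ℂ} (hs : s.re ≤ -1) {c : ℝ} (hc0 : 0 < c) (hc : c ≤ 1 / 2) :
    auxLine s c = auxLine s (1 / 2) := by
  obtain ⟨C, hC0, hC⟩ := exists_norm_riemannAuxIntegrand_le hs
  refine integral_slantedLine_eq (α := 0) (β := 1) (b := fun y => C * Real.exp (-y ^ 2)) ?_ hc0 hc
    (by norm_num) (integrable_riemannAuxIntegrand_of_mem hs ⟨hc0.le, hc⟩)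
    (integrable_riemannAuxIntegrand_of_mem hs ⟨by norm_num, le_rfl⟩)
    (by simpa using tendsto_exp_neg_sq_atTop.const_mul C)
    (by simpa using tendsto_exp_neg_sq_atBot.const_mul C) ?_
  · intro x hx
    exact (differentiableAt_riemannAuxIntegrand (slantedStrip_subset_slitPlane le_rfl hx)
      (auxDenom_ne_zero_of_mem_strip hx.1 hx.2)).differentiableWithinAt
  · intro y _ c' hc'
    exact hC c' ⟨hc0.le.trans hc'.1, hc'.2⟩ y (slantedLine_ne_zero (hc0.trans_le hc'.1) y)

/-- The Gaussian majorant is uniform in `c` down to `0`, so dominated convergence applies as `c →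
0+`. -/
theorem auxLine_half_eq_auxLine_zero {s : ℂ} (hs : s.re ≤ -1) : auxLine s (1 / 2) = auxLine s 0 := by
  obtain ⟨C, hC0, hC⟩ := exists_norm_riemannAuxIntegrand_le hs
  have hIoc : Ioc (0 : ℝ) (1 / 2) ∈ 𝓝[>] (0 : ℝ) := Ioc_mem_nhdsGT (by norm_num)
  have key : Tendsto (fun c : ℝ => auxLine s c) (𝓝[>] 0) (𝓝 (auxLine s 0)) := by
    refine tendsto_integral_filter_of_dominated_convergence
      (bound := fun y => C * Real.exp (-y ^ 2) * ‖(1 + I : ℂ)‖) ?_ ?_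
      ((integrable_exp_neg_sq.const_mul C).mul_const _) ?_
    · filter_upwards [hIoc] with c hc
      exact ((integrable_riemannAuxIntegrand_of_mem hs ⟨hc.1.le, hc.2⟩).mul_const _).aestronglyMeasurable
    · filter_upwards [hIoc] with c hc
      refine ae_of_all _ fun y => ?_
      rw [norm_mul]
      exact mul_le_mul_of_nonneg_right (hC c ⟨hc.1.le, hc.2⟩ y (slantedLine_ne_zero hc.1 y)) (norm_nonneg _)
    · have hae : ({0}ᶜ : Set ℝ) ∈ ae (volume : Measure ℝ) := by
        rw [compl_mem_ae_iff]; exact measure_singleton 0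
      filter_upwards [hae] with y hy
      have hy0 : (((0 : ℝ) : ℂ) + (1 + I) * y).im ≠ 0 := by simpa using hy
      have h1 := (differentiableAt_riemannAuxIntegrand (s := s)
        (Complex.mem_slitPlane_iff.mpr (Or.inr hy0)) (auxDenom_ne_zero_of_im hy0)).continuousAt
      have h2 : Tendsto (fun c : ℝ => (c : ℂ) + (1 + I) * y) (𝓝[>] 0) (𝓝 (((0 : ℝ) : ℂ) + (1 + I) * y)) := by
        have : Continuous fun c : ℝ => (c : ℂ) + (1 + I) * y := by fun_prop
        exact (this.tendsto 0).mono_left nhdsWithin_le_nhds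
      exact (h1.tendsto.comp h2).mul_const _
  refine tendsto_nhds_unique (tendsto_const_nhds.congr' ?_) key
  filter_upwards [hIoc] with c hc
  exact (auxLine_eq_auxLine_half hs hc.1 hc.2).symm

/-- The integral of the integrand of `R(s)` along the ray from `0` in the direction `1 + i`. -/
noncomputable def auxRay (s : ℂ) : ℂ :=
  ∫ r in Ioi (0 : ℝ), riemannAuxIntegrand s ((1 + I) * r) * (1 + I)

theorem integrable_auxRay {s : ℂ} (hs : s.re ≤ -1) :
    Integrable fun r : ℝ => riemannAuxIntegrand s ((1 + I) * r) * (1 + I) := by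
  have := (integrable_riemannAuxIntegrand_of_mem hs (c := 0) ⟨le_rfl, by norm_num⟩).mul_const (1 + I)
  simpa using this

theorem auxDenom_neg (x : ℂ) : auxDenom (-x) = -auxDenom x := by
  rw [auxDenom_eq_sin, auxDenom_eq_sin, mul_neg, Complex.sin_neg]; ring

/-- The factor `e^{πix²}` is even, the denominator is odd, and `log(-x) = log x - πi` in the upper
half-plane. This folds the lower half of the line through `0` onto the upper half. -/
theorem riemannAuxIntegrand_neg (s : ℂ) {x : ℂ} (hx : 0 < x.im) :
    riemannAuxIntegrand s (-x) = -(Complex.exp (Real.pi * I * s) * riemannAuxIntegrand s x) := by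
  have hx0 : x ≠ 0 := by rintro rfl; simp at hx
  have hlog : Complex.log (-x) = Complex.log x - Real.pi * I := by
    apply Complex.ext
    · simp [Complex.log_re]
    · simp [Complex.log_im, Complex.arg_neg_eq_arg_sub_pi_of_im_pos hx]
  rw [riemannAuxIntegrand_eq, riemannAuxIntegrand_eq, auxDenom_neg, auxKernel, auxKernel,
    Complex.cpow_def_of_ne_zero hx0, Complex.cpow_def_of_ne_zero (neg_ne_zero.mpr hx0), hlog,
    show (Complex.log x - Real.pi * I) * -s = Complex.log x * -s + Real.pi * I * s by ring,
    Complex.exp_add, neg_sq, div_neg]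
  ring

/-- For `σ ≤ -1` the function `R(s)` is, up to an elementary factor, a single ray integral. -/
theorem riemannAux_eq_auxRay {s : ℂ} (hs : s.re ≤ -1) :
    riemannAux s = -((1 - Complex.exp (Real.pi * I * s)) * auxRay s) := by
  rw [riemannAux_eq_neg_auxLine, auxLine_half_eq_auxLine_zero hs, auxLine]
  simp only [ofReal_zero, zero_add]
  have hi := integrable_auxRay hs
  have e0 := integral_comp_neg_Ioi (0 : ℝ) fun r : ℝ => riemannAuxIntegrand s ((1 + I) * r) * (1 + I)
  rw [neg_zero] at e0
  rw [← intervalIntegral.integral_Iic_add_Ioi (b := 0) hi.integrableOn hi.integrableOn, ← e0]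
  have e : ∫ r in Ioi (0 : ℝ), riemannAuxIntegrand s ((1 + I) * ((-r : ℝ) : ℂ)) * (1 + I) =
      -(Complex.exp (Real.pi * I * s)) * auxRay s := by
    rw [auxRay, ← integral_const_mul]
    refine setIntegral_congr_fun measurableSet_Ioi fun r hr => ?_
    have hr0 : 0 < ((1 + I) * (r : ℂ)).im := by simpa using hr
    rw [ofReal_neg, mul_neg, riemannAuxIntegrand_neg s hr0]
    ring
  rw [e, ← auxRay]
  ring

/-! ### Expansion of the integrand in the upper half-plane -/

/-- The `k`-th term `x^{-s} e^{πix²} e^{πi(2k+1)x}` of the expansion of the integrand in the upper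
half-plane. -/
noncomputable def auxTerm (s : ℂ) (k : ℕ) (x : ℂ) : ℂ :=
  auxKernel s x * Complex.exp (Real.pi * I * (2 * k + 1) * x)

theorem norm_exp_auxTerm (k : ℕ) (x : ℂ) :
    ‖Complex.exp (Real.pi * I * (2 * k + 1) * x)‖ = Real.exp (-(Real.pi * (2 * k + 1) * x.im)) := by
  rw [Complex.norm_exp]
  congr 1
  have : (Real.pi * I * (2 * k + 1) * x : ℂ) = ((Real.pi * (2 * k + 1) : ℝ) : ℂ) * (I * x) := by
    push_cast; ring
  rw [this, Complex.re_ofReal_mul]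
  simp

theorem auxKernel_norm_mul_ofReal {s x : ℂ} (hx : x ≠ 0) {r : ℝ} (hr : 0 < r) :
    ‖auxKernel s (x * r)‖ = ‖auxKernel s x‖ * (r ^ (-s.re) *
      Real.exp (-(2 * Real.pi * x.re * x.im * (r ^ 2 - 1)))) := by
  have hr' : (r : ℂ) ≠ 0 := by exact_mod_cast hr.ne'
  rw [norm_auxKernel (mul_ne_zero hx hr'), norm_auxKernel hx, mul_comm x (r : ℂ),
    Complex.arg_real_mul _ hr, norm_mul, Complex.norm_real, Real.norm_of_nonneg hr.le,
    Real.mul_rpow hr.le (norm_nonneg _), Complex.re_ofReal_mul, Complex.im_ofReal_mul,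
    show -(2 * Real.pi * (r * x.re) * (r * x.im)) = -(2 * Real.pi * x.re * x.im) +
      -(2 * Real.pi * x.re * x.im * (r ^ 2 - 1)) by ring, Real.exp_add]
  ring

theorem norm_auxTerm_mul_ofReal {s x : ℂ} (k : ℕ) (hx : x ≠ 0) {r : ℝ} (hr : 0 < r) :
    ‖auxTerm s k (x * r)‖ = ‖auxTerm s k x‖ * (r ^ (-s.re) *
      Real.exp (-(2 * Real.pi * x.re * x.im * (r ^ 2 - 1)) - Real.pi * (2 * k + 1) * x.im * (r - 1))) := by
  rw [auxTerm, auxTerm, norm_mul, norm_mul, auxKernel_norm_mul_ofReal hx hr, norm_exp_auxTerm, norm_exp_auxTerm,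
    sub_eq_add_neg (-(2 * Real.pi * x.re * x.im * (r ^ 2 - 1))), Real.exp_add, mul_comm x (r : ℂ), Complex.im_ofReal_mul,
    show -(Real.pi * (2 * k + 1) * (r * x.im)) = -(Real.pi * (2 * k + 1) * x.im) +
      -(Real.pi * (2 * k + 1) * x.im * (r - 1)) by ring, Real.exp_add]
  ring

theorem differentiableAt_auxTerm {s x : ℂ} (k : ℕ) (hx : x ∈ slitPlane) :
    DifferentiableAt ℂ (auxTerm s k) x :=
  (differentiableAt_auxKernel hx).mul (by fun_prop)

theorem norm_auxTerm_le {s x : ℂ} (k : ℕ) (hs : s.re ≤ 0) {M : ℝ} (hx : x ≠ 0) (hM : ‖x‖ ≤ M) :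
    ‖auxTerm s k x‖ ≤ M ^ (-s.re) * Real.exp (Real.pi * |s.im|) * Real.exp (2 * Real.pi * M ^ 2) *
      Real.exp (Real.pi * (2 * k + 1) * M) := by
  have hre := (Complex.abs_re_le_norm x).trans hM
  have him := (Complex.abs_im_le_norm x).trans hM
  have hM0 : 0 ≤ M := (norm_nonneg x).trans hM
  rw [auxTerm, norm_mul, norm_auxKernel hx, norm_exp_auxTerm]
  have h1 := abs_arg_mul_le x s.im
  have h2 : -(2 * Real.pi * x.re * x.im) ≤ 2 * Real.pi * M ^ 2 := by
    have : -(x.re * x.im) ≤ M ^ 2 := by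
      refine (neg_le_abs _).trans ?_
      rw [abs_mul, sq]
      exact mul_le_mul hre him (abs_nonneg _) hM0
    nlinarith [Real.pi_pos]
  have h3 : -(Real.pi * (2 * k + 1) * x.im) ≤ Real.pi * (2 * k + 1) * M := by
    rw [← mul_neg]
    exact mul_le_mul_of_nonneg_left ((neg_le_abs _).trans him) (by positivity)
  have h4 : ‖x‖ ^ (-s.re) ≤ M ^ (-s.re) := Real.rpow_le_rpow (norm_nonneg _) hM (by linarith)
  gcongr

/-- Bound for the numerator on a compact part of the open first quadrant, dilated by `r`. -/
theorem norm_auxKernel_mul_le {s z : ℂ} (hs : s.re ≤ 0) {κ M : ℝ} (hκ : 0 < κ) (hre : κ ≤ z.re)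
    (him : κ ≤ z.im) (hM : ‖z‖ ≤ M) {r : ℝ} (hr : 0 < r) :
    ‖auxKernel s (z * r)‖ ≤ M ^ (-s.re) * Real.exp (Real.pi * |s.im|) *
      (r ^ (-s.re) * Real.exp (-(2 * Real.pi * κ ^ 2) * r ^ 2)) := by
  have hz : z ≠ 0 := by rintro rfl; simp at hre; linarith
  have hr' : (r : ℂ) ≠ 0 := by exact_mod_cast hr.ne'
  rw [norm_auxKernel (mul_ne_zero hz hr'), mul_comm z (r : ℂ), norm_mul, Complex.norm_real,
    Real.norm_of_nonneg hr.le, Real.mul_rpow hr.le (norm_nonneg _), Complex.re_ofReal_mul,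
    Complex.im_ofReal_mul]
  have h1 := abs_arg_mul_le (r * z) s.im
  have h2 : -(2 * Real.pi * (r * z.re) * (r * z.im)) ≤ -(2 * Real.pi * κ ^ 2) * r ^ 2 := by
    have : κ * κ ≤ z.re * z.im := mul_le_mul hre him hκ.le (hκ.le.trans hre)
    have h3 : 0 ≤ 2 * Real.pi * r ^ 2 := by positivity
    nlinarith
  have h4 : ‖z‖ ^ (-s.re) ≤ M ^ (-s.re) := Real.rpow_le_rpow (norm_nonneg _) hM (by linarith)
  have hM0 : 0 ≤ M := (norm_nonneg z).trans hM
  calc _ ≤ r ^ (-s.re) * M ^ (-s.re) * Real.exp (Real.pi * |s.im|) *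
        Real.exp (-(2 * Real.pi * κ ^ 2) * r ^ 2) := by gcongr
    _ = _ := by ring

theorem integrableOn_auxKernel_ray {s z : ℂ} (hs : s.re ≤ 0) (hre : 0 < z.re) (him : 0 < z.im)
    {g : ℂ → ℂ} {B : ℝ} (hg : ∀ r : ℝ, 0 < r → ContinuousAt g (z * r))
    (hB : ∀ r : ℝ, 0 < r → ‖g (z * r)‖ ≤ B) :
    IntegrableOn (fun r : ℝ => auxKernel s (z * r) * g (z * r)) (Ioi 0) := by
  set κ := min z.re z.im
  have hκ : 0 < κ := lt_min hre him
  have hi := (integrableOn_rpow_mul_exp_neg_mul_sq (b := 2 * Real.pi * κ ^ 2) (by positivity)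
    (s := -s.re) (by linarith)).const_mul (‖z‖ ^ (-s.re) * Real.exp (Real.pi * |s.im|) * B)
  have hslit : ∀ r : ℝ, 0 < r → z * r ∈ slitPlane := fun r hr => by
    rw [Complex.mem_slitPlane_iff]
    left
    rw [mul_comm, Complex.re_ofReal_mul]
    positivity
  refine Integrable.mono' hi ?_ ?_
  · refine ContinuousOn.aestronglyMeasurable (fun r hr => ContinuousAt.continuousWithinAt ?_)
      measurableSet_Ioi
    have hc : ContinuousAt (fun r : ℝ => z * (r : ℂ)) r := by fun_prop
    exact (ContinuousAt.comp (f := fun r : ℝ => z * (r : ℂ))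
      (differentiableAt_auxKernel (hslit r hr)).continuousAt hc).mul
      (ContinuousAt.comp (f := fun r : ℝ => z * (r : ℂ)) (hg r hr) hc)
  · refine (ae_restrict_mem measurableSet_Ioi).mono fun r hr => ?_
    rw [norm_mul]
    have h1 := norm_auxKernel_mul_le (s := s) hs hκ (min_le_left _ _) (min_le_right _ _) le_rfl hr (z := z)
    have hB0 := (norm_nonneg _).trans (hB r hr)
    calc _ ≤ ‖z‖ ^ (-s.re) * Real.exp (Real.pi * |s.im|) *
          (r ^ (-s.re) * Real.exp (-(2 * Real.pi * κ ^ 2) * r ^ 2)) * B := by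
          exact mul_le_mul h1 (hB r hr) (norm_nonneg _) ((norm_nonneg _).trans h1)
      _ = _ := by ring

theorem convex_re_pos : Convex ℝ {z : ℂ | 0 < z.re} := convex_halfSpace_re_gt 0

theorem isOpen_re_pos : IsOpen {z : ℂ | 0 < z.re} := isOpen_lt continuous_const Complex.continuous_re

theorem segment_bounds {P D : ℂ} (hP : 0 < P.re ∧ 0 < P.im) (hD : 0 < D.re ∧ 0 < D.im) :
    ∃ κ M : ℝ, 0 < κ ∧ ∀ z ∈ segment ℝ P D, κ ≤ z.re ∧ κ ≤ z.im ∧ ‖z‖ ≤ M := by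
  refine ⟨min (min P.re P.im) (min D.re D.im), max ‖P‖ ‖D‖,
    lt_min (lt_min hP.1 hP.2) (lt_min hD.1 hD.2), ?_⟩
  intro z hz
  set κ := min (min P.re P.im) (min D.re D.im)
  have c1 : Convex ℝ {z : ℂ | κ ≤ z.re} := convex_halfSpace_re_ge κ
  have c2 : Convex ℝ {z : ℂ | κ ≤ z.im} := convex_halfSpace_im_ge κ
  refine ⟨c1.segment_subset ?_ ?_ hz, c2.segment_subset ?_ ?_ hz, ?_⟩
  · exact show κ ≤ P.re from (min_le_left _ _).trans (min_le_left _ _)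
  · exact show κ ≤ D.re from (min_le_right _ _).trans (min_le_left _ _)
  · exact show κ ≤ P.im from (min_le_left _ _).trans (min_le_right _ _)
  · exact show κ ≤ D.im from (min_le_right _ _).trans (min_le_right _ _)
  · have := (convex_closedBall (0 : ℂ) (max ‖P‖ ‖D‖)).segment_subset (x := P) (y := D) (by simp) (by simp) hz
    simpa using this

theorem tendsto_rpow_mul_exp_neg_mul_sq (p : ℝ) {b : ℝ} (hb : 0 < b) :
    Tendsto (fun r : ℝ => r ^ p * Real.exp (-b * r ^ 2)) atTop (𝓝 0) := by
  refine squeeze_zero' (g := fun r : ℝ => r ^ p * Real.exp (-b * r))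
    ((eventually_ge_atTop 0).mono fun r hr => by positivity) ?_ (tendsto_rpow_mul_exp_neg_mul_atTop_nhds_zero p b hb)
  filter_upwards [eventually_ge_atTop 1] with r hr
  refine mul_le_mul_of_nonneg_left (Real.exp_le_exp.mpr ?_) (by positivity)
  have : r ≤ r ^ 2 := by nlinarith
  nlinarith

theorem norm_exp_auxTerm_le_one (k : ℕ) {x : ℂ} (hx : 0 ≤ x.im) :
    ‖Complex.exp (Real.pi * I * (2 * k + 1) * x)‖ ≤ 1 := by
  rw [norm_exp_auxTerm, Real.exp_le_one_iff]
  have : 0 ≤ Real.pi * (2 * k + 1) * x.im := by positivity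
  linarith

/-- The path used for the `k`-th term. -/
theorem integral_auxTerm_eq_path {s : ℂ} (hs : s.re ≤ 0) (k : ℕ) {P Q : ℂ} (hP : 0 < P.re)
    (hQ : 0 < Q.re ∧ 0 < Q.im) :
    ∫ r in Ioi (0 : ℝ), auxTerm s k ((1 + I) * r) * (1 + I) =
      (∫ r in Ioc (0 : ℝ) 1, auxTerm s k (P * r) * P) +
      (∫ r in (0 : ℝ)..1, auxTerm s k (P + (Q - P) * r) * (Q - P)) +
      ∫ r in Ioi (1 : ℝ), auxTerm s k (Q * r) * Q := by
  have hD : 0 < (1 + I : ℂ).re ∧ 0 < (1 + I : ℂ).im := by simp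
  have hslit : ∀ z : ℂ, 0 < z.re → z ∈ slitPlane := fun z hz =>
    Complex.mem_slitPlane_iff.mpr (Or.inl hz)
  have hray : ∀ z : ℂ, 0 < z.re → 0 < z.im →
      IntegrableOn (fun r : ℝ => auxTerm s k (z * r) * z) (Ioi 0) := by
    intro z h1 h2
    refine Integrable.mul_const (integrableOn_auxKernel_ray (B := 1) hs h1 h2
      (g := fun x => Complex.exp (Real.pi * I * (2 * k + 1) * x)) (fun r _ => by fun_prop) ?_) z
    intro r hr
    refine norm_exp_auxTerm_le_one k ?_
    rw [mul_comm, Complex.im_ofReal_mul]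
    positivity
  have hmul : ∀ z : ℂ, 0 < z.re → ∀ r : ℝ, 0 < r → 0 < (z * r).re := by
    intro z hz r hr
    rw [mul_comm, Complex.re_ofReal_mul]
    positivity
  obtain ⟨κ, M, hκ, hseg⟩ := segment_bounds hQ hD
  set M₀ := max ‖P‖ ‖(1 + I : ℂ)‖
  set C₀ := M₀ ^ (-s.re) * Real.exp (Real.pi * |s.im|) * Real.exp (2 * Real.pi * M₀ ^ 2) *
      Real.exp (Real.pi * (2 * k + 1) * M₀)
  have hsmall : ∀ z ∈ segment ℝ P (1 + I), ∀ r : ℝ, 0 < r → r ≤ 1 → ‖auxTerm s k (z * r)‖ ≤ C₀ := by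
    intro z hz r hr hr1
    have hz1 := convex_re_pos.segment_subset hP hD.1 hz
    have hz2 := (convex_closedBall (0 : ℂ) M₀).segment_subset (x := P) (y := 1 + I)
      (by simp [M₀]) (by simp [M₀]) hz
    have hzM : ‖z‖ ≤ M₀ := by simpa using hz2
    refine norm_auxTerm_le k hs ?_ ?_
    · exact Complex.slitPlane_ne_zero (hslit _ (hmul z hz1 r hr))
    · rw [norm_mul, Complex.norm_real, Real.norm_of_nonneg hr.le]
      exact (mul_le_of_le_one_right (norm_nonneg _) hr1).trans hzM
  have hM0 : 0 ≤ M := (norm_nonneg _).trans (hseg Q (left_mem_segment _ _ _)).2.2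
  -- A single term has no poles, so the whole half-plane `Re x > 0` is available and `P` may lie
  -- below the real axis. Decay at infinity needs `Q` in the open first quadrant; near `0` the term
  -- is bounded because `σ ≤ 0`.
  refine integral_ray_eq_path (f := auxTerm s k) isOpen_re_pos convex_re_pos (fun z hz r hr => hmul z hz r hr)
    (fun z hz => (differentiableAt_auxTerm k (hslit z hz)).differentiableWithinAt) hD.1 hP hQ.1
    (hray _ hD.1 hD.2) ?_ ((hray Q hQ.1 hQ.2).mono_set (Ioi_subset_Ioi zero_le_one))
    (b₀ := fun r => C₀ * r)
    (b₁ := fun r => M ^ (-s.re) * Real.exp (Real.pi * |s.im|) *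
      (r ^ (-s.re + 1) * Real.exp (-(2 * Real.pi * κ ^ 2) * r ^ 2))) ?_ ?_ ?_ ?_
  · have hcont : ContinuousOn (fun r : ℝ => auxTerm s k (P * r) * P) (Ioc 0 1) := by
      refine fun r hr => ContinuousAt.continuousWithinAt ?_
      have hc : ContinuousAt (fun r : ℝ => P * (r : ℂ)) r := by fun_prop
      exact (ContinuousAt.comp (f := fun r : ℝ => P * (r : ℂ))
        (differentiableAt_auxTerm k (hslit _ (hmul P hP r hr.1))).continuousAt hc).mul continuousAt_const
    refine Integrable.mono' (g := fun _ => C₀ * ‖P‖) (integrableOn_const (by simp))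
      (hcont.aestronglyMeasurable measurableSet_Ioc) ?_
    · refine (ae_restrict_mem measurableSet_Ioc).mono fun r hr => ?_
      rw [norm_mul]
      exact mul_le_mul_of_nonneg_right (hsmall P (left_mem_segment _ _ _) r hr.1 hr.2) (norm_nonneg _)
  · have : Tendsto (fun r : ℝ => C₀ * r) (𝓝 0) (𝓝 (C₀ * 0)) := tendsto_id.const_mul C₀
    rw [mul_zero] at this
    exact this.mono_left nhdsWithin_le_nhds
  · simpa using (tendsto_rpow_mul_exp_neg_mul_sq (-s.re + 1) (b := 2 * Real.pi * κ ^ 2)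
      (by positivity)).const_mul (M ^ (-s.re) * Real.exp (Real.pi * |s.im|))
  · filter_upwards [Ioc_mem_nhdsGT one_pos] with r hr z hz
    exact mul_le_mul_of_nonneg_right (hsmall z hz r hr.1 hr.2) hr.1.le
  · filter_upwards [eventually_gt_atTop 0] with r hr z hz
    obtain ⟨h1, h2, h3⟩ := hseg z hz
    rw [auxTerm, norm_mul]
    have h4 := norm_auxKernel_mul_le (s := s) hs hκ h1 h2 h3 hr
    have h5 : ‖Complex.exp (Real.pi * I * (2 * k + 1) * (z * r))‖ ≤ 1 := by
      refine norm_exp_auxTerm_le_one k ?_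
      rw [mul_comm, Complex.im_ofReal_mul]
      have := hκ.le.trans h2
      positivity
    calc _ ≤ M ^ (-s.re) * Real.exp (Real.pi * |s.im|) *
          (r ^ (-s.re) * Real.exp (-(2 * Real.pi * κ ^ 2) * r ^ 2)) * 1 * r :=
          mul_le_mul_of_nonneg_right (mul_le_mul h4 h5 (norm_nonneg _) (by positivity)) hr.le
      _ = _ := by rw [Real.rpow_add hr, Real.rpow_one]; ring

/-- The remainder after `K` terms of the expansion of the integrand. -/
noncomputable def auxTail (s : ℂ) (K : ℕ) (x : ℂ) : ℂ :=
  auxKernel s x * (Complex.exp (2 * Real.pi * I * K * x) / auxDenom x)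

/-- A finite geometric series: multiplication by the denominator turns `e^{πi(2k+1)x}` into
`e^{2πi(k+1)x} - e^{2πikx}`, and the sum telescopes. -/
theorem riemannAuxIntegrand_eq_sum (s : ℂ) (K : ℕ) {x : ℂ} (hx : 0 < x.im) :
    riemannAuxIntegrand s x = -(∑ k ∈ Finset.range K, auxTerm s k x) + auxTail s K x := by
  have hD := auxDenom_ne_zero_of_im hx.ne'
  have key : ∀ K : ℕ, auxDenom x * ∑ k ∈ Finset.range K, Complex.exp (Real.pi * I * (2 * k + 1) * x) =
      Complex.exp (2 * Real.pi * I * K * x) - 1 := by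
    intro K
    induction K with
    | zero => simp
    | succ K ih =>
      rw [Finset.sum_range_succ, mul_add, ih, auxDenom, sub_mul, ← Complex.exp_add, ← Complex.exp_add]
      rw [show (Real.pi * I * x + Real.pi * I * (2 * K + 1) * x : ℂ) = 2 * Real.pi * I * (K + 1 : ℕ) * x by
        push_cast; ring, show (-(Real.pi * I * x) + Real.pi * I * (2 * K + 1) * x : ℂ) =
        2 * Real.pi * I * K * x by ring]
      ring
  rw [riemannAuxIntegrand_eq, auxTail]
  simp only [auxTerm]
  rw [← Finset.mul_sum]
  have := key K
  set E := Complex.exp (2 * Real.pi * I * K * x)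
  field_simp
  linear_combination auxKernel s x * this

theorem norm_exp_tail (K : ℕ) (x : ℂ) :
    ‖Complex.exp (2 * Real.pi * I * K * x)‖ = Real.exp (-(2 * Real.pi * K * x.im)) := by
  rw [Complex.norm_exp]
  congr 1
  have : (2 * Real.pi * I * K * x : ℂ) = ((2 * Real.pi * K : ℝ) : ℂ) * (I * x) := by
    push_cast; ring
  rw [this, Complex.re_ofReal_mul]
  simp

theorem norm_tail_factor_le (K : ℕ) {x : ℂ} (hx : 0 < x.im) :
    ‖Complex.exp (2 * Real.pi * I * K * x) / auxDenom x‖ ≤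
      Real.exp (-(2 * Real.pi * K * x.im)) / (2 * Real.pi * x.im) := by
  rw [norm_div, norm_exp_tail]
  have := two_pi_abs_im_le_norm_auxDenom x
  rw [abs_of_pos hx] at this
  gcongr

theorem norm_auxTail_le {s z : ℂ} (K : ℕ) (hs : s.re ≤ 0) {κ M : ℝ} (hκ : 0 < κ) (hre : κ ≤ z.re)
    (him : κ ≤ z.im) (hM : ‖z‖ ≤ M) {r : ℝ} (hr : 0 < r) :
    ‖auxTail s K (z * r)‖ ≤ M ^ (-s.re) * Real.exp (Real.pi * |s.im|) / (2 * Real.pi * κ) *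
      (r ^ (-s.re - 1) * Real.exp (-(2 * Real.pi * κ ^ 2) * r ^ 2)) := by
  have h4 := norm_auxKernel_mul_le (s := s) hs hκ hre him hM hr
  have him' : κ * r ≤ (z * r).im := by
    rw [mul_comm z, Complex.im_ofReal_mul, mul_comm]
    gcongr
  have hpos : 0 < (z * r).im := lt_of_lt_of_le (by positivity) him'
  have h5 := norm_tail_factor_le K hpos
  have h6 : Real.exp (-(2 * Real.pi * K * (z * r).im)) / (2 * Real.pi * (z * r).im) ≤
      1 / (2 * Real.pi * (κ * r)) := by
    gcongr
    rw [Real.exp_le_one_iff]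
    have : 0 ≤ 2 * Real.pi * K * (z * r).im := by positivity
    linarith
  have hM0 := (norm_nonneg z).trans hM
  rw [auxTail, norm_mul]
  calc _ ≤ M ^ (-s.re) * Real.exp (Real.pi * |s.im|) *
        (r ^ (-s.re) * Real.exp (-(2 * Real.pi * κ ^ 2) * r ^ 2)) * (1 / (2 * Real.pi * (κ * r))) :=
        mul_le_mul h4 (h5.trans h6) (norm_nonneg _) (by positivity)
    _ = _ := by rw [Real.rpow_sub hr, Real.rpow_one]; field_simp

theorem differentiableAt_auxTail {s x : ℂ} (K : ℕ) (hx : 0 < x.im) :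
    DifferentiableAt ℂ (auxTail s K) x := by
  refine (differentiableAt_auxKernel (Complex.mem_slitPlane_iff.mpr (Or.inr hx.ne'))).mul ?_
  exact DifferentiableAt.div (by fun_prop) differentiable_auxDenom.differentiableAt
    (auxDenom_ne_zero_of_im hx.ne')

theorem integrableOn_auxTail_ray {s z : ℂ} (K : ℕ) (hs : s.re ≤ -1) (hz : 0 < z.re ∧ 0 < z.im) :
    IntegrableOn (fun r : ℝ => auxTail s K (z * r) * z) (Ioi 0) := by
  obtain ⟨κ, M, hκ, hseg⟩ := segment_bounds hz hz
  obtain ⟨h1, h2, h3⟩ := hseg z (left_mem_segment _ _ _)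
  have hi := ((integrableOn_rpow_mul_exp_neg_mul_sq (b := 2 * Real.pi * κ ^ 2) (by positivity)
    (s := -s.re - 1) (by linarith)).const_mul
      (M ^ (-s.re) * Real.exp (Real.pi * |s.im|) / (2 * Real.pi * κ))).mul_const ‖z‖
  refine Integrable.mono' hi ?_ ?_
  · refine ContinuousOn.aestronglyMeasurable (fun r hr => ContinuousAt.continuousWithinAt ?_)
      measurableSet_Ioi
    have hc : ContinuousAt (fun r : ℝ => z * (r : ℂ)) r := by fun_prop
    refine (ContinuousAt.comp (f := fun r : ℝ => z * (r : ℂ))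
      (differentiableAt_auxTail K ?_).continuousAt hc).mul continuousAt_const
    rw [mul_comm, Complex.im_ofReal_mul]
    exact mul_pos hr hz.2
  · refine (ae_restrict_mem measurableSet_Ioi).mono fun r hr => ?_
    rw [norm_mul]
    exact mul_le_mul_of_nonneg_right (norm_auxTail_le K (by linarith) hκ h1 h2 h3 hr) (norm_nonneg _)

/-- The tail keeps the poles at the integers, so the ray may turn only inside the open first
quadrant. The path with `P = Q = z` is a single ray, its middle piece being empty. -/
theorem integral_auxTail_ray_eq {s : ℂ} (hs : s.re ≤ -1) (K : ℕ) {z : ℂ} (hz : 0 < z.re ∧ 0 < z.im) :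
    ∫ r in Ioi (0 : ℝ), auxTail s K ((1 + I) * r) * (1 + I) =
      ∫ r in Ioi (0 : ℝ), auxTail s K (z * r) * z := by
  have hD : 0 < (1 + I : ℂ).re ∧ 0 < (1 + I : ℂ).im := by simp
  obtain ⟨κ, M, hκ, hseg⟩ := segment_bounds hz hD
  have hs0 : s.re ≤ 0 := by linarith
  set U : Set ℂ := {z : ℂ | 0 < z.re ∧ 0 < z.im} with hU
  have hUo : IsOpen U := isOpen_re_pos.inter (isOpen_lt continuous_const Complex.continuous_im)
  have hUc : Convex ℝ U := convex_re_pos.inter (convex_halfSpace_im_gt 0)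
  have hiz := integrableOn_auxTail_ray K hs hz
  have hM0 : 0 ≤ M := (norm_nonneg z).trans (hseg z (left_mem_segment _ _ _)).2.2
  set C := M ^ (-s.re) * Real.exp (Real.pi * |s.im|) / (2 * Real.pi * κ) with hC
  have hC0 : 0 ≤ C := by positivity
  have hb : ∀ r : ℝ, 0 < r → ∀ w ∈ segment ℝ z (1 + I), ‖auxTail s K (w * r)‖ * r ≤
      C * (r ^ (-s.re) * Real.exp (-(2 * Real.pi * κ ^ 2) * r ^ 2)) := by
    intro r hr w hw
    obtain ⟨h1, h2, h3⟩ := hseg w hw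
    refine (mul_le_mul_of_nonneg_right (norm_auxTail_le K hs0 hκ h1 h2 h3 hr) hr.le).trans_eq ?_
    rw [Real.rpow_sub hr, Real.rpow_one, mul_assoc]
    congr 1
    field_simp
  have := integral_ray_eq_path (f := auxTail s K) (U := U) hUo hUc
    (fun w hw r hr => by
      constructor
      · rw [mul_comm, Complex.re_ofReal_mul]; exact mul_pos hr hw.1
      · rw [mul_comm, Complex.im_ofReal_mul]; exact mul_pos hr hw.2)
    (fun w hw => (differentiableAt_auxTail K hw.2).differentiableWithinAt) hD hz hz
    (integrableOn_auxTail_ray K hs hD) (hiz.mono_set Ioc_subset_Ioi_self)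
    (hiz.mono_set (Ioi_subset_Ioi zero_le_one))
    (b₀ := fun r => C * r)
    (b₁ := fun r => C * (r ^ (-s.re) * Real.exp (-(2 * Real.pi * κ ^ 2) * r ^ 2))) ?_ ?_ ?_ ?_
  · rw [this]
    simp only [sub_self, mul_zero, intervalIntegral.integral_zero, add_zero]
    rw [← setIntegral_union Ioc_disjoint_Ioi_same measurableSet_Ioi (hiz.mono_set Ioc_subset_Ioi_self)
      (hiz.mono_set (Ioi_subset_Ioi zero_le_one)), Ioc_union_Ioi_eq_Ioi zero_le_one]
  · have : Tendsto (fun r : ℝ => C * r) (𝓝 0) (𝓝 (C * 0)) := tendsto_id.const_mul C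
    rw [mul_zero] at this
    exact this.mono_left nhdsWithin_le_nhds
  · simpa using (tendsto_rpow_mul_exp_neg_mul_sq (-s.re) (b := 2 * Real.pi * κ ^ 2)
      (by positivity)).const_mul C
  · filter_upwards [Ioc_mem_nhdsGT one_pos] with r hr w hw
    refine (hb r hr.1 w hw).trans (mul_le_mul_of_nonneg_left ?_ hC0)
    have h1 : r ^ (-s.re) ≤ r := by
      have := Real.rpow_le_rpow_of_exponent_ge hr.1 hr.2 (show (1 : ℝ) ≤ -s.re by linarith)
      rwa [Real.rpow_one] at this
    have h2 : Real.exp (-(2 * Real.pi * κ ^ 2) * r ^ 2) ≤ 1 := by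
      rw [Real.exp_le_one_iff]
      have : 0 ≤ 2 * Real.pi * κ ^ 2 * r ^ 2 := by positivity
      linarith
    calc _ ≤ r * 1 := mul_le_mul h1 h2 (Real.exp_pos _).le hr.1.le
      _ = r := mul_one r
  · filter_upwards [eventually_gt_atTop 0] with r hr w hw
    exact hb r hr w hw

theorem auxRay_eq_sum {s : ℂ} (hs : s.re ≤ -1) (K : ℕ) {z : ℂ} (hz : 0 < z.re ∧ 0 < z.im) :
    auxRay s = -(∑ k ∈ Finset.range K, ∫ r in Ioi (0 : ℝ), auxTerm s k ((1 + I) * r) * (1 + I)) +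
      ∫ r in Ioi (0 : ℝ), auxTail s K (z * r) * z := by
  have hD : 0 < (1 + I : ℂ).re ∧ 0 < (1 + I : ℂ).im := by simp
  rw [← integral_auxTail_ray_eq hs K hz, auxRay]
  have hk : ∀ k ∈ Finset.range K, IntegrableOn (fun r : ℝ => auxTerm s k ((1 + I) * r) * (1 + I)) (Ioi 0) := by
    intro k _
    refine Integrable.mul_const (integrableOn_auxKernel_ray (B := 1) (by linarith) hD.1 hD.2
      (g := fun x => Complex.exp (Real.pi * I * (2 * k + 1) * x)) (fun r _ => by fun_prop) ?_) (1 + I)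
    intro r hr
    refine norm_exp_auxTerm_le_one k ?_
    simpa using hr.le
  have hadd := integral_add (integrable_finsetSum _ hk).neg (integrableOn_auxTail_ray K hs hD)
  simp only [Pi.neg_apply] at hadd
  rw [← integral_finsetSum _ hk, ← integral_neg, ← hadd]
  refine setIntegral_congr_fun measurableSet_Ioi fun r hr => ?_
  have him : 0 < ((1 + I) * (r : ℂ)).im := by simpa using hr
  rw [riemannAuxIntegrand_eq_sum s K him, add_mul, neg_mul, Finset.sum_mul]

/-! ### Saddle point evaluation of the single terms and of the tail -/

/-- The cubic remainder of the phase around the saddle point `η`. -/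
noncomputable def saddleRemainder (η w : ℂ) : ℂ :=
  -(2 * Real.pi * I * η ^ 2) * (Complex.log (1 + w / η) - w / η + (w / η) ^ 2 / 2)

theorem norm_saddleRemainder_le {η w : ℂ} (hη : η ≠ 0) (hw : ‖w / η‖ ≤ 1 / 2) :
    ‖saddleRemainder η w‖ ≤ 5 * ‖w‖ ^ 3 / ‖η‖ := by
  have hn : 0 < ‖η‖ := norm_pos_iff.mpr hη
  have h := Complex.norm_log_sub_logTaylor_le 2 (z := w / η) (by linarith)
  have e : Complex.log (1 + w / η) - Complex.logTaylor (2 + 1) (w / η) =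
      Complex.log (1 + w / η) - w / η + (w / η) ^ 2 / 2 := by
    simp only [Complex.logTaylor_succ, Complex.logTaylor_zero]
    norm_num
    ring
  rw [e] at h
  have h2 : ‖w / η‖ ^ (2 + 1) * (1 - ‖w / η‖)⁻¹ / ((2 : ℕ) + 1) ≤ ‖w / η‖ ^ 3 * (2 / 3) := by
    have : (1 - ‖w / η‖)⁻¹ ≤ 2 := by
      rw [inv_le_comm₀ (by linarith) two_pos]; linarith
    have h3 : 0 ≤ ‖w / η‖ ^ 3 := by positivity
    push_cast
    rw [div_le_iff₀ (by norm_num)]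
    nlinarith
  rw [saddleRemainder, norm_mul]
  have h4 : ‖-(2 * Real.pi * I * η ^ 2 : ℂ)‖ = 2 * Real.pi * ‖η‖ ^ 2 := by
    simp [abs_of_pos Real.pi_pos]
  rw [h4]
  calc _ ≤ 2 * Real.pi * ‖η‖ ^ 2 * (‖w / η‖ ^ 3 * (2 / 3)) := by gcongr; exact h.trans (by exact_mod_cast h2)
    _ = (4 / 3 * Real.pi) * ‖w‖ ^ 3 / ‖η‖ := by rw [norm_div]; field_simp; ring
    _ ≤ _ := by gcongr; nlinarith [Real.pi_lt_d2]

/-- With `s = 2πiη²` the derivative of `-s log x + πix²` vanishes at `x = η`, and the second order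
part of this phase is `2πiw²`. Adding the linear term `πi(2k+1)w` and completing the square moves
the centre to `w = -(2k+1)/4`. -/
theorem auxTerm_add {η : ℂ} (hre : 0 < η.re) (k : ℕ) {w : ℂ} (hw : ‖w / η‖ ≤ 1 / 2) :
    auxTerm (2 * Real.pi * I * η ^ 2) k (η + w) = auxTerm (2 * Real.pi * I * η ^ 2) k η *
      (Complex.exp (2 * Real.pi * I * ((w + (2 * k + 1) / 4) ^ 2 - ((2 * k + 1) / 4) ^ 2)) *
        Complex.exp (saddleRemainder η w)) := by
  have hη : η ≠ 0 := by rintro rfl; simp at hre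
  have h1 : 0 < (1 + w / η).re := by
    have := (abs_le.mp ((Complex.abs_re_le_norm (w / η)).trans hw)).1
    rw [Complex.add_re, Complex.one_re]
    linarith
  have h10 : 1 + w / η ≠ 0 := by intro h; rw [h] at h1; simp at h1
  have e : η + w = η * (1 + w / η) := by field_simp
  have hlog : Complex.log (η + w) = Complex.log η + Complex.log (1 + w / η) := by
    rw [e]
    refine Complex.log_mul hη h10 ?_
    have a1 := abs_lt.mp (Complex.abs_arg_lt_pi_div_two_iff.mpr (Or.inl hre))
    have a2 := abs_lt.mp (Complex.abs_arg_lt_pi_div_two_iff.mpr (Or.inl h1))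
    constructor <;> linarith [a1.1, a1.2, a2.1, a2.2]
  have h0 : η + w ≠ 0 := by rw [e]; exact mul_ne_zero hη h10
  rw [auxTerm, auxTerm, auxKernel, auxKernel, Complex.cpow_def_of_ne_zero h0,
    Complex.cpow_def_of_ne_zero hη, hlog, saddleRemainder]
  simp only [← Complex.exp_add]
  congr 1
  field_simp
  ring

/-- The Gaussian main part of the `k`-th term on the line of slope one through `η - (2k+1)/4`. -/
theorem auxTerm_slantedLine {η : ℂ} (hre : 0 < η.re) (k : ℕ) (v : ℝ)
    (hw : ‖(-(2 * k + 1) / 4 + (1 + I) * v) / η‖ ≤ 1 / 2) :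
    auxTerm (2 * Real.pi * I * η ^ 2) k (η - (2 * k + 1) / 4 + (1 + I) * v) =
      auxTerm (2 * Real.pi * I * η ^ 2) k η * Complex.exp (-(2 * Real.pi * I * ((2 * k + 1) / 4) ^ 2)) *
        (Real.exp (-(4 * Real.pi * v ^ 2)) *
          Complex.exp (saddleRemainder η (-(2 * k + 1) / 4 + (1 + I) * v))) := by
  have := auxTerm_add hre k hw
  rw [show η - (2 * k + 1) / 4 + (1 + I) * v = η + (-(2 * k + 1) / 4 + (1 + I) * v) by ring, this,
    ofReal_exp]
  have e : Complex.exp (2 * Real.pi * I * ((-(2 * k + 1) / 4 + (1 + I) * v + (2 * k + 1) / 4) ^ 2 -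
      ((2 * k + 1) / 4) ^ 2)) = Complex.exp (-(2 * Real.pi * I * ((2 * k + 1) / 4) ^ 2)) *
      Complex.exp ((-(4 * Real.pi * v ^ 2) : ℝ) : ℂ) := by
    rw [← Complex.exp_add]
    congr 1
    push_cast
    linear_combination (2 * Real.pi * v ^ 2 * (I + 2)) * I_sq
  rw [e]
  ring

theorem norm_exp_I_mul_sq (k : ℕ) :
    ‖Complex.exp (-(2 * Real.pi * I * ((2 * k + 1) / 4) ^ 2))‖ = 1 := by
  rw [show (-(2 * Real.pi * I * ((2 * k + 1) / 4) ^ 2) : ℂ) =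
    ((-(2 * Real.pi * ((2 * k + 1) / 4) ^ 2) : ℝ) : ℂ) * I by push_cast; ring]
  exact Complex.norm_exp_ofReal_mul_I _

theorem two_pi_I_sq_re (η : ℂ) : (2 * Real.pi * I * η ^ 2).re = -(4 * Real.pi * η.re * η.im) := by
  simp [sq]; ring

theorem two_pi_I_sq_im (η : ℂ) : (2 * Real.pi * I * η ^ 2).im = 2 * Real.pi * (η.re ^ 2 - η.im ^ 2) := by
  simp [sq]

/-- If `Im P > 0`, the logarithm of the modulus along the ray is concave in `r`, and the hypothesis
says that its derivative at `r = 1` is nonnegative, so it increases up to `r = 1`. If `Im P ≤ 0`,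
each factor increases. -/
theorem norm_auxTerm_mul_le_of_le_one {s P : ℂ} (k : ℕ) (hs : s.re ≤ 0) (hP : 0 < P.re)
    (h : P.im ≤ 0 ∨ P.im * (4 * Real.pi * P.re + Real.pi * (2 * k + 1)) ≤ -s.re) {r : ℝ} (hr : 0 < r)
    (hr1 : r ≤ 1) : ‖auxTerm s k (P * r)‖ ≤ ‖auxTerm s k P‖ := by
  have hP0 : P ≠ 0 := by rintro rfl; simp at hP
  rw [norm_auxTerm_mul_ofReal k hP0 hr, Real.rpow_def_of_pos hr, ← Real.exp_add]
  refine mul_le_of_le_one_right (norm_nonneg _) (Real.exp_le_one_iff.mpr ?_)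
  have hlog := Real.log_le_sub_one_of_pos hr
  have h1 : Real.log r * -s.re ≤ (r - 1) * -s.re := mul_le_mul_of_nonneg_right hlog (by linarith)
  have hpi := Real.pi_pos
  rcases h with h | h
  · have h2 : 0 ≤ (1 - r) * -s.re := mul_nonneg (by linarith) (by linarith)
    have h3 : 0 ≤ (1 - r) * (1 + r) * (Real.pi * P.re * -P.im) :=
      mul_nonneg (mul_nonneg (by linarith) (by linarith)) (mul_nonneg (by positivity) (by linarith))
    have h4 : 0 ≤ (1 - r) * (Real.pi * (2 * k + 1) * -P.im) :=
      mul_nonneg (by linarith) (mul_nonneg (by positivity) (by linarith))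
    nlinarith
  · rcases le_or_gt P.im 0 with h0 | h0
    · have h2 : 0 ≤ (1 - r) * -s.re := mul_nonneg (by linarith) (by linarith)
      have h3 : 0 ≤ (1 - r) * (1 + r) * (Real.pi * P.re * -P.im) :=
        mul_nonneg (mul_nonneg (by linarith) (by linarith)) (mul_nonneg (by positivity) (by linarith))
      have h4 : 0 ≤ (1 - r) * (Real.pi * (2 * k + 1) * -P.im) :=
        mul_nonneg (by linarith) (mul_nonneg (by positivity) (by linarith))
      nlinarith
    · have h2 := mul_le_mul_of_nonneg_left h (show 0 ≤ 1 - r by linarith)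
      have h3 : 0 ≤ (1 - r) ^ 2 * (2 * Real.pi * P.re * P.im) := by positivity
      nlinarith

/-- The logarithm of the modulus along the ray is concave in `r` with derivative at most `-1` at `r
= 1`, so it stays below that slope. -/
theorem norm_auxTerm_mul_le_of_one_le {s Q : ℂ} (k : ℕ) (hs : s.re ≤ 0) (hQ : 0 < Q.re) (hQi : 0 < Q.im)
    (h : -s.re + 1 ≤ Q.im * (4 * Real.pi * Q.re + Real.pi * (2 * k + 1))) {r : ℝ} (hr : 1 ≤ r) :
    ‖auxTerm s k (Q * r)‖ ≤ ‖auxTerm s k Q‖ * Real.exp (-(r - 1)) := by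
  have hQ0 : Q ≠ 0 := by rintro rfl; simp at hQ
  have hr0 : 0 < r := by linarith
  rw [norm_auxTerm_mul_ofReal k hQ0 hr0, Real.rpow_def_of_pos hr0, ← Real.exp_add]
  refine mul_le_mul_of_nonneg_left (Real.exp_le_exp.mpr ?_) (norm_nonneg _)
  have hlog := Real.log_le_sub_one_of_pos hr0
  have h1 : Real.log r * -s.re ≤ (r - 1) * -s.re := mul_le_mul_of_nonneg_right hlog (by linarith)
  have h2 := mul_le_mul_of_nonneg_left h (show 0 ≤ r - 1 by linarith)
  have h3 : 0 ≤ (r - 1) ^ 2 * (2 * Real.pi * Q.re * Q.im) := by positivity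
  nlinarith

theorem integral_exp_neg_sub_one : ∫ r in Ioi (1 : ℝ), Real.exp (-(r - 1)) = 1 := by
  have h : ∀ r : ℝ, Real.exp (-(r - 1)) = Real.exp 1 * Real.exp (-r) := fun r => by
    rw [← Real.exp_add]; ring_nf
  simp_rw [h]
  rw [integral_const_mul, integral_exp_neg_Ioi, ← Real.exp_add]
  simp

theorem integrableOn_exp_neg_sub_one : IntegrableOn (fun r : ℝ => Real.exp (-(r - 1))) (Ioi 1) := by
  have h : ∀ r : ℝ, Real.exp (-(r - 1)) = Real.exp 1 * Real.exp (-r) := fun r => by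
    rw [← Real.exp_add]; ring_nf
  simp_rw [h]
  exact (integrableOn_exp_neg_Ioi 1).const_mul _

/-- The cube majorizes the cubic remainder inside the range `|v| ≤ V`. The summand `v⁴` pays for the
truncation: outside the range `v⁴ ≥ V⁴ = ‖η‖`, so after division by `‖η‖` one majorant serves for
all `v`. -/
theorem cube_gaussian_le (κ v : ℝ) (hκ : 0 ≤ κ) :
    Real.exp (-(4 * Real.pi * v ^ 2)) * (10 * (κ + 2 * |v|) ^ 3 + v ^ 4) ≤
      (40 * κ ^ 3 + 650) * Real.exp (-v ^ 2) := by
  have h1 : v ^ 2 ≤ Real.exp (v ^ 2) := by linarith [Real.add_one_le_exp (v ^ 2)]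
  have h2 : v ^ 4 ≤ 2 * Real.exp (v ^ 2) := by
    have := Real.quadratic_le_exp_of_nonneg (sq_nonneg v)
    nlinarith [sq_nonneg v]
  have hv := abs_nonneg v
  have h3 : |v| ^ 3 ≤ 3 / 2 * Real.exp (v ^ 2) := by
    have e2 : |v| ^ 2 = v ^ 2 := sq_abs v
    have e4 : |v| ^ 4 = v ^ 4 := by rw [show |v| ^ 4 = (|v| ^ 2) ^ 2 by ring, e2]; ring
    nlinarith [mul_nonneg (sq_nonneg |v|) (sq_nonneg (|v| - 1))]
  have h4 : (κ + 2 * |v|) ^ 3 ≤ 4 * (κ ^ 3 + 8 * |v| ^ 3) := by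
    nlinarith [mul_nonneg (add_nonneg hκ (mul_nonneg zero_le_two hv)) (sq_nonneg (κ - 2 * |v|))]
  have h5 : 1 ≤ Real.exp (v ^ 2) := Real.one_le_exp (sq_nonneg v)
  have h6 : 10 * (κ + 2 * |v|) ^ 3 + v ^ 4 ≤ (40 * κ ^ 3 + 650) * Real.exp (v ^ 2) := by
    have : 0 ≤ κ ^ 3 := by positivity
    nlinarith
  calc _ ≤ Real.exp (-(4 * Real.pi * v ^ 2)) * ((40 * κ ^ 3 + 650) * Real.exp (v ^ 2)) := by gcongr
    _ = (40 * κ ^ 3 + 650) * Real.exp (-(4 * Real.pi * v ^ 2) + v ^ 2) := by rw [Real.exp_add]; ring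
    _ ≤ _ := by
      gcongr
      nlinarith [Real.pi_gt_three, sq_nonneg v]

theorem integral_gaussian_four_pi : ∫ v : ℝ, Real.exp (-(4 * Real.pi * v ^ 2)) = 1 / 2 := by
  have := integral_gaussian (4 * Real.pi)
  simp_rw [neg_mul] at this
  rw [this, show Real.pi / (4 * Real.pi) = (1 / 2) ^ 2 by field_simp; norm_num, Real.sqrt_sq (by norm_num)]

/-- Here `V = ‖η‖^{1/4}` and the displacement from `η` is at most `3V`, so the cubic remainder is at
most `5 (3V)³ / V⁴ = 135 / V`. This is the origin of the threshold `135`. -/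
theorem saddleShift_bounds {η : ℂ} {V : ℝ} (hV : 135 ≤ V) (hL : ‖η‖ = V ^ 4) (k : ℕ) (hk : (k : ℝ) ≤ V)
    (v : ℝ) (hv : |v| ≤ V) : ‖(-(2 * k + 1) / 4 + (1 + I) * v) / η‖ ≤ 1 / 2 ∧
      ‖saddleRemainder η (-(2 * k + 1) / 4 + (1 + I) * v)‖ ≤ 1 ∧
      ‖saddleRemainder η (-(2 * k + 1) / 4 + (1 + I) * v)‖ ≤
        5 * ((2 * k + 1) / 4 + 2 * |v|) ^ 3 / ‖η‖ := by
  have hn : 0 < ‖η‖ := by rw [hL]; positivity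
  have hη : η ≠ 0 := norm_pos_iff.mp hn
  have hwn : ‖(-(2 * k + 1) / 4 + (1 + I) * v : ℂ)‖ ≤ (2 * k + 1) / 4 + 2 * |v| := by
    have := norm_slantedLine_le (-((2 * k + 1) / 4)) v
    rw [abs_neg, abs_of_nonneg (by positivity)] at this
    convert this using 3
    push_cast; ring
  have hw3 : ‖(-(2 * k + 1) / 4 + (1 + I) * v : ℂ)‖ ≤ 3 * V := hwn.trans (by linarith)
  have hw : ‖(-(2 * k + 1) / 4 + (1 + I) * v) / η‖ ≤ 1 / 2 := by
    rw [norm_div, div_le_iff₀ hn, hL]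
    refine hw3.trans ?_
    have : (135 : ℝ) ^ 3 ≤ V ^ 3 := by gcongr
    nlinarith
  have h1 := norm_saddleRemainder_le hη hw
  refine ⟨hw, h1.trans ?_, h1.trans (by gcongr)⟩
  rw [div_le_one hn, hL]
  calc 5 * ‖(-(2 * k + 1) / 4 + (1 + I) * v : ℂ)‖ ^ 3 ≤ 5 * (3 * V) ^ 3 := by gcongr
    _ = 135 * V ^ 3 := by ring
    _ ≤ V * V ^ 3 := by gcongr
    _ = V ^ 4 := by ring

theorem norm_auxTerm_slantedLine_le {η : ℂ} (hre : 0 < η.re) {V : ℝ} (hV : 135 ≤ V) (hL : ‖η‖ = V ^ 4)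
    (k : ℕ) (hk : (k : ℝ) ≤ V) (v : ℝ) (hv : |v| ≤ V) :
    ‖auxTerm (2 * Real.pi * I * η ^ 2) k (η - (2 * k + 1) / 4 + (1 + I) * v)‖ ≤
      ‖auxTerm (2 * Real.pi * I * η ^ 2) k η‖ * (3 * Real.exp (-(4 * Real.pi * v ^ 2))) := by
  obtain ⟨hw, hR, -⟩ := saddleShift_bounds hV hL k hk v hv
  rw [auxTerm_slantedLine hre k v hw, norm_mul, norm_mul, norm_mul, norm_exp_I_mul_sq, mul_one,
    Complex.norm_real, Real.norm_of_nonneg (Real.exp_pos _).le, mul_comm (3 : ℝ)]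
  gcongr
  calc _ ≤ Real.exp ‖saddleRemainder η (-(2 * k + 1) / 4 + (1 + I) * v)‖ := Complex.norm_exp_le_exp_norm _
    _ ≤ Real.exp 1 := Real.exp_le_exp.mpr hR
    _ ≤ 3 := Real.exp_one_lt_d9.le.trans (by norm_num)

/-- Saddle point evaluation of the `k`-th term along the middle piece of the path. -/
theorem norm_middle_integral_sub_le {η : ℂ} (hre : 0 < η.re) {V : ℝ} (hV : 135 ≤ V) (hL : ‖η‖ = V ^ 4)
    (k : ℕ) (hk : (k : ℝ) ≤ V) (hpos : 0 < η.re - (2 * k + 1) / 4 - V) :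
    ‖(∫ v in (-V)..V, auxTerm (2 * Real.pi * I * η ^ 2) k (η - (2 * k + 1) / 4 + (1 + I) * v) * (1 + I)) -
      auxTerm (2 * Real.pi * I * η ^ 2) k η * Complex.exp (-(2 * Real.pi * I * ((2 * k + 1) / 4) ^ 2)) *
        ((1 + I) / 2)‖ ≤ ‖auxTerm (2 * Real.pi * I * η ^ 2) k η‖ * (2800 * (k + 1) ^ 3 / ‖η‖) := by
  have hη : η ≠ 0 := by rintro rfl; simp at hre
  have hn : 0 < ‖η‖ := norm_pos_iff.mpr hη
  set s := 2 * Real.pi * I * η ^ 2 with hs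
  set κ : ℝ := (2 * k + 1) / 4 with hκ
  have hκ0 : 0 ≤ κ := by positivity
  set A := auxTerm s k η * Complex.exp (-(2 * Real.pi * I * ((2 * k + 1) / 4) ^ 2)) with hA
  have hAn : ‖A‖ = ‖auxTerm s k η‖ := by rw [hA, norm_mul, norm_exp_I_mul_sq, mul_one]
  clear_value A
  have hw : ∀ v : ℝ, |v| ≤ V → ‖(-(2 * k + 1) / 4 + (1 + I) * v) / η‖ ≤ 1 / 2 :=
    fun v hv => (saddleShift_bounds hV hL k hk v hv).1
  have hR : ∀ v : ℝ, |v| ≤ V → ‖saddleRemainder η (-(2 * k + 1) / 4 + (1 + I) * v)‖ ≤ 1 ∧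
      ‖saddleRemainder η (-(2 * k + 1) / 4 + (1 + I) * v)‖ ≤ 5 * (κ + 2 * |v|) ^ 3 / ‖η‖ :=
    fun v hv => (saddleShift_bounds hV hL k hk v hv).2
  set F : ℝ → ℂ := fun v => auxTerm s k (η - (2 * k + 1) / 4 + (1 + I) * v) * (1 + I) with hF
  have hFc : Continuous fun v : ℝ => (η - (2 * k + 1) / 4 + (1 + I) * v : ℂ) := by fun_prop
  have hFi : IntegrableOn F (Ioc (-V) V) := by
    refine IntegrableOn.mono_set (t := Icc (-V) V) ?_ Ioc_subset_Icc_self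
    refine ContinuousOn.integrableOn_compact isCompact_Icc fun v hv => ContinuousAt.continuousWithinAt ?_
    refine (ContinuousAt.comp (f := fun v : ℝ => (η - (2 * k + 1) / 4 + (1 + I) * v : ℂ))
      (differentiableAt_auxTerm k ?_).continuousAt hFc.continuousAt).mul continuousAt_const
    rw [Complex.mem_slitPlane_iff]
    left
    have : (η - (2 * k + 1) / 4 + (1 + I) * v : ℂ) = η - (κ : ℂ) + (1 + I) * v := by
      rw [hκ]; push_cast; ring
    rw [this]
    simp
    rw [hκ]
    linarith [hv.1]
  have hgi : Integrable fun v : ℝ => A * (1 + I) * ((Real.exp (-(4 * Real.pi * v ^ 2)) : ℝ) : ℂ) := by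
    have := integrable_exp_neg_mul_sq (b := 4 * Real.pi) (by positivity)
    simp_rw [neg_mul] at this
    exact this.ofReal.const_mul _
  have e1 : A * ((1 + I) / 2) = ∫ v : ℝ, A * (1 + I) * ((Real.exp (-(4 * Real.pi * v ^ 2)) : ℝ) : ℂ) := by
    rw [integral_const_mul, integral_complex_ofReal, integral_gaussian_four_pi]
    push_cast; ring
  rw [intervalIntegral.integral_of_le (by linarith), ← integral_indicator measurableSet_Ioc, e1,
    ← integral_sub (hFi.integrable_indicator measurableSet_Ioc) hgi]
  have h2 : ‖(1 + I : ℂ)‖ ≤ 2 := (norm_add_le _ _).trans (by simp; norm_num)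
  have hbound : ∀ v : ℝ, ‖(Ioc (-V) V).indicator F v - A * (1 + I) *
      ((Real.exp (-(4 * Real.pi * v ^ 2)) : ℝ) : ℂ)‖ ≤
      ‖A‖ * 2 * ((40 * κ ^ 3 + 650) / ‖η‖) * Real.exp (-v ^ 2) := by
    intro v
    have hcg := cube_gaussian_le κ v hκ0
    have hc3 : 0 ≤ 10 * (κ + 2 * |v|) ^ 3 := by positivity
    suffices ‖(Ioc (-V) V).indicator F v - A * (1 + I) *
      ((Real.exp (-(4 * Real.pi * v ^ 2)) : ℝ) : ℂ)‖ ≤ ‖A‖ * 2 * (Real.exp (-(4 * Real.pi * v ^ 2)) *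
        ((10 * (κ + 2 * |v|) ^ 3 + v ^ 4) / ‖η‖)) by
      refine this.trans ?_
      rw [mul_assoc (‖A‖ * 2), ← mul_div_assoc, div_mul_eq_mul_div]
      gcongr
    by_cases hv : v ∈ Ioc (-V) V
    · have hv' : |v| ≤ V := abs_le.mpr ⟨hv.1.le, hv.2⟩
      obtain ⟨hR1, hR2⟩ := hR v hv'
      rw [indicator_of_mem hv, hF]
      simp only
      rw [hs, auxTerm_slantedLine hre k v (hw v hv'), ← hs, ← hA]
      have e2 : ∀ a E R : ℂ, A * (E * R) * a - A * a * E = A * a * (E * (R - 1)) := fun a E R => by ring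
      rw [e2, norm_mul, norm_mul, norm_mul, Complex.norm_real, Real.norm_of_nonneg (Real.exp_pos _).le]
      have h3 := Complex.norm_exp_sub_one_le hR1
      have h4 : ‖Complex.exp (saddleRemainder η (-(2 * k + 1) / 4 + (1 + I) * v)) - 1‖ ≤
          (10 * (κ + 2 * |v|) ^ 3 + v ^ 4) / ‖η‖ := by
        refine h3.trans ((mul_le_mul_of_nonneg_left hR2 zero_le_two).trans ?_)
        rw [← mul_div_assoc]
        gcongr
        have : 0 ≤ v ^ 4 := by positivity
        linarith
      gcongr
    · rw [indicator_of_notMem hv, zero_sub, norm_neg, norm_mul, norm_mul, Complex.norm_real,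
        Real.norm_of_nonneg (Real.exp_pos _).le]
      have h3 : 1 ≤ (10 * (κ + 2 * |v|) ^ 3 + v ^ 4) / ‖η‖ := by
        rw [le_div_iff₀ hn, one_mul, hL]
        have hv' : V ≤ |v| := by
          by_contra! h
          exact hv ⟨(abs_lt.mp h).1, (abs_lt.mp h).2.le⟩
        have : V ^ 4 ≤ |v| ^ 4 := by gcongr
        rw [show |v| ^ 4 = v ^ 4 by rw [show |v| ^ 4 = (|v| ^ 2) ^ 2 by ring, sq_abs]; ring] at this
        linarith
      have h5 : Real.exp (-(4 * Real.pi * v ^ 2)) ≤ Real.exp (-(4 * Real.pi * v ^ 2)) *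
          ((10 * (κ + 2 * |v|) ^ 3 + v ^ 4) / ‖η‖) := le_mul_of_one_le_right (Real.exp_pos _).le h3
      gcongr
  refine (norm_integral_le_of_norm_le (integrable_exp_neg_sq.const_mul _) (ae_of_all _ hbound)).trans ?_
  rw [integral_const_mul, hAn]
  have hJ : ∫ v : ℝ, Real.exp (-v ^ 2) ≤ 2 := by
    have := integral_gaussian 1
    simp only [neg_mul, one_mul, div_one] at this
    rw [this]
    exact Real.sqrt_le_iff.mpr ⟨by norm_num, by linarith [Real.pi_lt_four]⟩
  have hJ0 : 0 ≤ ∫ v : ℝ, Real.exp (-v ^ 2) := integral_nonneg fun v => (Real.exp_pos _).le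
  have hk3 : 40 * κ ^ 3 + 650 ≤ 700 * (k + 1 : ℝ) ^ 3 := by
    have h1 : κ ≤ (k + 1 : ℝ) / 2 := by rw [hκ]; linarith
    have h2 : κ ^ 3 ≤ ((k + 1 : ℝ) / 2) ^ 3 := by gcongr
    have h3 : 1 ≤ (k + 1 : ℝ) ^ 3 := one_le_pow₀ (by linarith [(Nat.cast_nonneg k : (0 : ℝ) ≤ k)])
    nlinarith
  calc _ ≤ ‖auxTerm s k η‖ * 2 * (700 * (k + 1 : ℝ) ^ 3 / ‖η‖) * 2 := by gcongr
    _ = _ := by ring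

/-- At the ends of the Gaussian stretch the term is smaller by `‖η‖^{-2}` than at the saddle. This
outweighs the factors `‖P‖, ‖Q‖ ≤ 2‖η‖` of the two radial pieces. -/
theorem exp_neg_four_pi_sq_le {V : ℝ} (hV : 1 ≤ V) : Real.exp (-(4 * Real.pi * V ^ 2)) ≤ 1 / (V ^ 4) ^ 2 := by
  rw [Real.exp_neg, inv_eq_one_div]
  refine one_div_le_one_div_of_le (by positivity) ?_
  have h1 : (4 * Real.pi * V ^ 2) ^ 4 / (Nat.factorial 4 : ℝ) ≤ Real.exp (4 * Real.pi * V ^ 2) :=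
    Real.pow_div_factorial_le_exp _ (by positivity) 4
  refine le_trans ?_ h1
  rw [le_div_iff₀ (by positivity)]
  have h2 : (12 * V ^ 2) ^ 4 ≤ (4 * Real.pi * V ^ 2) ^ 4 := by
    gcongr
    linarith [Real.pi_gt_three]
  refine le_trans ?_ h2
  have : (Nat.factorial 4 : ℝ) = 24 := by norm_num [Nat.factorial]
  rw [this]
  have : 0 ≤ V ^ 8 := by positivity
  nlinarith

theorem norm_le_two_mul_re {η : ℂ} (h0 : 0 < η.im) (h : η.im ≤ η.re) : ‖η‖ ≤ 2 * η.re := by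
  have := Complex.norm_le_abs_re_add_abs_im η
  rw [abs_of_pos h0, abs_of_pos (h0.trans_le h)] at this
  linarith

/-- Saddle point evaluation of the `k`-th term. -/
theorem norm_integral_auxTerm_sub_le {η : ℂ} (h0 : 0 < η.im) (hle : η.im ≤ η.re) {V : ℝ} (hV : 135 ≤ V)
    (hL : ‖η‖ = V ^ 4) (k : ℕ) (hk : (k : ℝ) ≤ V) :
    ‖(∫ r in Ioi (0 : ℝ), auxTerm (2 * Real.pi * I * η ^ 2) k ((1 + I) * r) * (1 + I)) -
      auxTerm (2 * Real.pi * I * η ^ 2) k η * Complex.exp (-(2 * Real.pi * I * ((2 * k + 1) / 4) ^ 2)) *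
        ((1 + I) / 2)‖ ≤ ‖auxTerm (2 * Real.pi * I * η ^ 2) k η‖ * (3000 * (k + 1) ^ 3 / ‖η‖) := by
  have hre : 0 < η.re := h0.trans_le hle
  have hn : 0 < ‖η‖ := by rw [hL]; positivity
  have ha := norm_le_two_mul_re h0 hle
  have hV4 : 135 ^ 3 * V ≤ V ^ 4 := by
    have : (135 : ℝ) ^ 3 ≤ V ^ 3 := by gcongr
    calc _ ≤ V ^ 3 * V := by gcongr
      _ = V ^ 4 := by ring
  have hσ := two_pi_I_sq_re η
  set s := 2 * Real.pi * I * η ^ 2 with hs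
  have hs0 : s.re ≤ 0 := by rw [hσ]; have : 0 ≤ 4 * Real.pi * η.re * η.im := by positivity
                            linarith
  set κ : ℝ := (2 * k + 1) / 4 with hκ
  have hκV : κ ≤ V := by rw [hκ]; linarith
  have hκ0 : 0 ≤ κ := by positivity
  have hkκ : Real.pi * (2 * k + 1) = 4 * Real.pi * κ := by rw [hκ]; ring
  have hκc : ((2 * k + 1) / 4 : ℂ) = (κ : ℂ) := by rw [hκ]; push_cast; ring
  have hpos : 0 < η.re - κ - V := by linarith
  -- `P` and `Q` are the ends `v = -V` and `v = V` of the Gaussian stretch through the shifted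
  -- saddle `η - (2k+1)/4`; both radial pieces then count as errors.
  set P : ℂ := η - (2 * k + 1) / 4 + (1 + I) * ((-V : ℝ) : ℂ) with hP
  set Q : ℂ := η - (2 * k + 1) / 4 + (1 + I) * (V : ℂ) with hQ
  have hPr : P.re = η.re - κ - V := by rw [hP, hκc]; simp; ring
  have hPi : P.im = η.im - V := by rw [hP, hκc]; simp; ring
  have hQr : Q.re = η.re - κ + V := by rw [hQ, hκc]; simp
  have hQi : Q.im = η.im + V := by rw [hQ, hκc]; simp
  have hQr0 : 0 < Q.re := by rw [hQr]; linarith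
  have hQi0 : 0 < Q.im := by rw [hQi]; linarith
  have hPn : ‖P‖ ≤ 2 * ‖η‖ := by
    have h1 := norm_slantedLine_le (-κ) (-V)
    rw [abs_neg, abs_neg, abs_of_nonneg hκ0, abs_of_nonneg (by linarith : (0 : ℝ) ≤ V)] at h1
    have h2 : P = η + (((-κ : ℝ) : ℂ) + (1 + I) * ((-V : ℝ) : ℂ)) := by rw [hP, hκc]; push_cast; ring
    rw [h2]
    refine (norm_add_le _ _).trans ?_
    linarith
  have hQn : ‖Q‖ ≤ 2 * ‖η‖ := by
    have h1 := norm_slantedLine_le (-κ) V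
    rw [abs_neg, abs_of_nonneg hκ0, abs_of_nonneg (by linarith : (0 : ℝ) ≤ V)] at h1
    have h2 : Q = η + (((-κ : ℝ) : ℂ) + (1 + I) * (V : ℂ)) := by rw [hQ, hκc]; push_cast; ring
    rw [h2]
    refine (norm_add_le _ _).trans ?_
    linarith
  have hPc : P.im ≤ 0 ∨ P.im * (4 * Real.pi * P.re + Real.pi * (2 * k + 1)) ≤ -s.re := by
    rcases le_or_gt P.im 0 with h | h
    · exact Or.inl h
    · right
      rw [hPi] at h
      rw [hkκ, hσ, hPr, hPi]
      have h1 : (η.im - V) * (η.re - V) ≤ η.im * η.re :=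
        mul_le_mul (by linarith) (by linarith) (by linarith) h0.le
      nlinarith [Real.pi_pos]
  have hQc : -s.re + 1 ≤ Q.im * (4 * Real.pi * Q.re + Real.pi * (2 * k + 1)) := by
    rw [hkκ, hσ, hQr, hQi]
    have h1 : η.im * η.re + 1 ≤ (η.im + V) * (η.re + V) := by nlinarith
    nlinarith [Real.pi_gt_three]
  have hE := exp_neg_four_pi_sq_le (V := V) (by linarith)
  rw [← hL] at hE
  have hfP : ‖auxTerm s k P‖ ≤ ‖auxTerm s k η‖ * (3 / ‖η‖ ^ 2) := by
    have := norm_auxTerm_slantedLine_le hre hV hL k hk (-V) (by rw [abs_neg, abs_of_nonneg (by linarith)])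
    rw [neg_sq] at this
    refine this.trans ?_
    gcongr
    calc _ ≤ 3 * (1 / ‖η‖ ^ 2) := by gcongr
      _ = _ := by ring
  have hfQ : ‖auxTerm s k Q‖ ≤ ‖auxTerm s k η‖ * (3 / ‖η‖ ^ 2) := by
    have := norm_auxTerm_slantedLine_le hre hV hL k hk V (by rw [abs_of_nonneg (by linarith)])
    refine this.trans ?_
    gcongr
    calc _ ≤ 3 * (1 / ‖η‖ ^ 2) := by gcongr
      _ = _ := by ring
  rw [integral_auxTerm_eq_path hs0 k (P := P) (Q := Q) (by rw [hPr]; exact hpos) ⟨hQr0, hQi0⟩]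
  have bP : ‖∫ r in Ioc (0 : ℝ) 1, auxTerm s k (P * r) * P‖ ≤ ‖auxTerm s k η‖ * (6 / ‖η‖) := by
    have := norm_setIntegral_le_of_norm_le_const (μ := volume) (s := Ioc (0 : ℝ) 1)
      (f := fun r : ℝ => auxTerm s k (P * r) * P) (C := ‖auxTerm s k P‖ * ‖P‖) (by simp) (fun r hr => by
        rw [norm_mul]
        exact mul_le_mul_of_nonneg_right (norm_auxTerm_mul_le_of_le_one k hs0 (by rw [hPr]; exact hpos) hPc hr.1 hr.2)
          (norm_nonneg _))
    refine this.trans ?_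
    simp only [Measure.real, Real.volume_Ioc, sub_zero, ENNReal.ofReal_one, ENNReal.toReal_one, mul_one]
    calc _ ≤ ‖auxTerm s k η‖ * (3 / ‖η‖ ^ 2) * (2 * ‖η‖) := by gcongr
      _ = _ := by field_simp; ring
  have bQ : ‖∫ r in Ioi (1 : ℝ), auxTerm s k (Q * r) * Q‖ ≤ ‖auxTerm s k η‖ * (6 / ‖η‖) := by
    have := norm_integral_le_of_norm_le (μ := volume.restrict (Ioi (1 : ℝ)))
      (f := fun r : ℝ => auxTerm s k (Q * r) * Q)
      (integrableOn_exp_neg_sub_one.const_mul (‖auxTerm s k Q‖ * ‖Q‖)) (by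
        refine (ae_restrict_mem measurableSet_Ioi).mono fun r hr => ?_
        rw [norm_mul]
        have := norm_auxTerm_mul_le_of_one_le k hs0 hQr0 hQi0 hQc (le_of_lt hr)
        calc _ ≤ ‖auxTerm s k Q‖ * Real.exp (-(r - 1)) * ‖Q‖ := by gcongr
          _ = _ := by ring)
    refine this.trans ?_
    rw [integral_const_mul, integral_exp_neg_sub_one, mul_one]
    calc _ ≤ ‖auxTerm s k η‖ * (3 / ‖η‖ ^ 2) * (2 * ‖η‖) := by gcongr
      _ = _ := by field_simp; ring
  have hmid : ∫ r in (0 : ℝ)..1, auxTerm s k (P + (Q - P) * r) * (Q - P) =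
      ∫ v in (-V)..V, auxTerm s k (η - (2 * k + 1) / 4 + (1 + I) * v) * (1 + I) := by
    have := intervalIntegral.smul_integral_comp_mul_add (a := 0) (b := 1)
      (fun v : ℝ => auxTerm s k (η - (2 * k + 1) / 4 + (1 + I) * v) * (1 + I)) (2 * V) (-V)
    rw [show 2 * V * 0 + -V = -V by ring, show 2 * V * 1 + -V = V by ring] at this
    rw [← this, ← intervalIntegral.integral_smul]
    refine intervalIntegral.integral_congr fun r _ => ?_
    have e1 : P + (Q - P) * r = η - (2 * k + 1) / 4 + (1 + I) * ((2 * V * r + -V : ℝ) : ℂ) := by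
      rw [hP, hQ]; push_cast; ring
    have e2 : Q - P = (1 + I) * (2 * V : ℝ) := by rw [hP, hQ]; push_cast; ring
    simp only [e1]
    rw [e2, real_smul]
    ring
  rw [hmid]
  have hm := norm_middle_integral_sub_le hre hV hL k hk hpos
  rw [← hs] at hm
  have hfin : ∀ a b c d : ℂ, ‖a + b + c - d‖ ≤ ‖a‖ + ‖b - d‖ + ‖c‖ := fun a b c d => by
    rw [show a + b + c - d = a + (b - d) + c by ring]
    exact norm_add₃_le
  refine (hfin _ _ _ _).trans ?_
  have hk1 : 12 / ‖η‖ ≤ 200 * (k + 1 : ℝ) ^ 3 / ‖η‖ := by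
    gcongr
    have : 1 ≤ (k + 1 : ℝ) ^ 3 := one_le_pow₀ (by linarith [(Nat.cast_nonneg k : (0 : ℝ) ≤ k)])
    linarith
  calc _ ≤ ‖auxTerm s k η‖ * (6 / ‖η‖) + ‖auxTerm s k η‖ * (2800 * (k + 1) ^ 3 / ‖η‖) +
        ‖auxTerm s k η‖ * (6 / ‖η‖) := by gcongr
    _ = ‖auxTerm s k η‖ * (12 / ‖η‖ + 2800 * (k + 1) ^ 3 / ‖η‖) := by ring
    _ ≤ ‖auxTerm s k η‖ * (200 * (k + 1 : ℝ) ^ 3 / ‖η‖ + 2800 * (k + 1) ^ 3 / ‖η‖) := by gcongr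
    _ = _ := by ring

/-- Here `m = -σ` and `L` measures the decay of `e^{2πiKx}` along the ray through `η`. For `r ≤ 1/2`
the tail is far from the saddle and `r^m e^{m/2}` is small, because `log 2 - 1/2 > 19/100`. For `r >
1/2` the first two factors are at most `1`, their value at `r = 1`, and `e^{-Lr}` gives the gain. -/
theorem tail_pointwise_le {m L r : ℝ} (hm : 1 ≤ m) (hr : 0 < r) (hL : 1 ≤ L) :
    r ^ m * Real.exp (-(m / 2 * (r ^ 2 - 1))) * (Real.exp (-(L * r)) / r) ≤
      2 * Real.exp 1 * (Real.exp (-(19 / 100 * m)) + Real.exp (-(L / 2))) * Real.exp (-r) := by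
  have hm0 : 0 < m := by linarith
  rcases le_or_gt r (1 / 2) with h | h
  · have h1 : r ^ m / r ≤ 2 * Real.exp (-(69 / 100 * m)) := by
      have e : r ^ m / r = r ^ (m - 1) := by rw [Real.rpow_sub hr, Real.rpow_one]
      rw [e]
      calc r ^ (m - 1) ≤ (1 / 2 : ℝ) ^ (m - 1) := Real.rpow_le_rpow hr.le h (by linarith)
        _ = 2 * Real.exp (-(Real.log 2 * m)) := by
            rw [Real.rpow_def_of_pos (by norm_num), mul_sub, mul_one, Real.exp_sub, Real.exp_log (by norm_num),
              one_div, Real.log_inv, neg_mul]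
            field_simp
        _ ≤ _ := by gcongr; linarith [Real.log_two_gt_d9]
    have h2 : Real.exp (-(m / 2 * (r ^ 2 - 1))) ≤ Real.exp (m / 2) := by
      refine Real.exp_le_exp.mpr ?_
      nlinarith [mul_nonneg hm0.le (sq_nonneg r)]
    have h3 : Real.exp (-(L * r)) ≤ 1 := by
      rw [Real.exp_le_one_iff]; have : 0 ≤ L * r := by positivity
      linarith
    have h4 : 1 ≤ Real.exp 1 * Real.exp (-r) := by
      rw [← Real.exp_add]; exact Real.one_le_exp (by linarith)
    calc _ = r ^ m / r * Real.exp (-(m / 2 * (r ^ 2 - 1))) * Real.exp (-(L * r)) := by ring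
      _ ≤ 2 * Real.exp (-(69 / 100 * m)) * Real.exp (m / 2) * 1 := by gcongr
      _ = 2 * Real.exp (-(19 / 100 * m)) := by
          rw [mul_one, mul_assoc, ← Real.exp_add]; ring_nf
      _ ≤ 2 * (Real.exp (-(19 / 100 * m)) + Real.exp (-(L / 2))) * 1 := by
          have := Real.exp_pos (-(L / 2)); linarith
      _ ≤ 2 * (Real.exp (-(19 / 100 * m)) + Real.exp (-(L / 2))) * (Real.exp 1 * Real.exp (-r)) := by gcongr
      _ = _ := by ring
  · have h1 : r ^ m * Real.exp (-(m / 2 * (r ^ 2 - 1))) ≤ 1 := by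
      rw [Real.rpow_def_of_pos hr, ← Real.exp_add, Real.exp_le_one_iff]
      have h2 := Real.log_le_sub_one_of_pos (show 0 < r ^ 2 by positivity)
      rw [Real.log_pow] at h2
      push_cast at h2
      nlinarith
    have h2 : Real.exp (-(L * r)) / r ≤ 2 * (Real.exp 1 * Real.exp (-(L / 2)) * Real.exp (-r)) := by
      rw [div_le_iff₀ hr, ← Real.exp_add, ← Real.exp_add]
      have : Real.exp (-(L * r)) ≤ Real.exp (1 + -(L / 2) + -r) := Real.exp_le_exp.mpr (by nlinarith)
      nlinarith [Real.exp_pos (1 + -(L / 2) + -r)]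
    calc _ ≤ 1 * (2 * (Real.exp 1 * Real.exp (-(L / 2)) * Real.exp (-r))) := by gcongr
      _ = 2 * Real.exp 1 * Real.exp (-(L / 2)) * Real.exp (-r) := by ring
      _ ≤ _ := by
        gcongr
        linarith [Real.exp_pos (-(19 / 100 * m))]

theorem norm_integral_auxTail_le {η : ℂ} (h0 : 0 < η.im) (hle : η.im ≤ η.re) (K : ℕ)
    (hm : 1 ≤ 4 * Real.pi * η.re * η.im) (hK : 1 ≤ 2 * Real.pi * K * η.im) :
    ‖∫ r in Ioi (0 : ℝ), auxTail (2 * Real.pi * I * η ^ 2) K (η * r) * η‖ ≤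
      ‖auxKernel (2 * Real.pi * I * η ^ 2) η‖ * (‖η‖ / η.im *
        (Real.exp (-(19 / 100 * (4 * Real.pi * η.re * η.im))) + Real.exp (-(Real.pi * K * η.im)))) := by
  have hre : 0 < η.re := h0.trans_le hle
  have hη : η ≠ 0 := by rintro rfl; simp at hre
  have hσ := two_pi_I_sq_re η
  set s := 2 * Real.pi * I * η ^ 2 with hs
  set m := 4 * Real.pi * η.re * η.im with hmdef
  set B := Real.exp (-(19 / 100 * m)) + Real.exp (-(Real.pi * K * η.im)) with hB
  have hB0 : 0 < B := by positivity
  set C := ‖auxKernel s η‖ * (‖η‖ / (2 * Real.pi * η.im)) * (2 * Real.exp 1 * B) with hC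
  have hi : IntegrableOn (fun r : ℝ => C * Real.exp (-r)) (Ioi 0) := (integrableOn_exp_neg_Ioi 0).const_mul C
  refine (norm_integral_le_of_norm_le hi ((ae_restrict_mem measurableSet_Ioi).mono fun r hr => ?_)).trans ?_
  · have hr0 : 0 < r := hr
    have him : (η * (r : ℂ)).im = η.im * r := by rw [mul_comm, Complex.im_ofReal_mul, mul_comm]
    have him0 : 0 < (η * (r : ℂ)).im := by rw [him]; positivity
    have h1 := norm_tail_factor_le K him0
    rw [him] at h1
    rw [norm_mul, auxTail, norm_mul, auxKernel_norm_mul_ofReal hη hr0, hσ, neg_neg]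
    have h2 := tail_pointwise_le (m := m) (L := 2 * Real.pi * K * η.im) (r := r) hm hr0 hK
    rw [show -(2 * Real.pi * K * η.im / 2) = -(Real.pi * K * η.im) by ring, ← hB] at h2
    calc _ ≤ ‖auxKernel s η‖ * (r ^ m * Real.exp (-(2 * Real.pi * η.re * η.im * (r ^ 2 - 1)))) *
          (Real.exp (-(2 * Real.pi * K * (η.im * r))) / (2 * Real.pi * (η.im * r))) * ‖η‖ := by gcongr
      _ = ‖auxKernel s η‖ * (‖η‖ / (2 * Real.pi * η.im)) *
          (r ^ m * Real.exp (-(m / 2 * (r ^ 2 - 1))) * (Real.exp (-(2 * Real.pi * K * η.im * r)) / r)) := by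
          rw [show 2 * Real.pi * η.re * η.im * (r ^ 2 - 1) = m / 2 * (r ^ 2 - 1) by rw [hmdef]; ring,
            show 2 * Real.pi * K * (η.im * r) = 2 * Real.pi * K * η.im * r by ring]
          field_simp
      _ ≤ ‖auxKernel s η‖ * (‖η‖ / (2 * Real.pi * η.im)) * (2 * Real.exp 1 * B * Real.exp (-r)) := by gcongr
      _ = _ := by rw [hC]; ring
  · rw [integral_const_mul, integral_exp_neg_Ioi_zero, mul_one, hC, mul_assoc]
    have h1 : ‖η‖ / (2 * Real.pi * η.im) * (2 * Real.exp 1 * B) = ‖η‖ / η.im * B * (Real.exp 1 / Real.pi) := by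
      field_simp
    rw [h1]
    refine mul_le_mul_of_nonneg_left ?_ (norm_nonneg _)
    refine mul_le_of_le_one_right (by positivity) ?_
    rw [div_le_one Real.pi_pos]
    exact (Real.exp_one_lt_d9.le.trans (by norm_num)).trans Real.pi_gt_three.le

/-! ### Summation over the terms and the asymptotics of the ray integral -/

/-- The parity of `k(k+1)/2` depends only on `k` modulo `4`, which is why the number of terms is
later taken divisible by four. -/
theorem exp_triangular (M j : ℕ) :
    Complex.exp (-(Real.pi * I * (((4 * M + j : ℕ) : ℂ) * ((4 * M + j : ℕ) + 1) / 2))) =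
      Complex.exp (-(Real.pi * I * ((j : ℂ) * (j + 1) / 2))) := by
  have e : -(Real.pi * I * (((4 * M + j : ℕ) : ℂ) * ((4 * M + j : ℕ) + 1) / 2)) =
      -(Real.pi * I * ((j : ℂ) * (j + 1) / 2)) - ((4 * M ^ 2 + 2 * M * j + M : ℕ) : ℂ) * (2 * Real.pi * I) := by
    push_cast; ring
  rw [e]
  exact_mod_cast Complex.exp_periodic.sub_nat_mul_eq (x := -(Real.pi * I * ((j : ℂ) * (j + 1) / 2)))
    (4 * M ^ 2 + 2 * M * j + M)

/-- The geometric series with signs `+ - - +`. -/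
theorem sum_triangular_sign (q : ℂ) (M : ℕ) :
    (1 + q ^ 2) * ∑ k ∈ Finset.range (4 * M),
      Complex.exp (-(Real.pi * I * ((k : ℂ) * (k + 1) / 2))) * q ^ k = (1 - q) * (1 - q ^ (4 * M)) := by
  have hodd : ∀ n : ℕ, Complex.exp (-(Real.pi * I * n)) = (-1) ^ n := by
    intro n
    rw [show -(Real.pi * I * n : ℂ) = n * -(Real.pi * I) by ring, Complex.exp_nat_mul, Complex.exp_neg,
      Complex.exp_pi_mul_I]
    norm_num
  induction M with
  | zero => simp
  | succ M ih =>
    rw [show 4 * (M + 1) = 4 * M + 3 + 1 by ring, Finset.sum_range_succ, Finset.sum_range_succ,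
      Finset.sum_range_succ, Finset.sum_range_succ]
    have h0 := exp_triangular M 0
    have h1 := exp_triangular M 1
    have h2 := exp_triangular M 2
    have h3 := exp_triangular M 3
    rw [show -(Real.pi * I * (((0 : ℕ) : ℂ) * ((0 : ℕ) + 1) / 2)) = -(Real.pi * I * (0 : ℕ)) by push_cast; ring,
      hodd] at h0
    rw [show -(Real.pi * I * (((1 : ℕ) : ℂ) * ((1 : ℕ) + 1) / 2)) = -(Real.pi * I * (1 : ℕ)) by push_cast; ring,
      hodd] at h1
    rw [show -(Real.pi * I * (((2 : ℕ) : ℂ) * ((2 : ℕ) + 1) / 2)) = -(Real.pi * I * (3 : ℕ)) by push_cast; ring,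
      hodd] at h2
    rw [show -(Real.pi * I * (((3 : ℕ) : ℂ) * ((3 : ℕ) + 1) / 2)) = -(Real.pi * I * (6 : ℕ)) by push_cast; ring,
      hodd] at h3
    rw [add_zero] at h0
    rw [h0, h1, h2, h3, mul_add, mul_add, mul_add, mul_add, ih]
    ring

/-- From `(k+1)³ ≤ 6 binom(k+3, 3)` and the generating function `∑ binom(k+3, 3) x^k = (1 -
x)^{-4}`. The cubes are the losses in the saddle point errors. -/
theorem sum_cube_mul_pow_le {x : ℝ} (hx0 : 0 ≤ x) (hx1 : x < 1) (K : ℕ) :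
    ∑ k ∈ Finset.range K, (k + 1 : ℝ) ^ 3 * x ^ k ≤ 6 / (1 - x) ^ 4 := by
  have hn : ‖x‖ < 1 := by rwa [Real.norm_of_nonneg hx0]
  have hs := summable_choose_mul_geometric_of_norm_lt_one 3 hn
  have ht := tsum_choose_mul_geometric_of_norm_lt_one 3 hn
  have h1 : ∑ k ∈ Finset.range K, ((k + 3).choose 3 : ℝ) * x ^ k ≤ 1 / (1 - x) ^ (3 + 1) := by
    rw [← ht]
    exact hs.sum_le_tsum _ (fun k _ => by positivity)
  have h2 : ∀ k : ℕ, (k + 1 : ℝ) ^ 3 ≤ 6 * ((k + 3).choose 3 : ℝ) := by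
    intro k
    have h3 : ((k + 1) * (k + 2) * (k + 3) : ℕ) = 6 * (k + 3).choose 3 := by
      have := Nat.descFactorial_eq_factorial_mul_choose (k + 3) 3
      simp only [Nat.descFactorial, Nat.factorial] at this
      have e : (k + 3 - 2) * ((k + 3 - 1) * ((k + 3 - 0) * 1)) = (k + 1) * (k + 2) * (k + 3) := by
        rw [show k + 3 - 2 = k + 1 by omega, show k + 3 - 1 = k + 2 by omega, Nat.sub_zero]; ring
      rw [e] at this
      rw [this]
    have h4 : ((k + 1) * (k + 2) * (k + 3) : ℝ) = 6 * ((k + 3).choose 3 : ℝ) := by exact_mod_cast h3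
    rw [← h4]
    have : (0 : ℝ) ≤ k := Nat.cast_nonneg k
    nlinarith
  calc ∑ k ∈ Finset.range K, (k + 1 : ℝ) ^ 3 * x ^ k
      ≤ ∑ k ∈ Finset.range K, 6 * (((k + 3).choose 3 : ℝ) * x ^ k) := by
        refine Finset.sum_le_sum fun k _ => ?_
        rw [← mul_assoc]
        exact mul_le_mul_of_nonneg_right (h2 k) (by positivity)
    _ = 6 * ∑ k ∈ Finset.range K, ((k + 3).choose 3 : ℝ) * x ^ k := by rw [Finset.mul_sum]
    _ ≤ 6 * (1 / (1 - x) ^ (3 + 1)) := by gcongr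
    _ = _ := by ring

/-- The nome `e^{2πiη}`. -/
noncomputable def saddleNome (η : ℂ) : ℂ := Complex.exp (2 * Real.pi * I * η)

/-- The amplitude of the saddle point contribution. -/
noncomputable def saddleAmplitude (η : ℂ) : ℂ :=
  auxKernel (2 * Real.pi * I * η ^ 2) η * Complex.exp (Real.pi * I * η) *
    (Complex.exp (-(Real.pi * I / 8)) * ((1 + I) / 2))

/-- Since `2((2k+1)/4)² = k(k+1)/2 + 1/8`, completing the square leaves a sign of period four and a
fixed eighth-turn constant, while the term at `η` is geometric in `k`. -/
theorem auxTerm_eq_saddleAmplitude (η : ℂ) (k : ℕ) :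
    auxTerm (2 * Real.pi * I * η ^ 2) k η * Complex.exp (-(2 * Real.pi * I * ((2 * k + 1) / 4) ^ 2)) *
      ((1 + I) / 2) = saddleAmplitude η *
      (Complex.exp (-(Real.pi * I * ((k : ℂ) * (k + 1) / 2))) * saddleNome η ^ k) := by
  rw [auxTerm, saddleAmplitude, saddleNome, ← Complex.exp_nat_mul]
  have e1 : Complex.exp (Real.pi * I * (2 * k + 1) * η) =
      Complex.exp (Real.pi * I * η) * Complex.exp (k * (2 * Real.pi * I * η)) := by
    rw [← Complex.exp_add]; ring_nf
  have e2 : Complex.exp (-(2 * Real.pi * I * ((2 * k + 1) / 4) ^ 2)) =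
      Complex.exp (-(Real.pi * I / 8)) * Complex.exp (-(Real.pi * I * ((k : ℂ) * (k + 1) / 2))) := by
    rw [← Complex.exp_add]; ring_nf
  rw [e1, e2]
  ring

theorem norm_saddleNome (η : ℂ) : ‖saddleNome η‖ = Real.exp (-(2 * Real.pi * η.im)) := by
  rw [saddleNome, Complex.norm_exp]; simp

theorem norm_kernel_le_saddleAmplitude (η : ℂ) :
    ‖auxKernel (2 * Real.pi * I * η ^ 2) η‖ * Real.exp (-(Real.pi * η.im)) ≤ 2 * ‖saddleAmplitude η‖ := by
  have h1 : ‖Complex.exp (-(Real.pi * I / 8))‖ = 1 := by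
    rw [show (-(Real.pi * I / 8) : ℂ) = ((-(Real.pi / 8) : ℝ) : ℂ) * I by push_cast; ring]
    exact Complex.norm_exp_ofReal_mul_I _
  have h2 : ‖Complex.exp (Real.pi * I * η)‖ = Real.exp (-(Real.pi * η.im)) := by
    rw [Complex.norm_exp]; simp
  have h3 : 1 ≤ ‖(1 + I : ℂ)‖ := by
    have := Complex.abs_re_le_norm (1 + I); simpa using this
  rw [saddleAmplitude, norm_mul, norm_mul, norm_mul, h1, h2, norm_div, Complex.norm_two, one_mul]
  have : 0 ≤ ‖auxKernel (2 * Real.pi * I * η ^ 2) η‖ * Real.exp (-(Real.pi * η.im)) := by positivity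
  nlinarith

/-- The quantity `1 - ‖q‖` controls both the size of the sum over `k` and the errors, and it
degenerates linearly as `Im η → 0`. -/
theorem min_div_two_le_one_sub_exp {b : ℝ} (hb : 0 < b) : min b 1 / 2 ≤ 1 - Real.exp (-(2 * Real.pi * b)) := by
  have h1 : Real.exp (-(2 * Real.pi * b)) ≤ 1 / (1 + b) := by
    rw [Real.exp_neg, inv_eq_one_div]
    refine one_div_le_one_div_of_le (by linarith) ?_
    have := Real.add_one_le_exp (2 * Real.pi * b)
    nlinarith [Real.pi_gt_three]
  have h2 : min b 1 / 2 ≤ 1 - 1 / (1 + b) := by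
    rw [show 1 - 1 / (1 + b) = b / (1 + b) by field_simp; ring]
    rcases le_total b 1 with h | h
    · rw [min_eq_left h]
      exact div_le_div_of_nonneg_left hb.le (by linarith) (by linarith)
    · rw [min_eq_right h, div_le_div_iff₀ two_pos (by linarith)]
      linarith
  linarith

/-- The total error of the expansion at the saddle point. -/
theorem norm_auxRay_add_le {η : ℂ} (h0 : 0 < η.im) (hle : η.im ≤ η.re) {V : ℝ} (hV : 135 ≤ V)
    (hL : ‖η‖ = V ^ 4) (M : ℕ) (hM : ((4 * M : ℕ) : ℝ) ≤ V) (hm : 1 ≤ 4 * Real.pi * η.re * η.im)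
    (hK : 1 ≤ 2 * Real.pi * (4 * M : ℕ) * η.im) :
    ‖auxRay (2 * Real.pi * I * η ^ 2) + saddleAmplitude η * ∑ k ∈ Finset.range (4 * M),
      Complex.exp (-(Real.pi * I * ((k : ℂ) * (k + 1) / 2))) * saddleNome η ^ k‖ ≤
    2 * ‖saddleAmplitude η‖ * (18000 / ((1 - Real.exp (-(2 * Real.pi * η.im))) ^ 4 * ‖η‖) +
      ‖η‖ / η.im * (Real.exp (Real.pi * η.im - 19 / 100 * (4 * Real.pi * η.re * η.im)) +
        Real.exp (Real.pi * η.im - Real.pi * (4 * M : ℕ) * η.im))) := by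
  have hre : 0 < η.re := h0.trans_le hle
  have hn : 0 < ‖η‖ := by rw [hL]; positivity
  have hσ := two_pi_I_sq_re η
  have hs : (2 * Real.pi * I * η ^ 2).re ≤ -1 := by rw [hσ]; linarith
  rw [auxRay_eq_sum hs (4 * M) ⟨hre, h0⟩, Finset.mul_sum]
  simp_rw [← auxTerm_eq_saddleAmplitude]
  have htail := norm_integral_auxTail_le h0 hle (4 * M) hm hK
  set s := 2 * Real.pi * I * η ^ 2 with hsd
  set H := ‖auxKernel s η‖ with hH
  have hamp := norm_kernel_le_saddleAmplitude η
  rw [← hsd, ← hH] at hamp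
  set x := Real.exp (-(2 * Real.pi * η.im)) with hx
  have hx1 : x < 1 := by rw [hx, Real.exp_lt_one_iff]; have := Real.pi_pos; nlinarith [mul_pos Real.pi_pos h0]
  have hterm : ∀ k : ℕ, ‖auxTerm s k η‖ = H * Real.exp (-(Real.pi * η.im)) * x ^ k := by
    intro k
    have e : Real.exp (-(Real.pi * (2 * k + 1) * η.im)) =
        Real.exp (-(Real.pi * η.im)) * Real.exp (k * -(2 * Real.pi * η.im)) := by
      rw [← Real.exp_add]; ring_nf
    rw [auxTerm, norm_mul, norm_exp_auxTerm, hx, ← Real.exp_nat_mul, e, ← hH]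
    ring
  have hgen : ∀ a b c : ℂ, ‖-a + b + c‖ ≤ ‖a - c‖ + ‖b‖ := fun a b c => by
    rw [show -a + b + c = -(a - c) + b by ring]
    refine (norm_add_le _ _).trans ?_
    rw [norm_neg]
  refine (hgen _ _ _).trans ?_
  rw [← Finset.sum_sub_distrib]
  have hsum : ‖∑ k ∈ Finset.range (4 * M), ((∫ r in Ioi (0 : ℝ), auxTerm s k ((1 + I) * r) * (1 + I)) -
      auxTerm s k η * Complex.exp (-(2 * Real.pi * I * ((2 * k + 1) / 4) ^ 2)) * ((1 + I) / 2))‖ ≤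
      H * Real.exp (-(Real.pi * η.im)) * (18000 / ((1 - x) ^ 4 * ‖η‖)) := by
    refine (norm_sum_le _ _).trans ?_
    calc _ ≤ ∑ k ∈ Finset.range (4 * M), H * Real.exp (-(Real.pi * η.im)) * (3000 / ‖η‖) *
          ((k + 1 : ℝ) ^ 3 * x ^ k) := by
          refine Finset.sum_le_sum fun k hk => ?_
          have hkV : (k : ℝ) ≤ V := le_trans (by exact_mod_cast (Finset.mem_range.mp hk).le) hM
          have := norm_integral_auxTerm_sub_le h0 hle hV hL k hkV
          rw [← hsd, hterm k] at this
          refine this.trans_eq ?_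
          ring
      _ = H * Real.exp (-(Real.pi * η.im)) * (3000 / ‖η‖) *
          ∑ k ∈ Finset.range (4 * M), ((k + 1 : ℝ) ^ 3 * x ^ k) := by rw [Finset.mul_sum]
      _ ≤ H * Real.exp (-(Real.pi * η.im)) * (3000 / ‖η‖) * (6 / (1 - x) ^ 4) := by
          gcongr
          exact sum_cube_mul_pow_le (Real.exp_pos _).le hx1 _
      _ = _ := by
          have : 1 - x ≠ 0 := by linarith
          field_simp; ring
  set D := 18000 / ((1 - x) ^ 4 * ‖η‖) with hD
  have hD0 : 0 ≤ D := by rw [hD]; positivity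
  have e1 : H * (‖η‖ / η.im * (Real.exp (-(19 / 100 * (4 * Real.pi * η.re * η.im))) +
      Real.exp (-(Real.pi * (4 * M : ℕ) * η.im)))) = H * Real.exp (-(Real.pi * η.im)) * (‖η‖ / η.im *
        (Real.exp (Real.pi * η.im - 19 / 100 * (4 * Real.pi * η.re * η.im)) +
        Real.exp (Real.pi * η.im - Real.pi * (4 * M : ℕ) * η.im))) := by
    rw [sub_eq_add_neg, sub_eq_add_neg, Real.exp_add, Real.exp_add, Real.exp_neg (Real.pi * η.im)]
    field_simp
  rw [e1] at htail
  refine (add_le_add hsum htail).trans ?_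
  rw [← mul_add]
  gcongr

/-- In `exists_auxRay_asymptotic`, `U^60` is `‖η‖³`; the `17` is `16` from the tail of the expansion
plus `1` from `q^{4M}`. -/
theorem exists_pow_mul_exp_neg_le : ∃ U₀ : ℝ, 1 ≤ U₀ ∧ ∀ U ≥ U₀, 17 * U ^ 60 * Real.exp (-U) ≤ 1 / 4 := by
  have h := (Real.tendsto_pow_mul_exp_neg_atTop_nhds_zero 60).const_mul 17
  rw [mul_zero] at h
  obtain ⟨a, ha⟩ := eventually_atTop.mp (h.eventually (gt_mem_nhds (show (0 : ℝ) < 1 / 4 by norm_num)))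
  refine ⟨max a 1, le_max_right _ _, fun U hU => ?_⟩
  have := ha U ((le_max_left _ _).trans hU)
  linarith

theorem pi_mul_sub_le_neg {a b U : ℝ} (hb : 0 < b) (ha : 100 ≤ a) (hU : U ≤ a * b * 2) :
    Real.pi * b - 19 / 100 * (4 * Real.pi * a * b) ≤ -U := by
  have h1 : Real.pi * b * 100 ≤ Real.pi * b * a := by gcongr
  have h2 : 3 * (a * b) ≤ Real.pi * (a * b) := by gcongr; exact Real.pi_gt_three.le
  have h3 : 0 < a * b := by positivity
  nlinarith

theorem pi_mul_sub_le_neg' {K b U V : ℝ} (hb : 0 < b) (hK : V / 2 ≤ K - 1) (hU : U ≤ V * b)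
    (hU0 : 0 ≤ U) : Real.pi * b - Real.pi * K * b ≤ -U := by
  have h1 : V / 2 * b ≤ (K - 1) * b := by gcongr
  have h2 : 3 * ((K - 1) * b) ≤ Real.pi * ((K - 1) * b) := by
    gcongr
    · linarith
    · exact Real.pi_gt_three.le
  nlinarith

set_option maxHeartbeats 1000000 in
/-- Asymptotic evaluation of the ray integral, uniform down to `Im η ≫ |η|^{-1/5}`. -/
theorem exists_auxRay_asymptotic : ∃ C₀ : ℝ, 1 ≤ C₀ ∧ ∀ η : ℂ, 0 < η.im → η.im ≤ η.re →
    C₀ ≤ min η.im 1 ^ 5 * ‖η‖ → ∃ δ : ℂ, ‖δ‖ ≤ 1 / 2 ∧ auxRay (2 * Real.pi * I * η ^ 2) =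
      -(saddleAmplitude η * ((1 - saddleNome η) / (1 + saddleNome η ^ 2)) * (1 + δ)) := by
  obtain ⟨U₀, hU₀1, hU₀⟩ := exists_pow_mul_exp_neg_le
  refine ⟨max (U₀ ^ 20) (135 ^ 20), (one_le_pow₀ hU₀1).trans (le_max_left _ _), ?_⟩
  intro η h0 hle hC
  have hre : 0 < η.re := h0.trans_le hle
  set b := η.im with hb
  set β := min b 1 with hβ
  have hβ0 : 0 < β := lt_min h0 one_pos
  have hβ1 : β ≤ 1 := min_le_right _ _
  have hβb : β ≤ b := min_le_left _ _
  have hβ5 : β ^ 5 ≤ 1 := pow_le_one₀ hβ0.le hβ1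
  have hLC : max (U₀ ^ 20) (135 ^ 20) ≤ ‖η‖ := hC.trans (mul_le_of_le_one_left (norm_nonneg _) hβ5)
  have hn : 0 < ‖η‖ := lt_of_lt_of_le (by positivity) ((le_max_right _ _).trans hLC)
  -- The exponent fits `(Vβ)^20 = (β⁵‖η‖)⁴ ‖η‖ ≥ U^20`. So `V β ≥ U`, and all exponentially small
  -- errors are at most `e^{-U}`.
  set U := ‖η‖ ^ (1 / 20 : ℝ) with hU
  have hU0 : 0 < U := by positivity
  have hU20 : U ^ 20 = ‖η‖ := by
    rw [hU, ← Real.rpow_natCast, ← Real.rpow_mul hn.le]; norm_num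
  have hUU : U₀ ≤ U := le_of_pow_le_pow_left₀ (by norm_num : 20 ≠ 0) hU0.le
    (by rw [hU20]; exact (le_max_left _ _).trans hLC)
  have hU135 : 135 ≤ U := le_of_pow_le_pow_left₀ (by norm_num : 20 ≠ 0) hU0.le
    (by rw [hU20]; exact (le_max_right _ _).trans hLC)
  set V := U ^ 5 with hVd
  have hL : ‖η‖ = V ^ 4 := by rw [hVd, ← hU20]; ring
  have hUV : U ≤ V := by
    rw [hVd]; exact le_self_pow₀ (by linarith) (by norm_num)
  have hV : 135 ≤ V := hU135.trans hUV
  have hC1 : 1 ≤ β ^ 5 * ‖η‖ := ((one_le_pow₀ hU₀1).trans (le_max_left _ _)).trans hC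
  have hVβ : U ≤ V * β := by
    refine le_of_pow_le_pow_left₀ (by norm_num : 20 ≠ 0) (by positivity) ?_
    have e : (V * β) ^ 20 = (β ^ 5 * ‖η‖) ^ 4 * ‖η‖ := by rw [hL]; ring
    rw [e, hU20]
    exact le_mul_of_one_le_left hn.le (one_le_pow₀ hC1)
  have hβinv : 1 / β ≤ ‖η‖ := by
    rw [div_le_iff₀ hβ0]
    have : β ^ 5 ≤ β := pow_le_of_le_one hβ0.le hβ1 (by norm_num)
    calc (1 : ℝ) ≤ β ^ 5 * ‖η‖ := hC1
      _ ≤ β * ‖η‖ := by gcongr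
      _ = _ := mul_comm _ _
  -- the number of terms
  set M := ⌊V / 4⌋₊ with hMd
  have hM1 : (M : ℝ) ≤ V / 4 := Nat.floor_le (by positivity)
  have hM2 : V / 4 < M + 1 := Nat.lt_floor_add_one _
  have hMV : ((4 * M : ℕ) : ℝ) ≤ V := by push_cast; linarith
  set K : ℝ := ((4 * M : ℕ) : ℝ) with hK
  have hKV : V - 4 ≤ K := by rw [hK]; push_cast; linarith
  have hpi := Real.pi_gt_three
  have ha := norm_le_two_mul_re h0 hle
  have hVV4 : V ≤ ‖η‖ := by rw [hL]; exact le_self_pow₀ (by linarith) (by norm_num)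
  have hVb : U ≤ V * b := hVβ.trans (by gcongr)
  have hab : U / 2 ≤ η.re * b := by
    have : V / 2 * b ≤ η.re * b := by gcongr; linarith
    linarith
  have hm : 1 ≤ 4 * Real.pi * η.re * b := by
    rw [mul_assoc]
    exact one_le_mul_of_one_le_of_one_le (by linarith) (by linarith)
  have hKb0 : 1 ≤ K * b := by
    have : V / 2 * b ≤ K * b := by gcongr; linarith
    linarith
  have hKb : 1 ≤ 2 * Real.pi * K * b := by
    rw [mul_assoc]
    exact one_le_mul_of_one_le_of_one_le (by linarith) hKb0
  have hmain := norm_auxRay_add_le h0 hle hV hL M hMV hm hKb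
  rw [← hb, ← hK] at hmain
  set q := saddleNome η with hq
  set x := Real.exp (-(2 * Real.pi * b)) with hx
  have hqn : ‖q‖ = x := norm_saddleNome η
  have hxβ := min_div_two_le_one_sub_exp h0
  rw [← hβ, ← hx] at hxβ
  have hx1 : x < 1 := by linarith
  have h1q : 1 - x ≤ ‖1 - q‖ := by
    have := norm_sub_norm_le (1 : ℂ) q
    rwa [norm_one, hqn] at this
  have h1q0 : 1 - q ≠ 0 := norm_pos_iff.mp (by linarith)
  have h2q : ‖1 + q ^ 2‖ ≤ 2 := by
    refine (norm_add_le _ _).trans ?_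
    rw [norm_one, norm_pow, hqn]
    linarith [pow_le_one₀ (Real.exp_pos (-(2 * Real.pi * b))).le hx1.le (n := 2)]
  have h2q0 : 1 + q ^ 2 ≠ 0 := by
    have h3 := norm_sub_le_norm_add (1 : ℂ) (q ^ 2)
    rw [norm_one, norm_pow, hqn] at h3
    have : 0 < 1 - x ^ 2 := by
      linarith [pow_lt_one₀ (Real.exp_pos (-(2 * Real.pi * b))).le hx1 two_ne_zero]
    exact norm_pos_iff.mp (by linarith)
  have hS := sum_triangular_sign q M
  set A := saddleAmplitude η with hA
  have hA0 : A ≠ 0 := by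
    intro h
    have h4 := norm_kernel_le_saddleAmplitude η
    rw [← hA, h, norm_zero, mul_zero] at h4
    have hη : η ≠ 0 := norm_pos_iff.mp hn
    have h5 : 0 < ‖auxKernel (2 * Real.pi * I * η ^ 2) η‖ := by
      rw [norm_auxKernel hη]; positivity
    have : 0 < ‖auxKernel (2 * Real.pi * I * η ^ 2) η‖ * Real.exp (-(Real.pi * η.im)) := by positivity
    linarith
  set Sg := (1 - q) / (1 + q ^ 2) with hSg
  have hSg0 : Sg ≠ 0 := div_ne_zero h1q0 h2q0
  have hS' : ∑ k ∈ Finset.range (4 * M), Complex.exp (-(Real.pi * I * ((k : ℂ) * (k + 1) / 2))) * q ^ k =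
      Sg * (1 - q ^ (4 * M)) := by
    rw [hSg, div_mul_eq_mul_div, eq_div_iff h2q0, mul_comm, hS]
  rw [hS'] at hmain
  set R := auxRay (2 * Real.pi * I * η ^ 2) with hR
  -- `δ` is solved from the asserted identity. The saddle errors amount to `‖A‖ / (β⁴‖η‖)` and the
  -- main term may be as small as `‖A‖ β / 4`, so the relative error is of order `1 / (β⁵‖η‖)`.
  -- Hence the fifth power here and, in the end, the exponent `2/5`.
  refine ⟨-(R + A * (Sg * (1 - q ^ (4 * M)))) / (A * Sg) - q ^ (4 * M), ?_, ?_⟩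
  swap
  · field_simp
    ring
  -- the size of the error
  have hSgn : 1 / ‖Sg‖ ≤ 4 / β := by
    rw [hSg, norm_div, one_div_div, div_le_div_iff₀ (by linarith) hβ0]
    calc ‖1 + q ^ 2‖ * β ≤ 2 * β := by gcongr
      _ ≤ 4 * ‖1 - q‖ := by linarith
  have hexp1 : Real.exp (Real.pi * b - 19 / 100 * (4 * Real.pi * η.re * b)) ≤ Real.exp (-U) := by
    refine Real.exp_le_exp.mpr ?_
    have hη : (135 : ℝ) ^ 20 ≤ ‖η‖ := (le_max_right _ _).trans hLC
    norm_num at hη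
    exact pi_mul_sub_le_neg h0 (by linarith) (by linarith)
  have hexp2 : Real.exp (Real.pi * b - Real.pi * K * b) ≤ Real.exp (-U) := by
    refine Real.exp_le_exp.mpr ?_
    exact pi_mul_sub_le_neg' h0 (by linarith) hVb hU0.le
  have hexp3 : ‖q ^ (4 * M)‖ ≤ Real.exp (-U) := by
    rw [norm_pow, hqn, hx, ← Real.exp_nat_mul, ← hK]
    refine Real.exp_le_exp.mpr ?_
    have h5 := pi_mul_sub_le_neg' h0 (show V / 2 ≤ K - 1 by linarith) hVb hU0.le
    have h6 : 0 ≤ Real.pi * K * b := by rw [mul_assoc]; exact mul_nonneg (by linarith) (by linarith)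
    have h7 : 0 ≤ Real.pi * b := by positivity
    linarith [show K * -(2 * Real.pi * b) = -(2 * (Real.pi * K * b)) by ring]
  have hD : 18000 / ((1 - x) ^ 4 * ‖η‖) ≤ 288000 / (β ^ 4 * ‖η‖) := by
    rw [div_le_div_iff₀ (by have : 0 < 1 - x := by linarith
                            positivity) (by positivity)]
    have h5 : (β / 2) ^ 4 ≤ (1 - x) ^ 4 := by gcongr
    calc 18000 * (β ^ 4 * ‖η‖) = 288000 * ((β / 2) ^ 4 * ‖η‖) := by ring
      _ ≤ _ := by gcongr
  have hE : ‖η‖ / b * (Real.exp (Real.pi * b - 19 / 100 * (4 * Real.pi * η.re * b)) +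
      Real.exp (Real.pi * b - Real.pi * K * b)) ≤ ‖η‖ / β * (2 * Real.exp (-U)) := by
    have : ‖η‖ / b ≤ ‖η‖ / β := by gcongr
    gcongr
    linarith
  have hfrac : ‖-(R + A * (Sg * (1 - q ^ (4 * M)))) / (A * Sg)‖ ≤
      8 / β * (288000 / (β ^ 4 * ‖η‖) + ‖η‖ / β * (2 * Real.exp (-U))) := by
    rw [norm_div, norm_neg, norm_mul A Sg, div_eq_mul_inv, mul_inv]
    have hAn : 0 < ‖A‖ := norm_pos_iff.mpr hA0
    calc _ ≤ 2 * ‖A‖ * (288000 / (β ^ 4 * ‖η‖) + ‖η‖ / β * (2 * Real.exp (-U))) * (‖A‖⁻¹ * ‖Sg‖⁻¹) := by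
          gcongr
          exact hmain.trans (by gcongr)
      _ = 2 * (1 / ‖Sg‖) * (288000 / (β ^ 4 * ‖η‖) + ‖η‖ / β * (2 * Real.exp (-U))) := by
          field_simp
      _ ≤ 2 * (4 / β) * (288000 / (β ^ 4 * ‖η‖) + ‖η‖ / β * (2 * Real.exp (-U))) := by gcongr
      _ = _ := by ring
  have hp1 : 8 / β * (288000 / (β ^ 4 * ‖η‖)) ≤ 1 / 4 := by
    rw [div_mul_div_comm, div_le_div_iff₀ (by positivity) (by norm_num)]
    have : (135 : ℝ) ^ 20 ≤ β ^ 5 * ‖η‖ := (le_max_right _ _).trans hC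
    have h6 : β * (β ^ 4 * ‖η‖) = β ^ 5 * ‖η‖ := by ring
    rw [h6]
    norm_num at this ⊢
    linarith
  have hp2 : 8 / β * (‖η‖ / β * (2 * Real.exp (-U))) ≤ 16 * U ^ 60 * Real.exp (-U) := by
    have : 8 / β * (‖η‖ / β * (2 * Real.exp (-U))) = 16 * (‖η‖ * (1 / β) * (1 / β)) * Real.exp (-U) := by
      field_simp; ring
    rw [this]
    have h6 : ‖η‖ * (1 / β) * (1 / β) ≤ ‖η‖ * ‖η‖ * ‖η‖ := by gcongr
    have h7 : ‖η‖ * ‖η‖ * ‖η‖ = U ^ 60 := by rw [← hU20]; ring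
    rw [h7] at h6
    gcongr
  have hp3 : Real.exp (-U) ≤ U ^ 60 * Real.exp (-U) :=
    le_mul_of_one_le_left (Real.exp_pos _).le (one_le_pow₀ (by linarith))
  have hfin := hU₀ U hUU
  refine (norm_sub_le _ _).trans ?_
  rw [mul_add] at hfrac
  linarith

/-! ### Continuous logarithms and factorization over zeros -/

/-- Two continuous logarithms of proportional functions differ by a constant on a preconnected set. -/
theorem sub_eq_sub_of_exp_eq_const_mul {E : Set ℂ} (hE : IsPreconnected E) {L₁ L₂ : ℂ → ℂ}
    (h₁ : ContinuousOn L₁ E) (h₂ : ContinuousOn L₂ E) {K : ℂ}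
    (h : ∀ s ∈ E, Complex.exp (L₁ s) = K * Complex.exp (L₂ s)) {a b : ℂ} (ha : a ∈ E) (hb : b ∈ E) :
    L₁ b - L₁ a = L₂ b - L₂ a := by
  have hK : Complex.exp (L₁ a - L₂ a) = K := by
    rw [Complex.exp_sub, h a ha, mul_div_assoc, div_self (Complex.exp_ne_zero _), mul_one]
  -- The exponential is a covering of the punctured plane, and two lifts of one map on a
  -- preconnected set agree everywhere once they agree at `a`.
  have key : EqOn L₁ (fun s => L₂ s + (L₁ a - L₂ a)) E :=
    isCoveringMap_exp.eqOn_of_comp_eqOn hE h₁ (h₂.add continuousOn_const)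
      (fun s hs => Subtype.ext (by
        change Complex.exp (L₁ s) = Complex.exp (L₂ s + (L₁ a - L₂ a))
        rw [Complex.exp_add, hK, h s hs, mul_comm])) ha (by ring)
  have := key hb
  simp only at this
  rw [this]; ring

/-- The continuous variation of the logarithm of `f` between two points of a preconnected set does
not depend on the logarithm. -/
theorem exists_log_variation_le {E : Set ℂ} (hE : IsPreconnected E) (f : ℂ → ℂ) {a b : ℂ} (ha : a ∈ E)
    (hb : b ∈ E) : ∃ C : ℝ, ∀ L : ℂ → ℂ, ContinuousOn L E → (∀ s ∈ E, Complex.exp (L s) = f s) →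
      |(L b - L a).im| ≤ C := by
  by_cases h : ∃ L₀ : ℂ → ℂ, ContinuousOn L₀ E ∧ ∀ s ∈ E, Complex.exp (L₀ s) = f s
  · obtain ⟨L₀, hc, h0⟩ := h
    refine ⟨|(L₀ b - L₀ a).im|, fun L hL hf => ?_⟩
    rw [sub_eq_sub_of_exp_eq_const_mul hE hL hc (K := 1) (fun s hs => by rw [hf s hs, h0 s hs, one_mul])
      ha hb]
  · exact ⟨0, fun L hL hf => (h ⟨L, hL, hf⟩).elim⟩

/-- Zeros of a nontrivial entire function in a compact set are finite in number. -/
theorem finite_zeros_inter_isCompact {f : ℂ → ℂ} (hf : Differentiable ℂ f) {c : ℂ} (hc : f c ≠ 0)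
    {K : Set ℂ} (hK : IsCompact K) : {s | f s = 0 ∧ s ∈ K}.Finite := by
  by_contra h
  obtain ⟨x, -, hx⟩ := Set.Infinite.exists_accPt_of_subset_isCompact h hK (fun s hs => hs.2)
  have han : AnalyticOnNhd ℂ f univ := fun z _ => hf.analyticAt z
  have := han.eqOn_zero_of_preconnected_of_frequently_eq_zero isPreconnected_univ (mem_univ x)
    ((accPt_iff_frequently_nhdsNE.mp hx).mono fun z hz => hz.1)
  exact hc (this (mem_univ c))

theorem exists_differentiable_eq_pow_mul {f : ℂ → ℂ} (hf : Differentiable ℂ f) {ρ : ℂ}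
    (hρ : analyticOrderAt f ρ ≠ ⊤) : ∃ G : ℂ → ℂ, Differentiable ℂ G ∧ G ρ ≠ 0 ∧
      ∀ s, f s = (s - ρ) ^ analyticOrderNatAt f ρ * G s := by
  obtain ⟨g, hg, hg0, hfg⟩ := (hf.analyticAt ρ).analyticOrderAt_ne_top.mp hρ
  classical
  set n := analyticOrderNatAt f ρ with hn
  set G : ℂ → ℂ := Function.update (fun s => f s / (s - ρ) ^ n) ρ (g ρ) with hG
  have hGg : G =ᶠ[𝓝 ρ] g := by
    filter_upwards [hfg] with s hs
    by_cases h : s = ρ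
    · rw [h, hG, Function.update_self]
    · rw [hG, Function.update_of_ne h, hs, smul_eq_mul, mul_div_cancel_left₀]
      exact pow_ne_zero _ (sub_ne_zero.mpr h)
  refine ⟨G, fun s => ?_, by rwa [hGg.eq_of_nhds], fun s => ?_⟩
  · by_cases h : s = ρ
    · rw [h]; exact hGg.symm.differentiableAt_iff.mp hg.differentiableAt
    · have h1 : DifferentiableAt ℂ (fun s => f s / (s - ρ) ^ n) s :=
        (hf s).div (by fun_prop) (pow_ne_zero _ (sub_ne_zero.mpr h))
      refine (EventuallyEq.differentiableAt_iff ?_).mp h1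
      filter_upwards [isOpen_ne.mem_nhds h] with z hz
      rw [hG, Function.update_of_ne hz]
  · by_cases h : s = ρ
    · have := hfg.eq_of_nhds
      rw [h, hGg.eq_of_nhds, this, smul_eq_mul]
    · rw [hG, Function.update_of_ne h, mul_div_cancel₀]
      exact pow_ne_zero _ (sub_ne_zero.mpr h)

/-- Dividing out finitely many zeros of an entire function. -/
theorem exists_differentiable_eq_prod_mul {f : ℂ → ℂ} (hf : Differentiable ℂ f) {c : ℂ} (hc : f c ≠ 0)
    (S : Finset ℂ) : ∃ G : ℂ → ℂ, Differentiable ℂ G ∧ (∀ ρ ∈ S, G ρ ≠ 0) ∧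
      ∀ s, f s = (∏ ρ ∈ S, (s - ρ) ^ analyticOrderNatAt f ρ) * G s := by
  classical
  induction S using Finset.induction_on with
  | empty => exact ⟨f, hf, by simp, by simp⟩
  | insert ρ S hρ ih =>
    obtain ⟨G, hG, hGS, hfG⟩ := ih
    have hGc : G c ≠ 0 := fun h => hc (by rw [hfG, h, mul_zero])
    have han : AnalyticOnNhd ℂ G univ := fun z _ => hG.analyticAt z
    have htop : analyticOrderAt G ρ ≠ ⊤ := by
      refine han.analyticOrderAt_ne_top_of_isPreconnected isPreconnected_univ (mem_univ c) (mem_univ ρ) ?_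
      rw [(hG.analyticAt c).analyticOrderAt_eq_zero.mpr hGc]; simp
    have hord : analyticOrderNatAt f ρ = analyticOrderNatAt G ρ := by
      have e : f = (fun s => ∏ ρ ∈ S, (s - ρ) ^ analyticOrderNatAt f ρ) * G := funext hfG
      have hP : AnalyticAt ℂ (fun s => ∏ ρ ∈ S, (s - ρ) ^ analyticOrderNatAt f ρ) ρ := by
        refine Differentiable.analyticAt ?_ ρ
        fun_prop
      have h0 : analyticOrderAt (fun s => ∏ ρ ∈ S, (s - ρ) ^ analyticOrderNatAt f ρ) ρ = 0 := by
        rw [hP.analyticOrderAt_eq_zero, Finset.prod_ne_zero_iff]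
        intro a ha
        exact pow_ne_zero _ (sub_ne_zero.mpr fun h => hρ (h ▸ ha))
      have h1 := analyticOrderAt_mul hP (hG.analyticAt ρ)
      rw [← e, h0, zero_add] at h1
      rw [analyticOrderNatAt, h1, analyticOrderNatAt]
    obtain ⟨G', hG', hG'ρ, hGG'⟩ := exists_differentiable_eq_pow_mul hG htop
    refine ⟨G', hG', fun a ha => ?_, fun s => ?_⟩
    · rcases Finset.mem_insert.mp ha with rfl | ha
      · exact hG'ρ
      · exact fun h => hGS a ha (by rw [hGG', h, mul_zero])
    · rw [Finset.prod_insert hρ, hfG s, hGG' s, hord]; ring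

/-- A zero-free holomorphic function on a convex open set has a holomorphic logarithm. -/
theorem exists_eq_exp_of_convex {G : ℂ → ℂ} {D : Set ℂ} (hD : Convex ℝ D) (hDo : IsOpen D)
    (hG : DifferentiableOn ℂ G D) (h0 : ∀ s ∈ D, G s ≠ 0) :
    ∃ g : ℂ → ℂ, DifferentiableOn ℂ g D ∧ ∀ s ∈ D, G s = Complex.exp (g s) := by
  rcases D.eq_empty_or_nonempty with rfl | ⟨c, hc⟩
  · exact ⟨0, by simp, by simp⟩
  obtain ⟨p, hp⟩ := hD.exists_forall_hasDerivWithinAt (f := fun s => deriv G s / G s)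
    ((hG.deriv hDo).div hG h0)
  have hp' : ∀ s ∈ D, HasDerivAt p (deriv G s / G s) s := fun s hs =>
    (hp s hs).hasDerivAt (hDo.mem_nhds hs)
  have hq : ∀ s ∈ D, HasDerivAt (fun s => G s * Complex.exp (-p s)) 0 s := by
    intro s hs
    have h1 := (hG.differentiableAt (hDo.mem_nhds hs)).hasDerivAt.mul (hp' s hs).neg.cexp
    refine HasDerivAt.congr_deriv h1 ?_
    have := h0 s hs
    field_simp
    ring
  have hconst : ∀ s ∈ D, G s * Complex.exp (-p s) = G c * Complex.exp (-p c) := fun s hs =>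
    hDo.is_const_of_deriv_eq_zero hD.isPreconnected
      (fun s hs => (hq s hs).differentiableAt.differentiableWithinAt) (fun s hs => (hq s hs).deriv) hs hc
  refine ⟨fun s => p s + Complex.log (G c * Complex.exp (-p c)),
    fun s hs => ((hp' s hs).differentiableAt.add_const _).differentiableWithinAt, fun s hs => ?_⟩
  rw [Complex.exp_add, Complex.exp_log (mul_ne_zero (h0 c hc) (Complex.exp_ne_zero _)), ← hconst s hs,
    Complex.exp_neg]
  rw [mul_left_comm, mul_inv_cancel₀ (Complex.exp_ne_zero _), mul_one]

/-- Factorization of an entire function over its zeros in a convex open set. -/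
theorem exists_eq_prod_mul_exp {f : ℂ → ℂ} (hf : Differentiable ℂ f) {c : ℂ} (hc : f c ≠ 0)
    {D : Set ℂ} (hD : Convex ℝ D) (hDo : IsOpen D) (S : Finset ℂ) (hS : ∀ s ∈ D, f s = 0 → s ∈ S) :
    ∃ G g : ℂ → ℂ, Differentiable ℂ G ∧ DifferentiableOn ℂ g D ∧
      (∀ s, f s = (∏ ρ ∈ S, (s - ρ) ^ analyticOrderNatAt f ρ) * G s) ∧
      ∀ s ∈ D, G s = Complex.exp (g s) := by
  obtain ⟨G, hG, hGS, hfG⟩ := exists_differentiable_eq_prod_mul hf hc S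
  obtain ⟨g, hg, hGg⟩ := exists_eq_exp_of_convex hD hDo hG.differentiableOn (fun s hs h =>
    hGS s (hS s hs (by rw [hfG, h, mul_zero])) h)
  exact ⟨G, g, hG, hg, hfG, hGg⟩

/-! ### Counting zeros by comparing two logarithms -/

/-- The logarithm of a product over zeros with all cuts to the left. -/
noncomputable def logProdRight (S : Finset ℂ) (m : ℂ → ℕ) (s : ℂ) : ℂ := ∑ ρ ∈ S, m ρ * Complex.log (s - ρ)

/-- The logarithm of a product over zeros with all cuts to the right. -/
noncomputable def logProdLeft (S : Finset ℂ) (m : ℂ → ℕ) (s : ℂ) : ℂ := ∑ ρ ∈ S, m ρ * Complex.log (ρ - s)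

theorem exp_logProdRight {S : Finset ℂ} {s : ℂ} (hs : s ∉ S) (m : ℂ → ℕ) :
    Complex.exp (logProdRight S m s) = ∏ ρ ∈ S, (s - ρ) ^ m ρ := by
  rw [logProdRight, Complex.exp_sum]
  refine Finset.prod_congr rfl fun ρ hρ => ?_
  rw [Complex.exp_nat_mul, Complex.exp_log]
  exact sub_ne_zero.mpr fun h => hs (h ▸ hρ)

theorem exp_logProdLeft {S : Finset ℂ} {s : ℂ} (hs : s ∉ S) (m : ℂ → ℕ) :
    Complex.exp (logProdLeft S m s) = (-1) ^ (∑ ρ ∈ S, m ρ) * ∏ ρ ∈ S, (s - ρ) ^ m ρ := by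
  rw [logProdLeft, Complex.exp_sum, ← Finset.prod_pow_eq_pow_sum, ← Finset.prod_mul_distrib]
  refine Finset.prod_congr rfl fun ρ hρ => ?_
  have h : ρ - s ≠ 0 := sub_ne_zero.mpr fun h => hs (h ▸ hρ)
  rw [Complex.exp_nat_mul, Complex.exp_log h, ← mul_pow]
  ring_nf

theorem continuousOn_logProdRight {S : Finset ℂ} (m : ℂ → ℕ) {E : Set ℂ}
    (h : ∀ s ∈ E, ∀ ρ ∈ S, s - ρ ∈ slitPlane) : ContinuousOn (logProdRight S m) E := by
  unfold logProdRight
  refine continuousOn_finsetSum _ fun ρ hρ => continuousOn_const.mul ?_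
  exact ContinuousOn.clog (by fun_prop) fun s hs => h s hs ρ hρ

theorem continuousOn_logProdLeft {S : Finset ℂ} (m : ℂ → ℕ) {E : Set ℂ}
    (h : ∀ s ∈ E, ∀ ρ ∈ S, ρ - s ∈ slitPlane) : ContinuousOn (logProdLeft S m) E := by
  unfold logProdLeft
  refine continuousOn_finsetSum _ fun ρ hρ => continuousOn_const.mul ?_
  exact ContinuousOn.clog (by fun_prop) fun s hs => h s hs ρ hρ

theorem arg_sub_arg_neg {z : ℂ} (hz : z.im ≠ 0) :
    arg z - arg (-z) = if 0 < z.im then Real.pi else -Real.pi := by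
  split_ifs with h
  · rw [arg_neg_eq_arg_sub_pi_of_im_pos h]; ring
  · rw [arg_neg_eq_arg_add_pi_of_im_neg (lt_of_le_of_ne (not_lt.mp h) hz)]; ring

/-- Comparison of the two logarithms counts the zeros below against those above. -/
theorem logProdRight_sub_logProdLeft_im {S : Finset ℂ} (m : ℂ → ℕ) {s : ℂ} (hs : ∀ ρ ∈ S, ρ.im ≠ s.im) :
    (logProdRight S m s - logProdLeft S m s).im =
      ∑ ρ ∈ S, m ρ * (if ρ.im < s.im then Real.pi else -Real.pi) := by
  rw [logProdRight, logProdLeft, ← Finset.sum_sub_distrib, Complex.im_sum]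
  refine Finset.sum_congr rfl fun ρ hρ => ?_
  have h1 := arg_sub_arg_neg (z := s - ρ) (by rw [sub_im, sub_ne_zero]; exact (hs ρ hρ).symm)
  simp only [neg_sub, sub_im, sub_pos] at h1
  rw [← mul_sub, ← Complex.ofReal_natCast, Complex.im_ofReal_mul, sub_im, log_im, log_im, h1]

/-- The difference over two heights counts the zeros between. -/
theorem two_pi_mul_sum_eq {S : Finset ℂ} (m : ℂ → ℕ) {A B : ℂ} (hA : ∀ ρ ∈ S, ρ.im ≠ A.im)
    (hB : ∀ ρ ∈ S, ρ.im ≠ B.im) (hAB : A.im ≤ B.im) :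
    2 * Real.pi * ∑ ρ ∈ S with A.im < ρ.im ∧ ρ.im < B.im, (m ρ : ℝ) =
      (logProdRight S m B - logProdRight S m A).im - (logProdLeft S m B - logProdLeft S m A).im := by
  have h1 := logProdRight_sub_logProdLeft_im m hA
  have h2 := logProdRight_sub_logProdLeft_im m hB
  -- Zeros below both heights or above both give equal contributions at the two heights, which
  -- cancel; a zero between contributes `π - (-π)`.
  have h3 : 2 * Real.pi * ∑ ρ ∈ S with A.im < ρ.im ∧ ρ.im < B.im, (m ρ : ℝ) =
      ∑ ρ ∈ S, m ρ * (if ρ.im < B.im then Real.pi else -Real.pi) -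
      ∑ ρ ∈ S, m ρ * (if ρ.im < A.im then Real.pi else -Real.pi) := by
    rw [Finset.sum_filter, Finset.mul_sum, ← Finset.sum_sub_distrib]
    refine Finset.sum_congr rfl fun ρ hρ => ?_
    rcases lt_or_gt_of_ne (hA ρ hρ) with h | h
    · rw [if_neg (by simp [h.le]), if_pos h, if_pos (h.trans_le hAB)]; ring
    · have h0 : ¬ ρ.im < A.im := h.not_gt
      rw [if_neg h0]
      rcases lt_or_gt_of_ne (hB ρ hρ) with h' | h'
      · rw [if_pos ⟨h, h'⟩, if_pos h']; ring
      · rw [if_neg (by simp [h'.le]), if_neg h'.not_gt]; ring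
  rw [h3, ← h1, ← h2]
  simp only [sub_im]
  ring

theorem abs_logProdRight_sub_im_le (S : Finset ℂ) (m : ℂ → ℕ) (a c : ℂ) :
    |(logProdRight S m a - logProdRight S m c).im| ≤ 2 * Real.pi * ∑ ρ ∈ S, (m ρ : ℝ) := by
  rw [logProdRight, logProdRight, ← Finset.sum_sub_distrib, Complex.im_sum, Finset.mul_sum]
  refine (Finset.abs_sum_le_sum_abs _ _).trans (Finset.sum_le_sum fun ρ _ => ?_)
  rw [← mul_sub, ← Complex.ofReal_natCast, Complex.im_ofReal_mul, sub_im, log_im, log_im, abs_mul,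
    Nat.abs_cast, mul_comm]
  gcongr
  have h1 := abs_le.mp (abs_arg_le_pi (a - ρ))
  have h2 := abs_le.mp (abs_arg_le_pi (c - ρ))
  rw [abs_le]
  constructor <;> linarith

/-! ### Variation of the argument by Jensen and Borel–Carathéodory -/

/-- Jensen's bound for the number of zeros, together with the bound for the zero-free quotient. -/
theorem norm_quotient_le {f G : ℂ → ℂ} (hG : Differentiable ℂ G) {c : ℂ} (hc : f c ≠ 0)
    {r M : ℝ} (hr : 0 < r) (hM : ∀ s ∈ Metric.closedBall c (6 * r), ‖f s‖ ≤ M) {S : Finset ℂ}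
    (hS : ∀ ρ ∈ S, ‖ρ - c‖ ≤ 2 * r) (m : ℂ → ℕ)
    (hfG : ∀ s, f s = (∏ ρ ∈ S, (s - ρ) ^ m ρ) * G s) {s : ℂ} (hs : s ∈ Metric.closedBall c (6 * r)) :
    ‖G s‖ * 2 ^ (∑ ρ ∈ S, m ρ) ≤ M / ‖f c‖ * ‖G c‖ := by
  set n := ∑ ρ ∈ S, m ρ with hn
  have hfc : 0 < ‖f c‖ := norm_pos_iff.mpr hc
  -- On the sphere of radius `6r` every zero is at distance at least `4r`, so the maximum principle
  -- applies to `G`. At the centre the distances are at most `2r`; the quotient `4r / 2r` yields the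
  -- `2^n` of the conclusion.
  have h1 : ‖G s‖ ≤ M / (4 * r) ^ n := by
    refine Complex.norm_le_of_forall_mem_frontier_norm_le (Metric.isBounded_ball (x := c) (r := 6 * r))
      hG.diffContOnCl ?_ (by rwa [closure_ball _ (by positivity)])
    intro z hz
    rw [frontier_ball _ (by positivity), mem_sphere_iff_norm] at hz
    rw [le_div_iff₀ (by positivity), mul_comm]
    have h2 : (4 * r) ^ n ≤ ‖∏ ρ ∈ S, (z - ρ) ^ m ρ‖ := by
      rw [norm_prod, hn, ← Finset.prod_pow_eq_pow_sum]
      refine Finset.prod_le_prod (fun _ _ => by positivity) fun ρ hρ => ?_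
      rw [norm_pow]
      gcongr
      have h3 := norm_sub_norm_le (z - c) (ρ - c)
      rw [sub_sub_sub_cancel_right] at h3
      linarith [hS ρ hρ]
    calc (4 * r) ^ n * ‖G z‖ ≤ ‖∏ ρ ∈ S, (z - ρ) ^ m ρ‖ * ‖G z‖ := by gcongr
      _ = ‖f z‖ := by rw [hfG z, norm_mul]
      _ ≤ M := hM z (by rw [mem_closedBall_iff_norm, hz])
  have h2 : ‖f c‖ ≤ (2 * r) ^ n * ‖G c‖ := by
    rw [hfG c, norm_mul, norm_prod, hn, ← Finset.prod_pow_eq_pow_sum]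
    gcongr with ρ hρ
    rw [norm_pow, norm_sub_rev]
    gcongr
    exact hS ρ hρ
  have hM0 : 0 ≤ M := (norm_nonneg _).trans (hM s hs)
  calc ‖G s‖ * 2 ^ n ≤ M / (4 * r) ^ n * 2 ^ n := by gcongr
    _ = M / ‖f c‖ * (‖f c‖ / (2 * r) ^ n) := by
      rw [show 4 * r = 2 * (2 * r) by ring, mul_pow]
      field_simp
    _ ≤ M / ‖f c‖ * ‖G c‖ := by
      gcongr
      rw [div_le_iff₀ (by positivity), mul_comm]
      exact h2

/-- Variation of the argument of an entire function along a horizontal segment free of zeros. -/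
theorem abs_log_variation_le_of_norm_le {f : ℂ → ℂ} (hf : Differentiable ℂ f) {c : ℂ} {r M : ℝ}
    (hr : 0 < r) (hM : ∀ s ∈ Metric.closedBall c (6 * r), ‖f s‖ ≤ M) (hcM : ‖f c‖ < M) {a : ℂ}
    (ha : a.im = c.im) (har : ‖a - c‖ ≤ r) (hz : ∀ s, f s = 0 → s.im ≠ c.im) {L : ℂ → ℂ}
    (hL : ContinuousOn L (segment ℝ a c)) (hLf : ∀ s ∈ segment ℝ a c, Complex.exp (L s) = f s) :
    |(L a - L c).im| ≤ 12 * Real.log (M / ‖f c‖) := by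
  have hc : f c ≠ 0 := fun h => hz c h rfl
  have hfc : 0 < ‖f c‖ := norm_pos_iff.mpr hc
  set B := Real.log (M / ‖f c‖) with hB
  have hMpos : 0 < M := hfc.trans hcM
  have hB0 : 0 < B := Real.log_pos ((one_lt_div hfc).mpr hcM)
  have hfin := finite_zeros_inter_isCompact hf hc (isCompact_closedBall c (2 * r))
  set S := hfin.toFinset with hS
  have hSz : ∀ ρ ∈ S, f ρ = 0 ∧ ‖ρ - c‖ ≤ 2 * r := fun ρ hρ => by
    have := hfin.mem_toFinset.mp hρ
    exact ⟨this.1, mem_closedBall_iff_norm.mp this.2⟩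
  obtain ⟨G, g, hG, hg, hfG, hGg⟩ := exists_eq_prod_mul_exp hf hc (convex_ball c (2 * r))
    Metric.isOpen_ball S (fun s hs h => hfin.mem_toFinset.mpr ⟨h, Metric.ball_subset_closedBall hs⟩)
  set m := fun ρ => analyticOrderNatAt f ρ with hm
  have hGc0 : G c ≠ 0 := fun h => hc (by rw [hfG, h, mul_zero])
  have hGc : 0 < ‖G c‖ := norm_pos_iff.mpr hGc0
  have hJ := fun s hs => norm_quotient_le hG hc hr hM (fun ρ hρ => (hSz ρ hρ).2) m hfG (s := s) hs
  set n := ∑ ρ ∈ S, m ρ with hn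
  -- Taking `s = c` in the quotient bound gives `2^n ≤ M / ‖f c‖`.
  have hnB : n * Real.log 2 ≤ B := by
    have h1 := hJ c (Metric.mem_closedBall_self (by positivity))
    rw [mul_comm] at h1
    have h2 := le_of_mul_le_mul_right h1 hGc
    rw [← Real.log_pow]
    exact Real.log_le_log (by positivity) h2
  have hcD : c ∈ Metric.ball c (2 * r) := Metric.mem_ball_self (by positivity)
  have hre : ∀ s ∈ Metric.ball c (2 * r), (g s - g c).re ≤ B := by
    intro s hs
    have h1 := hJ s (Metric.closedBall_subset_closedBall (by linarith) (Metric.ball_subset_closedBall hs))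
    have h2 : ‖G s‖ ≤ M / ‖f c‖ * ‖G c‖ :=
      (le_mul_of_one_le_right (norm_nonneg _) (one_le_pow₀ one_le_two)).trans h1
    rw [hGg s hs, hGg c hcD, Complex.norm_exp, Complex.norm_exp, ← div_le_iff₀ (Real.exp_pos _),
      ← Real.exp_sub] at h2
    rw [sub_re, hB, Real.le_log_iff_exp_le (by positivity)]
    exact h2
  -- Borel–Carathéodory in the disc of radius `2r`, at distance at most `r` from the centre.
  have hBC : ‖g a - g c‖ ≤ 2 * B := by
    have h1 := Complex.borelCaratheodory_zero (f := fun z => g (c + z) - g c) (M := B) (R := 2 * r)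
      (z := a - c) hB0 ?_ ?_ (by positivity) (by rw [mem_ball_zero_iff]; linarith) (by simp)
    · simp only [add_sub_cancel] at h1
      refine h1.trans ?_
      rw [div_le_iff₀ (by linarith)]
      nlinarith
    · refine DifferentiableOn.sub_const (hg.comp (by fun_prop) fun z hz => ?_) _
      rw [mem_ball_iff_norm, add_sub_cancel_left]
      exact mem_ball_zero_iff.mp hz
    · intro z hz
      refine hre (c + z) ?_
      rw [mem_ball_iff_norm, add_sub_cancel_left]
      exact mem_ball_zero_iff.mp hz
  have haD : a ∈ Metric.ball c (2 * r) := by rw [mem_ball_iff_norm]; linarith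
  have hseg : segment ℝ a c ⊆ Metric.ball c (2 * r) := (convex_ball c (2 * r)).segment_subset haD hcD
  have him : ∀ s ∈ segment ℝ a c, s.im = c.im := by
    rintro s ⟨x, y, hx, hy, hxy, rfl⟩
    simp only [add_im, Complex.real_smul, Complex.im_ofReal_mul, ha]
    rw [← add_mul, hxy, one_mul]
  have hvar := sub_eq_sub_of_exp_eq_const_mul (convex_segment a c).isPreconnected hL
    (L₂ := fun s => logProdRight S m s + g s) (K := 1)
    ((continuousOn_logProdRight m fun s hs ρ hρ => ?_).add (hg.continuousOn.mono hseg)) (fun s hs => ?_)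
    (right_mem_segment ℝ a c) (left_mem_segment ℝ a c)
  · rw [hvar, add_sub_add_comm, add_im]
    have h1 := abs_logProdRight_sub_im_le S m a c
    have h2 := (Complex.abs_im_le_norm (g a - g c)).trans hBC
    have h3 : ∑ ρ ∈ S, (m ρ : ℝ) = n := by rw [hn]; push_cast; rfl
    rw [h3] at h1
    -- `2π / log 2 < 10`; together with the `2B` for `g` this makes the constant `12`.
    have h4 : 2 * Real.pi * n ≤ 10 * B := by
      have := Real.pi_lt_d2
      have := Real.log_two_gt_d9
      have : (0 : ℝ) ≤ n := by positivity
      nlinarith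
    refine (abs_add_le _ _).trans ?_
    linarith
  · refine Complex.mem_slitPlane_iff.mpr (Or.inr ?_)
    rw [sub_im, him s hs, sub_ne_zero]
    exact (hz ρ (hSz ρ hρ).1).symm
  · have hsS : s ∉ S := fun h => hz s (hSz s h).1 (him s hs)
    rw [hLf s hs, Complex.exp_add, exp_logProdRight hsS, hfG s, hGg s (hseg hs), one_mul]

/-! ### The logarithm of `R(s)` in the left region -/

/-- The saddle point `√(s / 2πi)`. -/
noncomputable def auxSaddle (s : ℂ) : ℂ := Complex.exp (Complex.log (s / (2 * Real.pi * I)) / 2)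

/-- The exponent in the asymptotic formula in the left half plane. -/
noncomputable def auxPhase (s : ℂ) : ℂ :=
  -(s / 2) * Complex.log (s / (2 * Real.pi * I)) + s / 2 + Real.pi * I * auxSaddle s

/-- A region to the left, on which the asymptotic formula is valid. -/
def leftRegion (C : ℝ) : Set ℂ :=
  {s | s.re < 0 ∧ 0 < s.im ∧ C ≤ (-s.re) ^ 3 ∧ C * s.im ^ 2 ≤ (-s.re) ^ 5}

/-- With `R` zero-free on the region, a zero at the height of one of its points must lie to the
right of that point. So cuts running right from the zeros do not meet the left edge. -/
theorem mem_leftRegion_of_re_le {C : ℝ} {s z : ℂ} (hs : s ∈ leftRegion C) (hz : z.im = s.im)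
    (h : z.re ≤ s.re) : z ∈ leftRegion C := by
  obtain ⟨h1, h2, h3, h4⟩ := hs
  have h5 : 0 ≤ -s.re := by linarith
  refine ⟨by linarith, by linarith, h3.trans ?_, ?_⟩
  · gcongr
  · rw [hz]; refine h4.trans ?_; gcongr

theorem div_two_pi_I_re (s : ℂ) : (s / (2 * Real.pi * I)).re = s.im / (2 * Real.pi) := by
  have h : s / (2 * Real.pi * I) = (-I * s) / ((2 * Real.pi : ℝ) : ℂ) := by
    have : (Real.pi : ℂ) ≠ 0 := ofReal_ne_zero.mpr Real.pi_ne_zero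
    push_cast
    field_simp
    linear_combination s * I_sq
  rw [h, div_ofReal_re]; simp

theorem div_two_pi_I_im (s : ℂ) : (s / (2 * Real.pi * I)).im = -s.re / (2 * Real.pi) := by
  have h : s / (2 * Real.pi * I) = (-I * s) / ((2 * Real.pi : ℝ) : ℂ) := by
    have : (Real.pi : ℂ) ≠ 0 := ofReal_ne_zero.mpr Real.pi_ne_zero
    push_cast
    field_simp
    linear_combination s * I_sq
  rw [h, div_ofReal_im]; simp

theorem two_pi_I_ne_zero' : (2 * Real.pi * I : ℂ) ≠ 0 := by simp [Real.pi_ne_zero]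

theorem two_pi_I_mul_auxSaddle_sq {s : ℂ} (hs : s ≠ 0) : 2 * Real.pi * I * auxSaddle s ^ 2 = s := by
  rw [auxSaddle, ← Complex.exp_nat_mul, show ((2 : ℕ) : ℂ) * (Complex.log (s / (2 * Real.pi * I)) / 2) =
    Complex.log (s / (2 * Real.pi * I)) by push_cast; ring,
    Complex.exp_log (div_ne_zero hs two_pi_I_ne_zero'), mul_div_cancel₀ _ two_pi_I_ne_zero']

theorem log_auxSaddle (s : ℂ) : Complex.log (auxSaddle s) = Complex.log (s / (2 * Real.pi * I)) / 2 := by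
  have e : (Complex.log (s / (2 * Real.pi * I)) / 2).im = arg (s / (2 * Real.pi * I)) / 2 := by
    rw [← log_im]; exact div_ofReal_im _ 2
  have h1 := neg_pi_lt_arg (s / (2 * Real.pi * I))
  have h2 := arg_le_pi (s / (2 * Real.pi * I))
  rw [auxSaddle, Complex.log_exp]
  · rw [e]; linarith
  · rw [e]; linarith

/-- Real and imaginary parts of `2πiη² = s`. The root has positive real part because `s/(2πi)` lies
in the right half-plane when `Im s > 0`. -/
theorem auxSaddle_re_im {s : ℂ} (h1 : s.re < 0) (h2 : 0 < s.im) :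
    0 < (auxSaddle s).im ∧ (auxSaddle s).im ≤ (auxSaddle s).re ∧
      4 * Real.pi * (auxSaddle s).re * (auxSaddle s).im = -s.re ∧
      2 * Real.pi * ((auxSaddle s).re ^ 2 - (auxSaddle s).im ^ 2) = s.im := by
  have hs : s ≠ 0 := fun h => by simp [h] at h1
  have e1 := two_pi_I_sq_re (auxSaddle s)
  have e2 := two_pi_I_sq_im (auxSaddle s)
  rw [two_pi_I_mul_auxSaddle_sq hs] at e1 e2
  have hre : 0 < (auxSaddle s).re := by
    rw [auxSaddle, Complex.exp_re]
    have e : (Complex.log (s / (2 * Real.pi * I)) / 2).im = arg (s / (2 * Real.pi * I)) / 2 := by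
      rw [← log_im]; exact div_ofReal_im _ 2
    refine mul_pos (Real.exp_pos _) (Real.cos_pos_of_mem_Ioo ?_)
    have h3 : |arg (s / (2 * Real.pi * I))| < Real.pi / 2 := by
      rw [abs_arg_lt_pi_div_two_iff, div_two_pi_I_re]
      exact Or.inl (by positivity)
    rw [abs_lt] at h3
    rw [e]
    constructor <;> linarith [Real.pi_pos]
  have hpi := Real.pi_pos
  have him : 0 < (auxSaddle s).im := by
    by_contra h
    push Not at h
    have : 4 * Real.pi * (auxSaddle s).re * (auxSaddle s).im ≤ 0 :=
      mul_nonpos_of_nonneg_of_nonpos (by positivity) h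
    linarith
  refine ⟨him, ?_, by linarith, e2.symm⟩
  have h3 : 0 < (auxSaddle s).re ^ 2 - (auxSaddle s).im ^ 2 := by
    by_contra h
    push Not at h
    have : 2 * Real.pi * ((auxSaddle s).re ^ 2 - (auxSaddle s).im ^ 2) ≤ 0 :=
      mul_nonpos_of_nonneg_of_nonpos (by positivity) h
    linarith
  exact (pow_le_pow_iff_left₀ him.le hre.le two_ne_zero).mp (by linarith)

/-- From `-σ ≤ 4π‖η‖ Im η` and `|s| = 2π‖η‖²`, the quotient `(-σ)^5 / |s|²` is at most a constant
times `(Im η)^5 ‖η‖`. In `|s|² = σ² + t²` the two conditions of the region handle one summand each;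
the cubic one also settles the case `Im η ≥ 1`. -/
theorem exists_leftRegion_saddle (C₀ : ℝ) (hC₀ : 1 ≤ C₀) : ∃ C₁ : ℝ, 1 ≤ C₁ ∧ ∀ s ∈ leftRegion C₁,
    C₀ ≤ min (auxSaddle s).im 1 ^ 5 * ‖auxSaddle s‖ := by
  have hpi := Real.pi_gt_three
  have h512 : 1 ≤ 512 * Real.pi ^ 3 * C₀ := by
    have : 1 ≤ Real.pi ^ 3 := one_le_pow₀ (by linarith)
    nlinarith
  refine ⟨512 * Real.pi ^ 3 * C₀ + (2 * Real.pi * C₀ ^ 2) ^ 3, by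
    have : 0 ≤ (2 * Real.pi * C₀ ^ 2) ^ 3 := by positivity
    linarith, ?_⟩
  rintro s ⟨h1, h2, h3, h4⟩
  set C₁ := 512 * Real.pi ^ 3 * C₀ + (2 * Real.pi * C₀ ^ 2) ^ 3 with hC₁
  obtain ⟨him, hle, e1, e2⟩ := auxSaddle_re_im h1 h2
  have hs : s ≠ 0 := fun h => by simp [h] at h1
  set η := auxSaddle s with hη
  have hn : 0 < ‖η‖ := him.trans_le ((le_abs_self _).trans (abs_im_le_norm _))
  have hns : 2 * Real.pi * ‖η‖ ^ 2 = ‖s‖ := by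
    rw [← two_pi_I_mul_auxSaddle_sq hs, ← hη]
    simp [abs_of_pos Real.pi_pos]
  rcases le_total 1 η.im with h | h
  · rw [min_eq_right h, one_pow, one_mul]
    have h5 : 2 * Real.pi * C₀ ^ 2 ≤ -s.re := by
      refine le_of_pow_le_pow_left₀ (three_ne_zero) (by linarith) (le_trans ?_ h3)
      rw [hC₁]; linarith
    have h6 : -s.re ≤ ‖s‖ := (neg_le_abs _).trans (abs_re_le_norm s)
    refine le_of_pow_le_pow_left₀ two_ne_zero hn.le ?_
    have h7 : 2 * Real.pi * C₀ ^ 2 ≤ 2 * Real.pi * ‖η‖ ^ 2 := by linarith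
    exact le_of_mul_le_mul_left h7 (by positivity)
  · rw [min_eq_left h]
    have h5 : C₁ * ‖s‖ ^ 2 ≤ 2 * (-s.re) ^ 5 := by
      have e : ‖s‖ ^ 2 = (-s.re) ^ 2 + s.im ^ 2 := by rw [← normSq_eq_norm_sq, normSq_apply]; ring
      have : C₁ * (-s.re) ^ 2 ≤ (-s.re) ^ 3 * (-s.re) ^ 2 := by gcongr
      rw [e, mul_add]
      linarith [show (-s.re) ^ 3 * (-s.re) ^ 2 = (-s.re) ^ 5 by ring]
    have h6 : -s.re ≤ 4 * Real.pi * ‖η‖ * η.im := by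
      rw [← e1]
      gcongr
      exact (le_abs_self _).trans (abs_re_le_norm _)
    have h7 : (-s.re) ^ 5 ≤ (4 * Real.pi * ‖η‖ * η.im) ^ 5 := by
      have : 0 ≤ -s.re := by linarith
      gcongr
    have h8 : (512 * Real.pi ^ 3 * C₀) * ‖s‖ ^ 2 ≤ 2 * (4 * Real.pi * ‖η‖ * η.im) ^ 5 := by
      have : 512 * Real.pi ^ 3 * C₀ ≤ C₁ := by
        rw [hC₁]
        have : 0 ≤ (2 * Real.pi * C₀ ^ 2) ^ 3 := by positivity
        linarith
      calc _ ≤ C₁ * ‖s‖ ^ 2 := by gcongr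
        _ ≤ _ := by linarith
    rw [← hns] at h8
    have h9 : (2048 * Real.pi ^ 5 * ‖η‖ ^ 4) * C₀ ≤ (2048 * Real.pi ^ 5 * ‖η‖ ^ 4) * (η.im ^ 5 * ‖η‖) := by
      calc _ = 512 * Real.pi ^ 3 * C₀ * (2 * Real.pi * ‖η‖ ^ 2) ^ 2 := by ring
        _ ≤ _ := h8
        _ = _ := by ring
    exact le_of_mul_le_mul_left h9 (by positivity)

theorem saddleAmplitude_eq_exp {s : ℂ} (hs : s ≠ 0) : saddleAmplitude (auxSaddle s) =
    Complex.exp (-(Real.pi * I / 8)) * ((1 + I) / 2) * Complex.exp (auxPhase s) := by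
  have h0 : auxSaddle s ≠ 0 := Complex.exp_ne_zero _
  have e : 2 * Real.pi * I * auxSaddle s ^ 2 = s := two_pi_I_mul_auxSaddle_sq hs
  have e2 : Real.pi * I * auxSaddle s ^ 2 = s / 2 := by linear_combination e / 2
  rw [saddleAmplitude, auxKernel, e, e2, cpow_def_of_ne_zero h0, log_auxSaddle, auxPhase, Complex.exp_add,
    Complex.exp_add]
  ring_nf

theorem continuousOn_auxSaddle : ContinuousOn auxSaddle {s | 0 < s.im} := by
  unfold auxSaddle
  refine ((ContinuousOn.clog (by fun_prop) fun s hs => ?_).div_const _).cexp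
  refine mem_slitPlane_iff.mpr (Or.inl ?_)
  rw [div_two_pi_I_re]
  have : 0 < s.im := hs
  positivity

theorem continuousOn_auxPhase : ContinuousOn auxPhase {s | 0 < s.im} := by
  unfold auxPhase
  refine ((ContinuousOn.mul (by fun_prop) (ContinuousOn.clog (by fun_prop) fun s hs => ?_)).add
    (by fun_prop)).add (continuousOn_const.mul continuousOn_auxSaddle)
  refine mem_slitPlane_iff.mpr (Or.inl ?_)
  rw [div_two_pi_I_re]
  have : 0 < s.im := hs
  positivity

theorem one_add_mem_slitPlane_of_norm_lt {z : ℂ} (hz : ‖z‖ < 1) : 1 + z ∈ slitPlane := by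
  refine mem_slitPlane_iff.mpr (Or.inl ?_)
  have := (neg_le_abs _).trans (abs_re_le_norm z)
  rw [add_re, one_re]
  linarith

/-- The logarithm of `riemannAux` in the left region. -/
theorem exists_log_riemannAux_left : ∃ C₁ : ℝ, 1 ≤ C₁ ∧ ∃ K : ℂ, K ≠ 0 ∧ ∃ L : ℂ → ℂ,
    ContinuousOn L (leftRegion C₁) ∧ (∀ s ∈ leftRegion C₁, riemannAux s = K * Complex.exp (L s)) ∧
      ∀ s, |(L s - auxPhase s).im| ≤ 4 * Real.pi := by
  obtain ⟨C₀, hC₀, hasym⟩ := exists_auxRay_asymptotic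
  obtain ⟨C₁, hC₁, hreg⟩ := exists_leftRegion_saddle C₀ hC₀
  set K : ℂ := Complex.exp (-(Real.pi * I / 8)) * ((1 + I) / 2) with hK
  have hI : (1 + I : ℂ) ≠ 0 := fun h => by simpa using congrArg Complex.re h
  have hK0 : K ≠ 0 := mul_ne_zero (Complex.exp_ne_zero _) (div_ne_zero hI two_ne_zero)
  set q : ℂ → ℂ := fun s => saddleNome (auxSaddle s) with hq
  set e : ℂ → ℂ := fun s => Complex.exp (Real.pi * I * s) with he
  set P : ℂ → ℂ := fun s => K * Complex.exp (auxPhase s) * ((1 - e s) * ((1 - q s) / (1 + q s ^ 2))) with hP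
  have hqn : ∀ s ∈ leftRegion C₁, ‖q s‖ < 1 := by
    rintro s ⟨h1, h2, -⟩
    rw [hq]
    simp only
    rw [norm_saddleNome, Real.exp_lt_one_iff]
    have := mul_pos Real.pi_pos (auxSaddle_re_im h1 h2).1
    linarith
  have hen : ∀ s ∈ leftRegion C₁, ‖e s‖ < 1 := by
    rintro s ⟨h1, h2, -⟩
    rw [he]
    simp only
    rw [Complex.norm_exp, Real.exp_lt_one_iff]
    have := mul_pos Real.pi_pos h2
    simpa
  have hs1 : ∀ s ∈ leftRegion C₁, 1 - e s ∈ slitPlane := fun s hs => by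
    rw [sub_eq_add_neg]; exact one_add_mem_slitPlane_of_norm_lt (by rw [norm_neg]; exact hen s hs)
  have hs2 : ∀ s ∈ leftRegion C₁, 1 - q s ∈ slitPlane := fun s hs => by
    rw [sub_eq_add_neg]; exact one_add_mem_slitPlane_of_norm_lt (by rw [norm_neg]; exact hqn s hs)
  have hs3 : ∀ s ∈ leftRegion C₁, 1 + q s ^ 2 ∈ slitPlane := fun s hs =>
    one_add_mem_slitPlane_of_norm_lt (by
      rw [norm_pow]; exact pow_lt_one₀ (norm_nonneg _) (hqn s hs) two_ne_zero)
  have hP0 : ∀ s ∈ leftRegion C₁, P s ≠ 0 := fun s hs =>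
    mul_ne_zero (mul_ne_zero hK0 (Complex.exp_ne_zero _)) (mul_ne_zero (slitPlane_ne_zero (hs1 s hs))
      (div_ne_zero (slitPlane_ne_zero (hs2 s hs)) (slitPlane_ne_zero (hs3 s hs))))
  have hR : ∀ s ∈ leftRegion C₁, ∃ δ : ℂ, ‖δ‖ ≤ 1 / 2 ∧ riemannAux s / P s = 1 + δ := by
    intro s hs
    obtain ⟨h1, h2, h3, -⟩ := id hs
    obtain ⟨him, hle, -⟩ := auxSaddle_re_im h1 h2
    have hs0 : s ≠ 0 := fun h => by simp [h] at h1
    obtain ⟨δ, hδ, hA⟩ := hasym (auxSaddle s) him hle (hreg s hs)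
    refine ⟨δ, hδ, ?_⟩
    have hre : s.re ≤ -1 := by
      have : 1 ≤ -s.re := le_of_pow_le_pow_left₀ three_ne_zero (by linarith) (by
        rw [one_pow]; exact hC₁.trans h3)
      linarith
    rw [two_pi_I_mul_auxSaddle_sq hs0, saddleAmplitude_eq_exp hs0, ← hK] at hA
    rw [div_eq_iff (hP0 s hs), riemannAux_eq_auxRay hre, hA, hP]
    ring
  have hcreg : leftRegion C₁ ⊆ {s | 0 < s.im} := fun s hs => hs.2.1
  have hcφ : ContinuousOn auxPhase (leftRegion C₁) := continuousOn_auxPhase.mono hcreg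
  have hcq : ContinuousOn q (leftRegion C₁) := by
    have := continuousOn_auxSaddle.mono hcreg
    rw [hq]
    unfold saddleNome
    fun_prop
  have hce : Continuous e := by rw [he]; fun_prop
  have hcP : ContinuousOn P (leftRegion C₁) := by
    refine (continuousOn_const.mul hcφ.cexp).mul ((continuousOn_const.sub hce.continuousOn).mul
      ((continuousOn_const.sub hcq).div (continuousOn_const.add (hcq.pow 2)) fun s hs =>
        slitPlane_ne_zero (hs3 s hs)))
  have hs4 : ∀ s ∈ leftRegion C₁, riemannAux s / P s ∈ slitPlane := fun s hs => by
    obtain ⟨δ, hδ, h⟩ := hR s hs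
    rw [h]; exact one_add_mem_slitPlane_of_norm_lt (by linarith)
  -- Besides the phase there are four factors, each within distance one of `1` on the region; their
  -- principal logarithms are continuous there and contribute at most `π` each to the imaginary
  -- part.
  refine ⟨C₁, hC₁, K, hK0, fun s => auxPhase s + (Complex.log (1 - e s) + (Complex.log (1 - q s) -
    Complex.log (1 + q s ^ 2) + Complex.log (riemannAux s / P s))), ?_, ?_, ?_⟩
  · refine hcφ.add (((continuousOn_const.sub hce.continuousOn).clog hs1).add
      ((((continuousOn_const.sub hcq).clog hs2).sub
        ((continuousOn_const.add (hcq.pow 2)).clog hs3)).add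
          ((differentiable_riemannAux.continuous.continuousOn.div hcP hP0).clog hs4)))
  · intro s hs
    have h1 := slitPlane_ne_zero (hs1 s hs)
    have h2 := slitPlane_ne_zero (hs2 s hs)
    have h3 := slitPlane_ne_zero (hs3 s hs)
    have h4 := slitPlane_ne_zero (hs4 s hs)
    rw [Complex.exp_add, Complex.exp_add, Complex.exp_add, Complex.exp_sub, Complex.exp_log h1,
      Complex.exp_log h2, Complex.exp_log h3, Complex.exp_log h4]
    refine (mul_div_cancel₀ _ (hP0 s hs)).symm.trans ?_
    generalize riemannAux s / P s = W
    simp only [hP]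
    ring
  · intro s
    rw [add_sub_cancel_left, add_im, add_im, sub_im, log_im, log_im, log_im, log_im]
    have a1 := abs_le.mp (abs_arg_le_pi (1 - e s))
    have a2 := abs_le.mp (abs_arg_le_pi (1 - q s))
    have a3 := abs_le.mp (abs_arg_le_pi (1 + q s ^ 2))
    have a4 := abs_le.mp (abs_arg_le_pi (riemannAux s / P s))
    rw [abs_le]
    constructor <;> linarith

/-- For `σ = -X` the modulus of `s/(2πi)` exceeds `T/2π` by at most `X/2π`, so its logarithm changes
by at most `X/T`; the argument is bounded and multiplied by `X/2`; and `Re η` lies between `√(T/2π)`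
and `√(T/2π) + Im η` with `Im η ≤ X`. -/
theorem abs_auxPhase_im_add_le {X T : ℝ} (hX : 1 ≤ X) (hXT : X ≤ T) :
    |(auxPhase ⟨-X, T⟩).im + (T / 2 * Real.log (T / (2 * Real.pi)) - T / 2 -
      Real.pi * √(T / (2 * Real.pi)))| ≤ 10 * X := by
  have hpi := Real.pi_gt_three
  have hpi4 := Real.pi_lt_four
  have hT : 0 < T := by linarith
  set s : ℂ := ⟨-X, T⟩ with hs
  have hsre : s.re = -X := rfl
  have hsim : s.im = T := rfl
  obtain ⟨him, hle, e1, e2⟩ := auxSaddle_re_im (s := s) (by rw [hsre]; linarith) (by rw [hsim]; linarith)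
  set η := auxSaddle s with hη
  have hwre := div_two_pi_I_re s
  have hwim := div_two_pi_I_im s
  rw [hsre, neg_neg] at hwim
  rw [hsim] at hwre
  set w := s / (2 * Real.pi * I) with hw
  set A := √(T / (2 * Real.pi)) with hA
  have hA2 : A ^ 2 = T / (2 * Real.pi) := Real.sq_sqrt (by positivity)
  have hA0 : 0 ≤ A := Real.sqrt_nonneg _
  have hphase : (auxPhase s).im = X / 2 * arg w - T / 2 * Real.log ‖w‖ + T / 2 + Real.pi * η.re := by
    have hre2 : (s / 2).re = -X / 2 := div_ofReal_re s 2
    have him2 : (s / 2).im = T / 2 := div_ofReal_im s 2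
    rw [auxPhase, ← hη, ← hw, add_im, add_im, mul_im, neg_re, neg_im, log_re, log_im, hre2, him2, mul_assoc,
      im_ofReal_mul, I_mul_im]
    ring
  have hηA : η.re ^ 2 = A ^ 2 + η.im ^ 2 := by
    rw [hA2, ← hsim, ← e2]; field_simp; ring
  have hre : 0 < η.re := him.trans_le hle
  have h1 : A ≤ η.re := (pow_le_pow_iff_left₀ hA0 hre.le two_ne_zero).mp (by rw [hηA]; linarith [sq_nonneg η.im])
  have h2 : η.re ≤ A + η.im := (pow_le_pow_iff_left₀ hre.le (by positivity) two_ne_zero).mp (by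
    rw [hηA]; nlinarith)
  have h3 : 1 ≤ 4 * Real.pi * η.re := by
    refine le_of_pow_le_pow_left₀ two_ne_zero (by positivity) ?_
    have : 1 / (2 * Real.pi) ≤ η.re ^ 2 := by
      rw [hηA, hA2]
      have : 1 / (2 * Real.pi) ≤ T / (2 * Real.pi) := by gcongr; linarith
      linarith [sq_nonneg η.im]
    calc (1 : ℝ) ^ 2 ≤ 16 * Real.pi ^ 2 * (1 / (2 * Real.pi)) := by field_simp; linarith
      _ ≤ 16 * Real.pi ^ 2 * η.re ^ 2 := by gcongr
      _ = _ := by ring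
  have h4 : η.im ≤ X := by
    rw [hsre, neg_neg] at e1
    calc η.im ≤ 4 * Real.pi * η.re * η.im := le_mul_of_one_le_left him.le h3
      _ = X := e1
  have hw1 : T / (2 * Real.pi) ≤ ‖w‖ := by rw [← hwre]; exact (le_abs_self _).trans (abs_re_le_norm _)
  have hw2 : ‖w‖ ≤ T / (2 * Real.pi) + X / (2 * Real.pi) := by
    refine (norm_le_abs_re_add_abs_im w).trans ?_
    rw [hwre, hwim, abs_of_pos (by positivity), abs_of_pos (by positivity)]
  have hT2 : 0 < T / (2 * Real.pi) := by positivity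
  have h5 : Real.log (T / (2 * Real.pi)) ≤ Real.log ‖w‖ := Real.log_le_log hT2 hw1
  have h6 : Real.log ‖w‖ - Real.log (T / (2 * Real.pi)) ≤ X / T := by
    rw [← Real.log_div (hT2.trans_le hw1).ne' hT2.ne']
    refine (Real.log_le_sub_one_of_pos (div_pos (hT2.trans_le hw1) hT2)).trans ?_
    rw [sub_le_iff_le_add, div_le_iff₀ hT2]
    refine hw2.trans_eq ?_
    field_simp; ring
  have h7 : T / 2 * (Real.log ‖w‖ - Real.log (T / (2 * Real.pi))) ≤ X / 2 := by
    calc _ ≤ T / 2 * (X / T) := by gcongr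
      _ = X / 2 := by field_simp
  have h8 : 0 ≤ T / 2 * (Real.log ‖w‖ - Real.log (T / (2 * Real.pi))) :=
    mul_nonneg (by positivity) (by linarith)
  have h9 : |X / 2 * arg w| ≤ X / 2 * 4 := by
    rw [abs_mul, abs_of_pos (by positivity)]
    gcongr
    exact (abs_arg_le_pi w).trans hpi4.le
  have h10 : Real.pi * (η.re - A) ≤ 4 * X := by
    apply mul_le_mul hpi4.le (by linarith) (by linarith) (by norm_num)
  have h11 : 0 ≤ Real.pi * (η.re - A) := mul_nonneg (by linarith) (by linarith)
  rw [hphase, show X / 2 * arg w - T / 2 * Real.log ‖w‖ + T / 2 + Real.pi * η.re +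
    (T / 2 * Real.log (T / (2 * Real.pi)) - T / 2 - Real.pi * A) = X / 2 * arg w -
    T / 2 * (Real.log ‖w‖ - Real.log (T / (2 * Real.pi))) + Real.pi * (η.re - A) by ring]
  rw [abs_le] at h9 ⊢
  constructor <;> linarith

/-! ### Finiteness of the zeros and variation along the edges -/

theorem exists_riemannAux_ne_zero : ∃ c, riemannAux c ≠ 0 := by
  obtain ⟨t₁, -, h⟩ := exists_norm_riemannAux_sub_one_le
  refine ⟨⟨3, t₁⟩, fun h0 => ?_⟩
  have := h ⟨3, t₁⟩ le_rfl le_rfl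
  rw [h0, zero_sub, norm_neg, norm_one] at this
  norm_num at this

/-- For heights in `(0, T]` there are no zeros far to the right, nor far to the left, where every
point belongs to the left region once `-σ ≥ C₁ (1 + T²)`. The others lie in a compact rectangle. -/
theorem riemannAuxZeros_finite (T : ℝ) : (riemannAuxZeros T).Finite := by
  obtain ⟨c, hc⟩ := exists_riemannAux_ne_zero
  obtain ⟨σ₁, h₁⟩ := exists_riemannAux_ne_zero_right T
  obtain ⟨C₁, hC₁, K, hK, L, -, hL, -⟩ := exists_log_riemannAux_left
  set σ₂ := C₁ * (1 + T ^ 2) with hσ₂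
  have hσ₂C : C₁ ≤ σ₂ := le_mul_of_one_le_right (by linarith) (by linarith [sq_nonneg T])
  have hσ₂1 : 1 ≤ σ₂ := hC₁.trans hσ₂C
  have hσ₂T : C₁ * T ^ 2 ≤ σ₂ := by rw [hσ₂]; gcongr; linarith
  refine (finite_zeros_inter_isCompact differentiable_riemannAux hc
    ((isCompact_Icc (a := -σ₂) (b := σ₁)).reProdIm (isCompact_Icc (a := (0 : ℝ)) (b := T)))).subset ?_
  rintro s ⟨h0, hpos, hT⟩
  refine ⟨h0, mem_reProdIm.mpr ⟨⟨?_, ?_⟩, hpos.le, hT⟩⟩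
  · by_contra h
    push Not at h
    have h5 : σ₂ ≤ -s.re := by linarith
    have h6 : 1 ≤ -s.re := by linarith
    have hs : s ∈ leftRegion C₁ := by
      refine ⟨by linarith, hpos, ?_, ?_⟩
      · exact (hσ₂C.trans h5).trans (le_self_pow₀ h6 (by norm_num))
      · refine le_trans ?_ ((hσ₂T.trans h5).trans (le_self_pow₀ h6 (by norm_num)))
        have : s.im ^ 2 ≤ T ^ 2 := by gcongr
        gcongr
    exact mul_ne_zero hK (Complex.exp_ne_zero _) ((hL s hs).symm.trans h0)
  · by_contra h
    push Not at h
    exact h₁ s h.le (by rwa [abs_of_pos hpos]) h0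

theorem riemannAuxN_eq_add {t₀ T : ℝ} (hT : t₀ ≤ T)
    (hz : ∀ s, riemannAux s = 0 → s.im ≠ T) {S : Finset ℂ} (hS : (S : Set ℂ) = riemannAuxZeros (T + 1)) :
    riemannAuxN T = riemannAuxN t₀ +
      ∑ ρ ∈ S with t₀ < ρ.im ∧ ρ.im < T, analyticOrderNatAt riemannAux ρ := by
  have e : riemannAuxZeros T = riemannAuxZeros t₀ ∪ ↑(S.filter fun ρ => t₀ < ρ.im ∧ ρ.im < T) := by
    ext s
    rw [mem_union, Finset.mem_coe, Finset.mem_filter, ← Finset.mem_coe, hS]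
    constructor
    · rintro ⟨h1, h2, h3⟩
      rcases le_or_gt s.im t₀ with h | h
      · exact Or.inl ⟨h1, h2, h⟩
      · exact Or.inr ⟨⟨h1, h2, by linarith⟩, h, lt_of_le_of_ne h3 (hz s h1)⟩
    · rintro (⟨h1, h2, h3⟩ | ⟨⟨h1, h2, -⟩, -, h4⟩)
      · exact ⟨h1, h2, h3.trans hT⟩
      · exact ⟨h1, h2, h4.le⟩
  rw [riemannAuxN, e, finsum_mem_union ?_ (riemannAuxZeros_finite t₀) (Finset.finite_toSet _),
    finsum_mem_coe_finset, riemannAuxN]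
  refine Set.disjoint_left.mpr fun s hs h => ?_
  rw [Finset.mem_coe, Finset.mem_filter] at h
  exact (not_le.mpr h.2.1) hs.2.2

theorem segment_subset_reProdIm {a b : ℂ} {x₁ x₂ y₁ y₂ : ℝ} (ha : a ∈ Icc x₁ x₂ ×ℂ Icc y₁ y₂)
    (hb : b ∈ Icc x₁ x₂ ×ℂ Icc y₁ y₂) : segment ℝ a b ⊆ Icc x₁ x₂ ×ℂ Icc y₁ y₂ :=
  (((convex_Icc x₁ x₂).linear_preimage Complex.reLm).inter
    ((convex_Icc y₁ y₂).linear_preimage Complex.imLm)).segment_subset ha hb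

/-- Within `1/2` of `1` the principal logarithm of `R` is continuous, so any other logarithm varies
equally, by at most `2π`. -/
theorem exists_log_variation_right : ∃ t₁ : ℝ, 1 ≤ t₁ ∧ (∀ s, 3 ≤ s.re → t₁ ≤ s.im →
    1 / 2 ≤ ‖riemannAux s‖ ∧ ‖riemannAux s‖ ≤ 3 / 2) ∧ ∀ E : Set ℂ, IsPreconnected E →
    (∀ s ∈ E, 3 ≤ s.re ∧ t₁ ≤ s.im) → ∀ L : ℂ → ℂ, ContinuousOn L E →
    (∀ s ∈ E, Complex.exp (L s) = riemannAux s) → ∀ a ∈ E, ∀ b ∈ E, |(L b - L a).im| ≤ 2 * Real.pi := by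
  obtain ⟨t₁, ht₁, h⟩ := exists_norm_riemannAux_sub_one_le
  have hslit : ∀ s, 3 ≤ s.re → t₁ ≤ s.im → riemannAux s ∈ slitPlane := fun s h1 h2 => by
    rw [show riemannAux s = 1 + (riemannAux s - 1) by ring]
    exact one_add_mem_slitPlane_of_norm_lt ((h s h1 h2).trans_lt (by norm_num))
  refine ⟨t₁, ht₁, fun s h1 h2 => ?_, fun E hE hE2 L hL hLR a ha b hb => ?_⟩
  · have h3 := h s h1 h2
    have h4 := norm_sub_norm_le (1 : ℂ) (riemannAux s)
    have h5 := norm_sub_norm_le (riemannAux s) 1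
    rw [norm_sub_rev, norm_one] at h4
    rw [norm_one] at h5
    constructor <;> linarith
  · rw [sub_eq_sub_of_exp_eq_const_mul hE hL (L₂ := fun s => Complex.log (riemannAux s)) (K := 1)
      (differentiable_riemannAux.continuous.continuousOn.clog fun s hs => hslit s (hE2 s hs).1 (hE2 s hs).2)
      (fun s hs => by
        rw [hLR s hs, one_mul, Complex.exp_log (slitPlane_ne_zero (hslit s (hE2 s hs).1 (hE2 s hs).2))]) ha hb]
    rw [sub_im, log_im, log_im]
    have a1 := abs_le.mp (abs_arg_le_pi (riemannAux a))
    have a2 := abs_le.mp (abs_arg_le_pi (riemannAux b))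
    rw [abs_le]
    constructor <;> linarith

/-- Variation of the argument along the upper edge. -/
theorem exists_log_variation_top : ∃ t₁ C : ℝ, 1 ≤ C ∧ ∀ T X : ℝ, 1 ≤ X → 72 ≤ T → t₁ ≤ T →
    6 * X + 21 ≤ √(T / 2) / 3 → (∀ s, riemannAux s = 0 → s.im ≠ T) → ∀ L : ℂ → ℂ,
    ContinuousOn L (segment ℝ ⟨-X, T⟩ ⟨3, T⟩) →
    (∀ s ∈ segment ℝ (⟨-X, T⟩ : ℂ) ⟨3, T⟩, Complex.exp (L s) = riemannAux s) →
    |(L ⟨-X, T⟩ - L ⟨3, T⟩).im| ≤ C * (X * Real.log T) := by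
  obtain ⟨t₁, -, ht₁, -⟩ := exists_log_variation_right
  obtain ⟨C, hC, hR⟩ := exists_norm_riemannAux_le
  have hlogC : 0 ≤ Real.log (2 * C) := Real.log_nonneg (by linarith)
  refine ⟨t₁, 12 * (Real.log (2 * C) + 28), by linarith, ?_⟩
  intro T X hX hT hTt hXT hz L hL hLR
  set c : ℂ := ⟨3, T⟩ with hc
  set a : ℂ := ⟨-X, T⟩ with ha
  obtain ⟨hc1, hc2⟩ := ht₁ c le_rfl hTt
  have hsq : √(T / 2) ≤ T / 2 := by
    rw [Real.sqrt_le_left (by linarith)]; nlinarith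
  -- In the disc of radius `6(X + 3)` about `3 + iT` one has `|σ| ≤ 6X + 21`; the growth bound adds
  -- `1` to the exponent.
  have hM : ∀ s ∈ Metric.closedBall c (6 * (X + 3)), ‖riemannAux s‖ ≤ C * T ^ (6 * X + 22) := by
    intro s hs
    rw [mem_closedBall_iff_norm] at hs
    have h1 := (abs_re_le_norm (s - c)).trans hs
    have h2 := (abs_im_le_norm (s - c)).trans hs
    have ec : c.re = 3 := rfl
    have ec' : c.im = T := rfl
    rw [sub_re, ec, abs_le] at h1
    rw [sub_im, ec', abs_le] at h2
    have h3 : |s.re| ≤ 6 * X + 21 := by rw [abs_le]; constructor <;> linarith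
    have h4 : T / 2 ≤ s.im := by linarith
    have h5 : s.im ≤ 2 * T := by linarith
    have h6 : √(T / 2) ≤ √s.im := Real.sqrt_le_sqrt h4
    refine (hR s (by linarith) (by linarith)).trans ?_
    have h7 : 1 ≤ √s.im := Real.one_le_sqrt.mpr (by linarith)
    have h8 : √s.im ≤ T := by
      rw [Real.sqrt_le_left (by linarith)]
      nlinarith
    gcongr
    calc √s.im ^ (|s.re| + 1) ≤ √s.im ^ (6 * X + 22) := by
          apply Real.rpow_le_rpow_of_exponent_le h7; linarith
      _ ≤ T ^ (6 * X + 22) := by gcongr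
  have hTM : T ≤ C * T ^ (6 * X + 22) := by
    calc T = 1 * T ^ (1 : ℝ) := by rw [Real.rpow_one, one_mul]
      _ ≤ C * T ^ (6 * X + 22) := by
        gcongr
        · linarith
        · linarith
  have hac : ‖a - c‖ ≤ X + 3 := by
    have e : a - c = ((-(X + 3) : ℝ) : ℂ) := by
      apply Complex.ext <;> simp [ha, hc]; ring
    rw [e, norm_real, Real.norm_eq_abs, abs_neg, abs_of_pos (by linarith)]
  refine (abs_log_variation_le_of_norm_le differentiable_riemannAux (c := c) (r := X + 3) (by linarith) hM
    (by linarith) (a := a) rfl hac hz hL hLR).trans ?_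
  have hlogT : 1 ≤ Real.log T := by
    rw [Real.le_log_iff_exp_le (by linarith)]
    linarith [Real.exp_one_lt_d9]
  have h1 : Real.log (C * T ^ (6 * X + 22) / ‖riemannAux c‖) ≤ Real.log (2 * C) + (6 * X + 22) * Real.log T := by
    have h2 : C * T ^ (6 * X + 22) / ‖riemannAux c‖ ≤ 2 * C * T ^ (6 * X + 22) := by
      rw [div_le_iff₀ (by linarith)]
      have : 0 ≤ C * T ^ (6 * X + 22) := by linarith
      nlinarith
    refine (Real.log_le_log (div_pos (by linarith) (by linarith)) h2).trans_eq ?_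
    rw [Real.log_mul (by linarith) (Real.rpow_pos_of_pos (by linarith) _).ne', Real.log_rpow (by linarith)]
  have h2 : 1 ≤ X * Real.log T := one_le_mul_of_one_le_of_one_le hX hlogT
  have h3 : Real.log (2 * C) ≤ Real.log (2 * C) * (X * Real.log T) := le_mul_of_one_le_right hlogC h2
  have h4 : Real.log T ≤ X * Real.log T := le_mul_of_one_le_left (by linarith) hX
  linarith

theorem exists_log_variation_left : ∃ C₁ : ℝ, 1 ≤ C₁ ∧ (∀ s ∈ leftRegion C₁, riemannAux s ≠ 0) ∧
    ∀ E : Set ℂ, IsPreconnected E → E ⊆ leftRegion C₁ → ∀ (K : ℂ) (L : ℂ → ℂ), ContinuousOn L E →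
    (∀ s ∈ E, Complex.exp (L s) = K * riemannAux s) → ∀ a ∈ E, ∀ b ∈ E,
    |(L b - L a).im - (auxPhase b - auxPhase a).im| ≤ 8 * Real.pi := by
  obtain ⟨C₁, hC₁, K₀, hK₀, L₀, hL₀, hR, hφ⟩ := exists_log_riemannAux_left
  refine ⟨C₁, hC₁, fun s hs => ?_, fun E hE hEr K L hL hLR a ha b hb => ?_⟩
  · rw [hR s hs]; exact mul_ne_zero hK₀ (Complex.exp_ne_zero _)
  · rw [sub_eq_sub_of_exp_eq_const_mul hE hL (L₂ := L₀) (K := K * K₀) (hL₀.mono hEr)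
      (fun s hs => by rw [hLR s hs, hR s (hEr hs), mul_assoc]) ha hb]
    have h1 := abs_le.mp (hφ a)
    have h2 := abs_le.mp (hφ b)
    simp only [sub_im] at h1 h2 ⊢
    rw [abs_le]
    constructor <;> linarith

theorem exists_height_ne (t : ℝ) : ∃ t₀, t < t₀ ∧ 0 < t₀ ∧ ∀ s, riemannAux s = 0 → s.im ≠ t₀ := by
  obtain ⟨t₀, ht₀, h⟩ := (Ioo_infinite (lt_add_one (max t 0))).exists_notMem_finite
    ((riemannAuxZeros_finite (max t 0 + 1)).image Complex.im)
  have h0 : 0 < t₀ := (le_max_right t 0).trans_lt ht₀.1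
  refine ⟨t₀, (le_max_left _ _).trans_lt ht₀.1, h0, fun s hs he => h ⟨s, ⟨hs, ?_, ?_⟩, he⟩⟩
  · rwa [he]
  · rw [he]; exact ht₀.2.le

theorem sub_mem_slitPlane_of_im_ne {s ρ : ℂ} (h : ρ.im ≠ s.im) : s - ρ ∈ slitPlane :=
  mem_slitPlane_iff.mpr (Or.inr (by rw [sub_im]; exact sub_ne_zero.mpr h.symm))

/-! ### The counting formula and the choice of `X` -/

/-- The counting formula with an explicit error, at heights free of zeros. -/
theorem exists_abs_riemannAuxN_sub_le : ∃ t₀ X₀ C₁ C : ℝ, 72 ≤ t₀ ∧ 1 ≤ X₀ ∧ 0 ≤ C ∧ ∀ T X : ℝ, t₀ ≤ T →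
    X₀ ≤ X → X ≤ T → C₁ * T ^ 2 ≤ X ^ 5 → 6 * X + 21 ≤ √(T / 2) / 3 →
    (∀ s, riemannAux s = 0 → s.im ≠ T) →
    |2 * Real.pi * riemannAuxN T - (T / 2 * Real.log (T / (2 * Real.pi)) - T / 2 -
      Real.pi * √(T / (2 * Real.pi)))| ≤ C * (X * Real.log T) := by
  obtain ⟨t₁, ht₁, hbd, hright⟩ := exists_log_variation_right
  obtain ⟨t₂, C₂, hC₂, htop⟩ := exists_log_variation_top
  obtain ⟨C₁, hC₁, hnz, hleft⟩ := exists_log_variation_left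
  obtain ⟨t₀, ht₀, ht₀pos, ht₀z⟩ := exists_height_ne (max (max t₁ t₂) 72)
  have ht01 : t₁ ≤ t₀ := ((le_max_left _ _).trans (le_max_left _ _)).trans ht₀.le
  have ht02 : t₂ ≤ t₀ := ((le_max_right _ _).trans (le_max_left _ _)).trans ht₀.le
  have ht072 : 72 ≤ t₀ := (le_max_right _ _).trans ht₀.le
  -- So large that the whole half-line at height `t₀` to the left of `-X₀` lies in the left region.
  -- The lower edge proper then ends at `-X₀`, independently of `T`.
  set X₀ := C₁ * (1 + t₀ ^ 2) with hX₀
  have hX₀C : C₁ ≤ X₀ := le_mul_of_one_le_right (by linarith) (by linarith [sq_nonneg t₀])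
  have hX₀1 : 1 ≤ X₀ := hC₁.trans hX₀C
  have hX₀T : C₁ * t₀ ^ 2 ≤ X₀ := by rw [hX₀]; gcongr; linarith
  -- The logarithm used below depends on `T`, but its variation along this fixed segment does not,
  -- so `C₃` can be fixed before `T`.
  obtain ⟨C₃, hC₃⟩ := exists_log_variation_le
    (convex_segment (⟨-X₀, t₀⟩ : ℂ) ⟨3, t₀⟩).isPreconnected riemannAux (right_mem_segment ℝ _ _)
    (left_mem_segment ℝ _ _)
  set D := 10 * Real.pi + |C₃| + |(auxPhase ⟨-X₀, t₀⟩).im| + 2 * Real.pi * riemannAuxN t₀ with hD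
  have hD0 : 0 ≤ D := by positivity
  refine ⟨t₀, X₀, C₁, C₂ + 10 + D, ht072, hX₀1, by linarith, ?_⟩
  intro T X hT hX hXT hXT2 hXT3 hz
  have hfin := riemannAuxZeros_finite (T + 1)
  set S := hfin.toFinset with hS
  have hmem : ∀ ρ, ρ ∈ S ↔ ρ ∈ riemannAuxZeros (T + 1) := fun ρ => hfin.mem_toFinset
  set Dm : Set ℂ := {s | 0 < s.im ∧ s.im < T + 1} with hDm
  have hDconv : Convex ℝ Dm := (convex_Ioo (0 : ℝ) (T + 1)).linear_preimage Complex.imLm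
  have hDopen : IsOpen Dm := isOpen_Ioo.preimage Complex.continuous_im
  obtain ⟨c₀, hc₀⟩ := exists_riemannAux_ne_zero
  -- One `g` on the convex strip serves both logarithms, hence cancels when their variations are
  -- subtracted.
  obtain ⟨G, g, -, hg, hfG, hGg⟩ := exists_eq_prod_mul_exp differentiable_riemannAux hc₀ hDconv hDopen S
    (fun s hs h => (hmem s).mpr ⟨h, hs.1, hs.2.le⟩)
  set m := fun ρ => analyticOrderNatAt riemannAux ρ with hm
  have hzS : ∀ ρ ∈ S, riemannAux ρ = 0 := fun ρ hρ => ((hmem ρ).mp hρ).1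
  have hST : ∀ ρ ∈ S, ρ.im ≠ T := fun ρ hρ => hz ρ (hzS ρ hρ)
  have hSt : ∀ ρ ∈ S, ρ.im ≠ t₀ := fun ρ hρ => ht₀z ρ (hzS ρ hρ)
  -- the two logarithms
  have expR : ∀ s ∈ Dm, s ∉ S → Complex.exp (logProdRight S m s + g s) = riemannAux s := fun s hs hsS => by
    rw [Complex.exp_add, exp_logProdRight hsS, hfG s, hGg s hs]
  have expL : ∀ s ∈ Dm, s ∉ S → Complex.exp (logProdLeft S m s + g s) =
      (-1) ^ (∑ ρ ∈ S, m ρ) * riemannAux s := fun s hs hsS => by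
    rw [Complex.exp_add, exp_logProdLeft hsS, hfG s, hGg s hs, mul_assoc]
  have contR : ∀ E ⊆ Dm, (∀ s ∈ E, ∀ ρ ∈ S, s - ρ ∈ slitPlane) →
      ContinuousOn (fun s => logProdRight S m s + g s) E := fun E hE h =>
    (continuousOn_logProdRight m h).add (hg.continuousOn.mono hE)
  have notS : ∀ s, (∀ ρ ∈ S, s - ρ ∈ slitPlane) → s ∉ S := fun s h hs => by
    simpa using slitPlane_ne_zero (h s hs)
  -- the upper edge
  have subtop : segment ℝ (⟨-X, T⟩ : ℂ) ⟨3, T⟩ ⊆ Icc (-X) 3 ×ℂ Icc T T := by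
    apply segment_subset_reProdIm <;> simp [mem_reProdIm] <;> linarith
  have imtop : ∀ s ∈ segment ℝ (⟨-X, T⟩ : ℂ) ⟨3, T⟩, s.im = T := fun s hs =>
    le_antisymm (subtop hs).2.2 (subtop hs).2.1
  have slittop : ∀ s ∈ segment ℝ (⟨-X, T⟩ : ℂ) ⟨3, T⟩, ∀ ρ ∈ S, s - ρ ∈ slitPlane := fun s hs ρ hρ =>
    sub_mem_slitPlane_of_im_ne (by rw [imtop s hs]; exact hST ρ hρ)
  have Dtop : segment ℝ (⟨-X, T⟩ : ℂ) ⟨3, T⟩ ⊆ Dm := fun s hs => by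
    rw [hDm, mem_ofPred_eq, imtop s hs]; constructor <;> linarith
  have vtop := htop T X (by linarith) (by linarith) (by linarith) hXT3 hz _ (contR _ Dtop slittop)
    (fun s hs => expR s (Dtop hs) (notS s (slittop s hs)))
  -- the right edge
  have subright : segment ℝ (⟨3, t₀⟩ : ℂ) ⟨3, T⟩ ⊆ Icc 3 3 ×ℂ Icc t₀ T := by
    apply segment_subset_reProdIm <;> simp [mem_reProdIm] <;> linarith
  -- A cut running left could meet the right edge only from a zero with `σ ≥ 3`, where `‖R‖ ≥ 1/2`.
  have slitright : ∀ s ∈ segment ℝ (⟨3, t₀⟩ : ℂ) ⟨3, T⟩, ∀ ρ ∈ S, s - ρ ∈ slitPlane := fun s hs ρ hρ => by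
    have h1 := (subright hs).1.1
    have h2 := (subright hs).2.1
    rcases eq_or_ne ρ.im s.im with h | h
    · refine mem_slitPlane_iff.mpr (Or.inl ?_)
      by_contra h3
      rw [sub_re, sub_pos, not_lt] at h3
      have := (hbd ρ (h1.trans h3) (by rw [h]; exact ht01.trans h2)).1
      rw [hzS ρ hρ, norm_zero] at this
      norm_num at this
    · exact sub_mem_slitPlane_of_im_ne h
  have Dright : segment ℝ (⟨3, t₀⟩ : ℂ) ⟨3, T⟩ ⊆ Dm := fun s hs =>
    ⟨by linarith [(subright hs).2.1], by linarith [(subright hs).2.2]⟩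
  have vright := hright _ (convex_segment (⟨3, t₀⟩ : ℂ) ⟨3, T⟩).isPreconnected
    (fun s hs => ⟨(subright hs).1.1, ht01.trans (subright hs).2.1⟩) _ (contR _ Dright slitright)
    (fun s hs => expR s (Dright hs) (notS s (slitright s hs))) _ (left_mem_segment ℝ _ _) _
    (right_mem_segment ℝ _ _)
  -- the lower edge
  have subbot : segment ℝ (⟨-X₀, t₀⟩ : ℂ) ⟨3, t₀⟩ ⊆ Icc (-X₀) 3 ×ℂ Icc t₀ t₀ := by
    apply segment_subset_reProdIm <;> simp [mem_reProdIm] <;> linarith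
  have imbot : ∀ s ∈ segment ℝ (⟨-X₀, t₀⟩ : ℂ) ⟨3, t₀⟩, s.im = t₀ := fun s hs =>
    le_antisymm (subbot hs).2.2 (subbot hs).2.1
  have slitbot : ∀ s ∈ segment ℝ (⟨-X₀, t₀⟩ : ℂ) ⟨3, t₀⟩, ∀ ρ ∈ S, s - ρ ∈ slitPlane := fun s hs ρ hρ =>
    sub_mem_slitPlane_of_im_ne (by rw [imbot s hs]; exact hSt ρ hρ)
  have Dbot : segment ℝ (⟨-X₀, t₀⟩ : ℂ) ⟨3, t₀⟩ ⊆ Dm := fun s hs => by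
    rw [hDm, mem_ofPred_eq, imbot s hs]; constructor <;> linarith
  have vbot := hC₃ _ (contR _ Dbot slitbot) (fun s hs => expR s (Dbot hs) (notS s (slitbot s hs)))
  -- the left edge
  set E := segment ℝ (⟨-X, t₀⟩ : ℂ) ⟨-X₀, t₀⟩ ∪ segment ℝ (⟨-X, t₀⟩ : ℂ) ⟨-X, T⟩ with hE
  have hEpre : IsPreconnected E := (convex_segment _ _).isPreconnected.union (⟨-X, t₀⟩ : ℂ)
    (left_mem_segment ℝ _ _) (left_mem_segment ℝ _ _) (convex_segment _ _).isPreconnected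
  have sub1 : segment ℝ (⟨-X, t₀⟩ : ℂ) ⟨-X₀, t₀⟩ ⊆ Icc (-X) (-X₀) ×ℂ Icc t₀ t₀ := by
    apply segment_subset_reProdIm <;> simp [mem_reProdIm] <;> linarith
  have sub2 : segment ℝ (⟨-X, t₀⟩ : ℂ) ⟨-X, T⟩ ⊆ Icc (-X) (-X) ×ℂ Icc t₀ T := by
    apply segment_subset_reProdIm <;> simp [mem_reProdIm] <;> linarith
  have hEreg : E ⊆ leftRegion C₁ := by
    rintro s (hs | hs)
    · obtain ⟨⟨h1, h2⟩, h3, h4⟩ := sub1 hs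
      have h5 : s.im = t₀ := le_antisymm h4 h3
      have h6 : X₀ ≤ -s.re := by linarith
      have h7 : 1 ≤ -s.re := by linarith
      refine ⟨by linarith, by linarith, ?_, ?_⟩
      · exact (hX₀C.trans h6).trans (le_self_pow₀ h7 (by norm_num))
      · rw [h5]; exact (hX₀T.trans h6).trans (le_self_pow₀ h7 (by norm_num))
    · obtain ⟨⟨h1, h2⟩, h3, h4⟩ := sub2 hs
      have h5 : -s.re = X := by linarith
      refine ⟨by linarith, by linarith, ?_, ?_⟩
      · rw [h5]; exact (hX₀C.trans hX).trans (le_self_pow₀ (by linarith) (by norm_num))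
      · rw [h5]
        refine le_trans ?_ hXT2
        gcongr
        linarith
  have hED : E ⊆ Dm := by
    rintro s (hs | hs)
    · exact ⟨by linarith [(sub1 hs).2.1], by linarith [(sub1 hs).2.2]⟩
    · exact ⟨by linarith [(sub2 hs).2.1], by linarith [(sub2 hs).2.2]⟩
  have slitL : ∀ s ∈ E, ∀ ρ ∈ S, ρ - s ∈ slitPlane := fun s hs ρ hρ => by
    rcases eq_or_ne ρ.im s.im with h | h
    · refine mem_slitPlane_iff.mpr (Or.inl ?_)
      by_contra h3
      rw [sub_re, sub_pos, not_lt] at h3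
      exact hnz ρ (mem_leftRegion_of_re_le (hEreg hs) h h3) (hzS ρ hρ)
    · exact sub_mem_slitPlane_of_im_ne h.symm
  have vleft := hleft E hEpre hEreg _ (fun s => logProdLeft S m s + g s)
    ((continuousOn_logProdLeft m slitL).add (hg.continuousOn.mono hED))
    (fun s hs => expL s (hED hs) fun h => by simpa using slitPlane_ne_zero (slitL s hs s h))
    ⟨-X₀, t₀⟩ (Or.inl (right_mem_segment ℝ _ _)) ⟨-X, T⟩ (Or.inr (right_mem_segment ℝ _ _))
  -- conclusion
  have hcount := two_pi_mul_sum_eq (S := S) m (A := ⟨-X₀, t₀⟩) (B := ⟨-X, T⟩) hSt hST hT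
  have hN := riemannAuxN_eq_add hT hz (S := S) hfin.coe_toFinset
  have hN' : (riemannAuxN T : ℝ) = riemannAuxN t₀ + ∑ ρ ∈ S with t₀ < ρ.im ∧ ρ.im < T, (m ρ : ℝ) := by
    rw [hN]; push_cast; rfl
  have hphase := abs_auxPhase_im_add_le (hX₀1.trans hX) hXT
  have hlogT : 1 ≤ Real.log T := by
    rw [Real.le_log_iff_exp_le (by linarith)]
    linarith [Real.exp_one_lt_d9]
  have hXlog : X ≤ X * Real.log T := le_mul_of_one_le_right (by linarith) hlogT
  have hDlog : D ≤ D * (X * Real.log T) := le_mul_of_one_le_right hD0 (by linarith)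
  -- The number of zeros between the heights is now the variation along lower, right and upper edges
  -- minus that along the left edge. The latter is the phase difference, whose negative is the main
  -- term.
  rw [hN', mul_add, hcount]
  rw [hD] at hDlog
  have n1 := le_abs_self C₃
  have n2 := neg_abs_le C₃
  have n3 := le_abs_self (auxPhase ⟨-X₀, t₀⟩).im
  have n4 := neg_abs_le (auxPhase ⟨-X₀, t₀⟩).im
  have n5 : 0 ≤ 2 * Real.pi * (riemannAuxN t₀ : ℝ) := by positivity
  simp only [add_im, sub_im] at vtop vright vbot vleft ⊢
  rw [abs_le] at vtop vright vbot vleft hphase ⊢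
  constructor <;> linarith

/-- There are finitely many zeros up to height `T + 1`, so just above `T` no zero occurs. This
reaches heights `T` that do carry zeros as limits from above. -/
theorem eventually_riemannAuxZeros_eq (T : ℝ) : ∀ᶠ T' in 𝓝[>] T,
    riemannAuxZeros T' = riemannAuxZeros T ∧ ∀ s, 0 < T → riemannAux s = 0 → s.im ≠ T' := by
  have h1 : ∀ᶠ T' in 𝓝[>] T, ∀ ρ ∈ riemannAuxZeros (T + 1), T < ρ.im → T' < ρ.im := by
    rw [eventually_all_finite (riemannAuxZeros_finite (T + 1))]
    intro ρ _
    by_cases h : T < ρ.im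
    · filter_upwards [nhdsWithin_le_nhds (eventually_lt_nhds h)] with T' hT' _ using hT'
    · exact Eventually.of_forall fun T' h' => (h h').elim
  filter_upwards [h1, self_mem_nhdsWithin, nhdsWithin_le_nhds (eventually_lt_nhds (lt_add_one T))]
    with T' h2 h3 h4
  have h3 : T < T' := h3
  refine ⟨Subset.antisymm ?_ fun s hs => ⟨hs.1, hs.2.1, hs.2.2.trans h3.le⟩, ?_⟩
  · rintro s ⟨hs, hpos, hle⟩
    refine ⟨hs, hpos, ?_⟩
    by_contra h
    push Not at h
    exact absurd hle (not_le.mpr (h2 s ⟨hs, hpos, hle.trans h4.le⟩ h))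
  · intro s hT hs he
    have := h2 s ⟨hs, by linarith, by linarith⟩ (by linarith)
    linarith

/-- The choice `X = T^{2/5} log T`. The left region asks for `X^5 ≥ C₁ T²`, where the factor `log T`
outgrows `C₁`; the upper edge asks for `X` small against `√T`, which holds since `log T =
o(T^{1/10})`. -/
theorem eventually_edge_conditions (X₀ C₁ : ℝ) : ∀ᶠ T : ℝ in atTop,
    X₀ ≤ T ^ (2 / 5 : ℝ) * Real.log T ∧ T ^ (2 / 5 : ℝ) * Real.log T ≤ T ∧
    C₁ * T ^ 2 ≤ (T ^ (2 / 5 : ℝ) * Real.log T) ^ 5 ∧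
    6 * (T ^ (2 / 5 : ℝ) * Real.log T) + 21 ≤ √(T / 2) / 3 := by
  have h1 : Tendsto (fun T : ℝ => T ^ (2 / 5 : ℝ) * Real.log T) atTop atTop :=
    (tendsto_rpow_atTop (by norm_num)).atTop_mul_atTop₀ Real.tendsto_log_atTop
  have h2 := (isLittleO_log_rpow_atTop (show (0 : ℝ) < 1 / 10 by norm_num)).def
    (show (0 : ℝ) < 1 / 100 by norm_num)
  filter_upwards [h1.eventually_ge_atTop X₀, h1.eventually_ge_atTop 21, h2, eventually_ge_atTop 2,
    Real.tendsto_log_atTop.eventually_ge_atTop (max C₁ 1)] with T hX₀ hX21 hlog hT hlogC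
  have hT0 : 0 < T := by linarith
  have hlog1 : 1 ≤ Real.log T := (le_max_right _ _).trans hlogC
  rw [Real.norm_of_nonneg (by linarith), Real.norm_of_nonneg (by positivity)] at hlog
  set X := T ^ (2 / 5 : ℝ) * Real.log T with hX
  have hX2 : X ≤ √T / 100 := by
    calc X ≤ T ^ (2 / 5 : ℝ) * (1 / 100 * T ^ (1 / 10 : ℝ)) := by rw [hX]; gcongr
      _ = T ^ (2 / 5 + 1 / 10 : ℝ) / 100 := by rw [Real.rpow_add hT0]; ring
      _ = √T / 100 := by rw [Real.sqrt_eq_rpow]; norm_num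
  have hs : √T / 2 ≤ √(T / 2) := by
    refine Real.le_sqrt_of_sq_le ?_
    rw [div_pow, Real.sq_sqrt hT0.le]; linarith
  have hsT : √T ≤ T := by
    rw [Real.sqrt_le_left hT0.le]; nlinarith
  refine ⟨hX₀, by linarith, ?_, by linarith⟩
  have e : X ^ 5 = T ^ 2 * Real.log T ^ 5 := by
    rw [hX, mul_pow, ← Real.rpow_natCast (T ^ (2 / 5 : ℝ)), ← Real.rpow_mul hT0.le]
    norm_num
  rw [e, mul_comm]
  gcongr
  exact ((le_max_left _ _).trans hlogC).trans (le_self_pow₀ hlog1 (by norm_num))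

theorem mainTheorem3 :
    (∀ T : ℝ, (riemannAuxZeros T).Finite) ∧
    (fun T : ℝ => (riemannAuxN T : ℝ) -
        (T / (4 * Real.pi) * Real.log (T / (2 * Real.pi)) - T / (4 * Real.pi)
          - 1 / 2 * Real.sqrt (T / (2 * Real.pi))))
      =O[atTop] (fun T : ℝ => T ^ (2 / 5 : ℝ) * Real.log T ^ 2) := by
  refine ⟨riemannAuxZeros_finite, ?_⟩
  obtain ⟨t₀, X₀, C₁, C, ht₀, hX₀, hC, hmain⟩ := exists_abs_riemannAuxN_sub_le
  obtain ⟨T₁, hT₁⟩ := eventually_atTop.mp (eventually_edge_conditions X₀ C₁)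
  refine IsBigO.of_bound (C / (2 * Real.pi)) ?_
  filter_upwards [eventually_ge_atTop t₀, eventually_ge_atTop T₁] with T hT0 hT1
  have hTpos : 0 < T := by linarith
  have hpi := Real.pi_pos
  have key : |2 * Real.pi * riemannAuxN T - (T / 2 * Real.log (T / (2 * Real.pi)) - T / 2 -
      Real.pi * √(T / (2 * Real.pi)))| ≤ C * (T ^ (2 / 5 : ℝ) * Real.log T * Real.log T) := by
    -- The count is constant just above `T` and both sides of the bound are continuous in the
    -- height, so the estimate at zero-free heights passes to the limit.
    have hev : ∀ᶠ T' in 𝓝[>] T, |2 * Real.pi * riemannAuxN T - (T' / 2 * Real.log (T' / (2 * Real.pi)) -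
        T' / 2 - Real.pi * √(T' / (2 * Real.pi)))| ≤
        C * (T' ^ (2 / 5 : ℝ) * Real.log T' * Real.log T') := by
      filter_upwards [eventually_riemannAuxZeros_eq T, self_mem_nhdsWithin] with T' h1 h2
      have h2 : T < T' := h2
      obtain ⟨a1, a2, a3, a4⟩ := hT₁ T' (by linarith)
      have := hmain T' _ (by linarith) a1 a2 a3 a4 fun s hs => h1.2 s hTpos hs
      rwa [riemannAuxN, h1.1, ← riemannAuxN] at this
    have hdiv : T / (2 * Real.pi) ≠ 0 := by positivity
    have c1 : ContinuousAt (fun T' : ℝ => |2 * Real.pi * riemannAuxN T - (T' / 2 *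
        Real.log (T' / (2 * Real.pi)) - T' / 2 - Real.pi * √(T' / (2 * Real.pi)))|) T := by
      fun_prop (disch := assumption)
    have c2 : ContinuousAt (fun T' : ℝ => C * (T' ^ (2 / 5 : ℝ) * Real.log T' * Real.log T')) T := by
      have h3 : ContinuousAt (fun T' : ℝ => T' ^ (2 / 5 : ℝ)) T :=
        Real.continuousAt_rpow_const _ _ (Or.inl hTpos.ne')
      have h4 := Real.continuousAt_log hTpos.ne'
      exact continuousAt_const.mul ((h3.mul h4).mul h4)
    exact le_of_tendsto_of_tendsto (c1.tendsto.mono_left nhdsWithin_le_nhds)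
      (c2.tendsto.mono_left nhdsWithin_le_nhds) hev
  have e1 : (riemannAuxN T : ℝ) - (T / (4 * Real.pi) * Real.log (T / (2 * Real.pi)) - T / (4 * Real.pi) -
      1 / 2 * √(T / (2 * Real.pi))) = (2 * Real.pi * riemannAuxN T - (T / 2 * Real.log (T / (2 * Real.pi)) -
      T / 2 - Real.pi * √(T / (2 * Real.pi)))) / (2 * Real.pi) := by
    field_simp
    ring
  have hlog : 0 ≤ T ^ (2 / 5 : ℝ) * Real.log T ^ 2 := by positivity
  rw [e1, Real.norm_eq_abs, Real.norm_of_nonneg hlog, abs_div, abs_of_pos (show 0 < 2 * Real.pi by positivity)]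
  exact (div_le_div_of_nonneg_right key (by positivity)).trans_eq (by ring)
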